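/- Let $\mathcal H$ be a right quaternionic Hilbert space, with inner product $\langle\cdot,\cdot\rangle$ right linear in its second variable, and let $T$ be a bounded right $\mathbb H$-linear operator on $\mathcal H$. For $q\in\mathbb H$ put $\Delta_q(T)=T^2-2\,\mathrm{re}(q)\,T+|q|^2I$, and let $\sigma_S(T)=\{q\in\mathbb H:\Delta_q(T)\text{ is not invertible in }\mathcal B(\mathcal H)\}$ be the spherical spectrum of $T$. A set $K\subseteq\mathbb H$ is axially symmetric if $q\in K$, $\mathrm{re}(p)=\mathrm{re}(q)$ and $|\mathrm{im}(p)|=|\mathrm{im}(q)|$ imply $p\in K$. Let $\sigma_S(T)=\sigma\cup\tau$, where $\sigma$ and $\tau$ are disjoint, nonempty, closed and axially symmetric. Then there are bounded right linear operators $P_\sigma,P_\tau$ on $\mathcal H$ with the following properties. 1. (Riesz projections of the $S$-functional calculus.) Fix a Hilbert basis $\mathcal N$ of $\mathcal H$, write $q\cdot I$ for the operator $x\mapsto\sum_{z\in\mathcal N}z\,q\,\langle z,x\rangle$, and put $q\cdot A=(q\cdot I)A$, $A\cdot q=A(q\cdot I)$ for $q\in\mathbb H$ and operators $A$. Let $S_R^{-1}(s,T)=-(T-\overline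 s\cdot I)\Delta_s(T)^{-1}$ and $S_L^{-1}(s,T)=-\Delta_s(T)^{-1}(T-\overline s\cdot I)$ for $s\notin\sigma_S(T)$. Let $m\in\mathbb H$ with $m^2=-1$, let $\mathbb C_m=\mathbb R+m\mathbb R$, and let $U_\sigma\subset\mathbb H$ be a bounded, axially symmetric, open set such that $\sigma\subset U_\sigma$, $\overline{U_\sigma}\cap\tau=\emptyset$, and the boundary of $U_\sigma\cap\mathbb C_m$ in $\mathbb C_m$ consists of finitely many $C^1$ arcs, oriented so that their total winding number is $1$ around each point of $U_\sigma\cap\mathbb C_m$ and $0$ around each point of $\mathbb C_m$ outside the closure of $U_\sigma\cap\mathbb C_m$. Then, with $ds_m=-ds\,m$, $$P_\sigma=\frac1{2\pi}\int_{\partial(U_\sigma\cap\mathbb C_m)}ds_m\,S_R^{-1}(s,T)=\frac1{2\pi}\int_{\partial(U_\sigma\cap\mathbb C_m)}S_L^{-1}(s,T)\,ds_m ,$$ for every choice of $\mathcal N$, $m$ and $U_\sigma$. Hilbert bases exist, and for every $m$ such sets $U_\sigma$ exist. The same holds for $P_\tau$, with $\sigma$ and $\tau$ exchanged. 2. $P_\sigma^2=P_\sigma$,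 $P_\tau^2=P_\tau$, $P_\sigma+P_\tau=I$, $TP_\sigma=P_\sigma T$ and $TP_\tau=P_\tau T$. 3. The ranges $\mathcal M_\sigma=R(P_\sigma)$ and $\mathcal M_\tau=R(P_\tau)$ are closed subspaces, invariant under $T$ and different from $\{0\}$ and $\mathcal H$; $\mathcal H=\mathcal M_\sigma\oplus\mathcal M_\tau$ is their (not necessarily orthogonal) direct sum; and $$\sigma_S(T|_{\mathcal M_\sigma})=\sigma,\qquad \sigma_S(T|_{\mathcal M_\tau})=\tau .$$ -/

import Mathlib

open scoped Quaternion RightActions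

/-- An inner product on a right quaternionic module `H` (right multiplication `x <• q`), which
induces the norm of `H`. Together with `CompleteSpace H` this is a right quaternionic Hilbert
space. -/
class QuaternionicInnerProductSpace (H : Type*) [NormedAddCommGroup H] [Module ℍᵐᵒᵖ H] where
  /-- The quaternion-valued inner product. -/
  qinner : H → H → ℍ
  /-- `⟨x, x⟩` is real and nonnegative, and it is the square of the norm. -/
  qinner_self : ∀ x : H, qinner x x = ((‖x‖ ^ 2 : ℝ) : ℍ)
  /-- Right linearity in the second variable. -/
  qinner_right : ∀ (x y z : H) (q : ℍ), qinner x (y <• q + z) = qinner x y * q + qinner x z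
  /-- Quaternionic Hermiticity. -/
  qinner_symm : ∀ x y : H, qinner x y = star (qinner y x)

namespace QuaternionicRiesz

open QuaternionicInnerProductSpace

/-- A set of quaternions is axially symmetric if with `q` it contains the whole sphere
`[q] = {p | re p = re q, |im p| = |im q|}`. -/
def IsAxiallySymmetric (K : Set ℍ) : Prop :=
  ∀ q ∈ K, ∀ p : ℍ, p.re = q.re → ‖p.im‖ = ‖q.im‖ → p ∈ K

/-- The point `α + m β` of the slice `ℂ_m` that corresponds to `α + i β`. -/
noncomputable def slicePoint (m : ℍ) (z : ℂ) : ℍ := (z.re : ℍ) + (z.im : ℍ) * m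

section Operators

variable {H : Type*} [NormedAddCommGroup H] [NormedSpace ℝ H] [Module ℍᵐᵒᵖ H]
  [IsScalarTower ℝ ℍᵐᵒᵖ H]

/-- `Δ_q(T) = T² - 2 re(q) T + |q|² I`. -/
noncomputable def Delta (T : H →L[ℍᵐᵒᵖ] H) (q : ℍ) : H →L[ℍᵐᵒᵖ] H :=
  T ^ 2 - (2 * q.re) • T + (‖q‖ ^ 2) • (1 : H →L[ℍᵐᵒᵖ] H)

/-- The spherical spectrum: all `q` such that `Δ_q(T)` has no bounded right linear inverse. -/
def sphericalSpectrum (T : H →L[ℍᵐᵒᵖ] H) : Set ℍ := {q | ¬ IsUnit (Delta T q)}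

variable [QuaternionicInnerProductSpace H]

/-- A Hilbert basis: an orthonormal set that satisfies the Parseval identity. (In the
finite-dimensional space `ℍ` unconditional and absolute convergence are the same.) -/
def IsHilbertBasis (N : Set H) : Prop :=
  (∀ z ∈ N, qinner z z = 1) ∧ (∀ z ∈ N, ∀ w ∈ N, z ≠ w → qinner z w = 0) ∧
    ∀ x y : H, HasSum (fun z : N => qinner x (z : H) * qinner (z : H) y) (qinner x y)

/-- The operator `q · I = I · q : x ↦ ∑ z q ⟨z, x⟩` of left multiplication by `q`, relative to a
Hilbert basis `N`. For an operator `A` one has `q · A = (q · I) A` and `A · q = A (q · I)`. -/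
noncomputable def leftMul (N : Set H) (q : ℍ) (x : H) : H :=
  ∑' z : N, (z : H) <• (q * qinner (z : H) x)

/-- The right spherical resolvent `S_R⁻¹(s, T) = -(T - s̄ I) Δ_s(T)⁻¹`. -/
noncomputable def rightResolvent (N : Set H) (T : H →L[ℍᵐᵒᵖ] H) (s : ℍ) (x : H) : H :=
  -(T (Ring.inverse (Delta T s) x) - leftMul N (star s) (Ring.inverse (Delta T s) x))

/-- The left spherical resolvent `S_L⁻¹(s, T) = -Δ_s(T)⁻¹ (T - s̄ I)`. -/
noncomputable def leftResolvent (N : Set H) (T : H →L[ℍᵐᵒᵖ] H) (s : ℍ) (x : H) : H :=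
  -(Ring.inverse (Delta T s) (T x - leftMul N (star s) x))

/-- The density at time `t` of `ds_m = -ds · m` along `s = slicePoint m ∘ c`. -/
noncomputable def dsm (m : ℍ) (c : ℝ → ℂ) (t : ℝ) : ℍ := -(slicePoint m (deriv c t) * m)

/-- `(1 / 2π) ∫ ds_m S_R⁻¹(s, T)`, applied to `x`, over the chain of arcs `γ` in the
slice `ℂ_m`. -/
noncomputable def rightIntegral (N : Set H) (T : H →L[ℍᵐᵒᵖ] H) (m : ℍ) {n : ℕ}
    (γ : Fin n → ℝ → ℂ) (x : H) : H :=
  (1 / (2 * Real.pi)) • ∑ k, ∫ t in (0 : ℝ)..1,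
    leftMul N (dsm m (γ k) t) (rightResolvent N T (slicePoint m (γ k t)) x)

/-- `(1 / 2π) ∫ S_L⁻¹(s, T) ds_m`, applied to `x`, over the chain of arcs `γ` in the
slice `ℂ_m`. -/
noncomputable def leftIntegral (N : Set H) (T : H →L[ℍᵐᵒᵖ] H) (m : ℍ) {n : ℕ}
    (γ : Fin n → ℝ → ℂ) (x : H) : H :=
  (1 / (2 * Real.pi)) • ∑ k, ∫ t in (0 : ℝ)..1,
    leftResolvent N T (slicePoint m (γ k t)) (leftMul N (dsm m (γ k) t) x)

end Operators

/-- The total winding number of a finite chain of arcs around `z`. -/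
noncomputable def winding {n : ℕ} (γ : Fin n → ℝ → ℂ) (z : ℂ) : ℂ :=
  (1 / (2 * Real.pi * Complex.I)) * ∑ k, ∫ t in (0 : ℝ)..1, deriv (γ k) t / (γ k t - z)

/-- `γ` is the positively oriented boundary of the plane open set `D`: finitely many `C¹` arcs
`γ k : [0, 1] → ℂ` fill the topological boundary of `D`, and they wind once around each point
of `D` and do not wind around the points outside of the closure. Finitely many `C¹` Jordan
curves, with their usual orientation, are the case where every arc is a closed simple curve;
a piecewise `C¹` curve is cut into its `C¹` pieces. -/
structure IsOrientedBoundary (D : Set ℂ) {n : ℕ} (γ : Fin n → ℝ → ℂ) : Prop where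
  contDiffOn : ∀ k, ContDiffOn ℝ 1 (γ k) (Set.Icc 0 1)
  frontier_eq : frontier D = ⋃ k, γ k '' Set.Icc 0 1
  winding_inside : ∀ z ∈ D, winding γ z = 1
  winding_outside : ∀ z ∉ closure D, winding γ z = 0

/-- `U` is a bounded axially symmetric open neighbourhood of `σ` whose closure does not meet `τ`,
and `γ` is the positively oriented boundary of `U ∩ ℂ_m`, written in the coordinate of `ℂ_m`. -/
structure IsSeparatingDomain (σ τ : Set ℍ) (m : ℍ) (U : Set ℍ) {n : ℕ} (γ : Fin n → ℝ → ℂ) :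
    Prop where
  isOpen : IsOpen U
  isBounded : Bornology.IsBounded U
  axiallySymmetric : IsAxiallySymmetric U
  subset : σ ⊆ U
  disjoint : Disjoint (closure U) τ
  boundary : IsOrientedBoundary {z | slicePoint m z ∈ U} γ

/-- `P` is the Riesz projection `χ_σ(T)` of the functional calculus that belongs to the part `σ`
of the spherical spectrum of `T`: both Cauchy integrals, of the right and of the left spherical
resolvent, over the boundary of `U ∩ ℂ_m` are equal to `P`, for every Hilbert basis, every
imaginary unit `m` and every domain `U` that separates `σ` from the rest of the spectrum; and
Hilbert bases exist, and such domains exist for every `m`. -/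
structure IsRieszProjection {H : Type*} [NormedAddCommGroup H] [NormedSpace ℝ H] [Module ℍᵐᵒᵖ H]
    [IsScalarTower ℝ ℍᵐᵒᵖ H] [QuaternionicInnerProductSpace H]
    (T : H →L[ℍᵐᵒᵖ] H) (σ : Set ℍ) (P : H →L[ℍᵐᵒᵖ] H) : Prop where
  exists_basis : ∃ N : Set H, IsHilbertBasis N
  exists_domain : ∀ m : ℍ, m * m = -1 → ∃ (U : Set ℍ) (n : ℕ) (γ : Fin n → ℝ → ℂ),
    IsSeparatingDomain σ (sphericalSpectrum T \ σ) m U γ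
  eq_integral : ∀ N : Set H, IsHilbertBasis N → ∀ m : ℍ, m * m = -1 →
    ∀ (U : Set ℍ) (n : ℕ) (γ : Fin n → ℝ → ℂ),
      IsSeparatingDomain σ (sphericalSpectrum T \ σ) m U γ →
        ∀ x, P x = rightIntegral N T m γ x ∧ P x = leftIntegral N T m γ x

end QuaternionicRiesz

/-! Everything is reduced to the complex Riesz calculus in one slice. Fix `m` with `m * m = -1`.
Right multiplication by `α + m β` makes `H` a complex Banach space on which `T` becomes a complex
linear operator `a`. For `q` in the slice, `Δ_q(T) = (z - a)(z̄ - a)`, so `q` is in the spherical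
spectrum iff `z` or `z̄` is in the spectrum of `a` (`toComplex_Delta`).

Let `J` be left multiplication by `m` relative to a Hilbert basis, so `J² = -1`. If `v (z - a)⁻¹ = X
+ i Y`, with `X`, `Y` built from `a`, `Δ⁻¹` and real scalars, then the quaternionic integrands are
`Y - J X` and `Y - X J` (`leftFactor_mul`, `rightFactor_mul`). The domain is symmetric in the real
axis, so the reflected and reversed boundary bounds it too, and equality of the two resolvent
integrals forces `∫ X = 0` (`Separates.integral_densities`). What remains is `(1/2π) ∫ Y = (1/2πi) ∮
(z - a)⁻¹ dz`: the basis has dropped out. This expression involves no `m`, so it is complex linear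
for every slice structure; since each quaternion lies in some slice, it is right `ℍ`-linear.

In the complex calculus a boundary is known only by its trace and its winding numbers. The resolvent
equation and Fubini evaluate products of two Riesz integrals (`rieszInt_mul_rieszInt`). Fine square
grids around the two parts `K`, `L` of the spectrum give integrals `P_K`, `P_L` with `P_K + P_L =
1`, by enlarging the grid region to large squares (`rieszInt_gridChain_eq_one`). For any admissible
chain `γ` around `K`, the integral `P_γ` satisfies `P_γ P_K = P_K` and `P_γ P_L = 0`, so `P_γ =
P_K`. Independence of the chain, idempotence and `P_σ + P_τ = 1` follow.

For `z` outside `K`, integrating `(z - w)⁻¹ (w - a)⁻¹` inverts `z - a` relative to the projection,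
so the restriction to `M_σ` has no spherical spectrum outside `σ`. Conversely, if `Δ_q` is
invertible on both ranges, it is invertible on `H`; hence no point of `σ` is lost. As `σ` and `τ`
are nonempty, neither range is zero. -/

namespace QuaternionicRiesz

open Complex

/-! ### Integrals along segments and the logarithm. -/

section Segments

variable {E : Type*} [NormedAddCommGroup E] [NormedSpace ℂ E]

/-- The integral of `f` along the segment from `a` to `b`. -/
noncomputable def segInt (f : ℂ → E) (a b : ℂ) : E :=
  ∫ t in (0 : ℝ)..1, (b - a) • f (a + t * (b - a))

theorem segInt_swap (f : ℂ → E) (a b : ℂ) : segInt f b a = -segInt f a b := by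
  unfold segInt
  have h := intervalIntegral.integral_comp_sub_left (a := (0 : ℝ)) (b := 1)
    (fun t : ℝ => (b - a) • f (a + t * (b - a))) 1
  rw [sub_self, sub_zero] at h
  rw [← h, ← intervalIntegral.integral_neg]
  congr 1
  ext t
  rw [← neg_smul, neg_sub]
  congr 2
  push_cast
  ring

theorem segInt_horizontal (f : ℂ → E) (x₁ x₂ y : ℝ) :
    segInt f (x₁ + y * I) (x₂ + y * I) = ∫ x in x₁..x₂, f (x + y * I) := by
  have h := intervalIntegral.smul_integral_comp_mul_add (a := (0 : ℝ)) (b := 1)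
    (fun x : ℝ => f (x + y * I)) (x₂ - x₁) x₁
  simp only [mul_zero, zero_add, mul_one, sub_add_cancel] at h
  rw [← h, segInt, intervalIntegral.integral_smul, ← Complex.coe_smul]
  congr 1
  · push_cast; ring
  · congr 1
    ext t
    congr 1
    push_cast
    ring

theorem segInt_vertical (f : ℂ → E) (x y₁ y₂ : ℝ) :
    segInt f (x + y₁ * I) (x + y₂ * I) = I • ∫ y in y₁..y₂, f (x + y * I) := by
  have h := intervalIntegral.smul_integral_comp_mul_add (a := (0 : ℝ)) (b := 1)
    (fun y : ℝ => f (x + y * I)) (y₂ - y₁) y₁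
  simp only [mul_zero, zero_add, mul_one, sub_add_cancel] at h
  rw [← h, segInt, intervalIntegral.integral_smul, ← Complex.coe_smul, smul_smul]
  congr 1
  · push_cast; ring
  · congr 1
    ext t
    congr 1
    push_cast
    ring

theorem segInt_rect_eq_zero [CompleteSpace E] (f : ℂ → E) (x₁ x₂ y₁ y₂ : ℝ)
    (hf : DifferentiableOn ℂ f (Set.uIcc x₁ x₂ ×ℂ Set.uIcc y₁ y₂)) :
    segInt f (x₁ + y₁ * I) (x₂ + y₁ * I) + segInt f (x₂ + y₁ * I) (x₂ + y₂ * I) +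
      segInt f (x₂ + y₂ * I) (x₁ + y₂ * I) + segInt f (x₁ + y₂ * I) (x₁ + y₁ * I) = 0 := by
  have h := Complex.integral_boundary_rect_eq_zero_of_differentiableOn f ⟨x₁, y₁⟩ ⟨x₂, y₂⟩ hf
  simp only at h
  rw [segInt_swap f (x₁ + y₂ * I) (x₂ + y₂ * I), segInt_swap f (x₁ + y₁ * I) (x₁ + y₂ * I),
    segInt_horizontal, segInt_horizontal, segInt_vertical, segInt_vertical, ← h]
  abel

/-- If `z` is not on the segment, then the segment, seen from `z`, stays in the slit plane. -/
theorem div_mem_slitPlane {a b z : ℂ} (hz : z ∉ segment ℝ a b) :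
    (b - z) / (a - z) ∈ slitPlane := by
  have ha : a - z ≠ 0 := fun h => hz (by rw [← sub_eq_zero.1 h]; exact left_mem_segment ℝ a b)
  rw [mem_slitPlane_iff_not_le_zero]
  intro h
  apply hz
  obtain ⟨r, hr⟩ : ∃ r : ℝ, (b - z) / (a - z) = -r := ⟨-((b - z) / (a - z)).re, by
    apply Complex.ext
    · simp
    · simpa using (Complex.le_def.1 h).2⟩
  have hr0 : 0 ≤ r := by
    have := (Complex.le_def.1 h).1
    rw [hr] at this
    simpa using this
  rw [div_eq_iff ha] at hr
  have hpos : (1 + r : ℝ) ≠ 0 := by positivity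
  have hposc : (1 + r : ℂ) ≠ 0 := by exact_mod_cast hpos
  -- From `b - z = -r (a - z)` one gets `(1 + r) z = r a + b`.
  refine ⟨r / (1 + r), 1 / (1 + r), by positivity, by positivity, by field_simp; ring, ?_⟩
  simp only [real_smul]
  push_cast
  field_simp
  linear_combination hr

/-- Dividing by `a - z` keeps the whole path in the slit plane, so the principal logarithm is a
primitive there and vanishes at the starting point. -/
theorem segInt_inv {a b z : ℂ} (hz : z ∉ segment ℝ a b) :
    segInt (fun w => (w - z)⁻¹) a b = log ((b - z) / (a - z)) := by
  have ha : a - z ≠ 0 := fun h => hz (by rw [← sub_eq_zero.1 h]; exact left_mem_segment ℝ a b)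
  have hmem : ∀ t ∈ Set.uIcc (0 : ℝ) 1, (a + t * (b - a) - z) / (a - z) ∈ slitPlane := by
    intro t ht
    rw [Set.uIcc_of_le zero_le_one] at ht
    refine div_mem_slitPlane fun h => hz ?_
    refine (convex_segment a b).segment_subset (left_mem_segment ℝ a b) ?_ h
    rw [segment_eq_image']
    exact ⟨t, ht, by simp⟩
  have hd : ∀ t ∈ Set.uIcc (0 : ℝ) 1, HasDerivAt
      (fun t : ℝ => log ((a + t * (b - a) - z) / (a - z)))
      ((b - a) * (a + t * (b - a) - z)⁻¹) t := by
    intro t ht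
    have h1 : HasDerivAt (fun t : ℝ => (a + t * (b - a) - z) / (a - z)) ((b - a) / (a - z)) t := by
      have := ((((hasDerivAt_id t).ofReal_comp).mul_const (b - a)).const_add a).sub_const z
      simpa using this.div_const (a - z)
    have h2 := h1.clog_real (hmem t ht)
    convert h2 using 1
    have := slitPlane_ne_zero (hmem t ht)
    rw [div_ne_zero_iff] at this
    have := this.1
    field_simp
  have hc : ContinuousOn (fun t : ℝ => (b - a) * (a + t * (b - a) - z)⁻¹) (Set.uIcc 0 1) := by
    refine ContinuousOn.mul continuousOn_const (ContinuousOn.inv₀ (by fun_prop) ?_)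
    intro t ht h0
    have := slitPlane_ne_zero (hmem t ht)
    exact this (by simp [h0])
  have := intervalIntegral.integral_eq_sub_of_hasDerivAt hd hc.intervalIntegrable
  simp only [segInt, smul_eq_mul]
  rw [this]
  simp [ha]

end Segments

/-! ### Plane domains made of grid squares. -/

section Grid

/-- The corners of the unit cell, counterclockwise, from the lower left one. -/
def cornerOffset : Fin 4 → ℤ × ℤ := ![(0, 0), (1, 0), (1, 1), (0, 1)]

/-- The direction to the neighbouring cell across the edge `d`. -/
def neighbour : Fin 4 → ℤ × ℤ := ![(0, -1), (1, 0), (0, 1), (-1, 0)]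

/-- The points of the square grid of mesh `δ`. -/
noncomputable def gridPoint (δ : ℝ) (p : ℤ × ℤ) : ℂ := ((δ * p.1 : ℝ) : ℂ) + ((δ * p.2 : ℝ) : ℂ) * I

/-- The starting point of the edge `e.1` of the cell `e.2`. -/
noncomputable def edgeStart (δ : ℝ) (e : Fin 4 × (ℤ × ℤ)) : ℂ :=
  gridPoint δ (e.2 + cornerOffset e.1)

/-- The end point of the edge `e.1` of the cell `e.2`. -/
noncomputable def edgeEnd (δ : ℝ) (e : Fin 4 × (ℤ × ℤ)) : ℂ :=
  gridPoint δ (e.2 + cornerOffset (e.1 + 1))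

/-- The closed cell with lower left corner `s`. -/
def closedCell (δ : ℝ) (s : ℤ × ℤ) : Set ℂ :=
  Set.Icc (δ * s.1) (δ * (s.1 + 1)) ×ℂ Set.Icc (δ * s.2) (δ * (s.2 + 1))

/-- The open cell with lower left corner `s`. -/
def openCell (δ : ℝ) (s : ℤ × ℤ) : Set ℂ :=
  Set.Ioo (δ * s.1) (δ * (s.1 + 1)) ×ℂ Set.Ioo (δ * s.2) (δ * (s.2 + 1))

/-- The edges of the cells of `S` behind which there is no other cell of `S`. -/
def boundaryEdges (S : Finset (ℤ × ℤ)) : Finset (Fin 4 × (ℤ × ℤ)) :=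
  (Finset.univ ×ˢ S).filter fun e => e.2 + neighbour e.1 ∉ S

/-- The interior of the union of the cells of `S`. -/
def gridDomain (δ : ℝ) (S : Finset (ℤ × ℤ)) : Set ℂ := {z | ∀ s, z ∈ closedCell δ s → s ∈ S}

/-- The boundary edges as a chain of arcs. -/
noncomputable def gridChain (δ : ℝ) (S : Finset (ℤ × ℤ)) (k : Fin (boundaryEdges S).card) (t : ℝ) :
    ℂ :=
  let e := ((boundaryEdges S).equivFin.symm k : Fin 4 × (ℤ × ℤ))
  edgeStart δ e + t * (edgeEnd δ e - edgeStart δ e)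

theorem mem_closedCell {δ : ℝ} {s : ℤ × ℤ} {z : ℂ} : z ∈ closedCell δ s ↔
    (δ * s.1 ≤ z.re ∧ z.re ≤ δ * (s.1 + 1)) ∧ (δ * s.2 ≤ z.im ∧ z.im ≤ δ * (s.2 + 1)) := Iff.rfl

theorem isClosed_closedCell (δ : ℝ) (s : ℤ × ℤ) : IsClosed (closedCell δ s) :=
  isClosed_Icc.reProdIm isClosed_Icc

theorem closure_openCell {δ : ℝ} (hδ : 0 < δ) (s : ℤ × ℤ) :
    closure (openCell δ s) = closedCell δ s := by
  rw [openCell, closure_reProdIm, closure_Ioo (by nlinarith), closure_Ioo (by nlinarith)]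
  rfl

theorem exists_mem_Icc_int {δ : ℝ} (hδ : 0 < δ) (x : ℝ) : ∃ i : ℤ, δ * i ≤ x ∧ x ≤ δ * (i + 1) := by
  refine ⟨⌊x / δ⌋, ?_, ?_⟩
  · rw [mul_comm, ← le_div_iff₀ hδ]; exact Int.floor_le _
  · rw [mul_comm, ← div_le_iff₀ hδ]; exact (Int.lt_floor_add_one _).le

theorem exists_mem_closedCell {δ : ℝ} (hδ : 0 < δ) (z : ℂ) : ∃ s, z ∈ closedCell δ s := by
  obtain ⟨i, hi⟩ := exists_mem_Icc_int hδ z.re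
  obtain ⟨j, hj⟩ := exists_mem_Icc_int hδ z.im
  exact ⟨(i, j), hi, hj⟩

theorem int_le_of_mul_le {δ x : ℝ} (hδ : 0 < δ) {i j : ℤ} (h₁ : δ * i ≤ x) (h₂ : x ≤ δ * (j + 1)) :
    i ≤ j + 1 := by
  have : δ * i ≤ δ * (j + 1) := h₁.trans h₂
  have := le_of_mul_le_mul_left this hδ
  exact_mod_cast this

theorem int_eq_of_mul_lt {δ x : ℝ} (hδ : 0 < δ) {i j : ℤ} (h : δ * i < x ∧ x < δ * (i + 1))
    (h' : δ * j ≤ x ∧ x ≤ δ * (j + 1)) : j = i := by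
  have h1 : δ * i < δ * (j + 1) := h.1.trans_le h'.2
  have h2 : δ * j < δ * (i + 1) := h'.1.trans_lt h.2
  have h1 := lt_of_mul_lt_mul_left h1 hδ.le
  have h2 := lt_of_mul_lt_mul_left h2 hδ.le
  have h1 : i < j + 1 := by exact_mod_cast h1
  have h2 : j < i + 1 := by exact_mod_cast h2
  omega

theorem eq_of_mem_openCell {δ : ℝ} (hδ : 0 < δ) {s t : ℤ × ℤ} {z : ℂ} (hs : z ∈ openCell δ s)
    (ht : z ∈ closedCell δ t) : t = s :=
  Prod.ext (int_eq_of_mul_lt hδ hs.1 ht.1) (int_eq_of_mul_lt hδ hs.2 ht.2)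

theorem openCell_subset_gridDomain {δ : ℝ} (hδ : 0 < δ) {S : Finset (ℤ × ℤ)} {s : ℤ × ℤ}
    (hs : s ∈ S) : openCell δ s ⊆ gridDomain δ S := fun _ hz _ ht =>
  eq_of_mem_openCell hδ hz ht ▸ hs

theorem closure_gridDomain {δ : ℝ} (hδ : 0 < δ) (S : Finset (ℤ × ℤ)) :
    closure (gridDomain δ S) = ⋃ s ∈ S, closedCell δ s := by
  apply Set.Subset.antisymm
  · refine closure_minimal (fun z hz => ?_) (S.finite_toSet.isClosed_biUnion fun s _ =>
      isClosed_closedCell δ s)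
    obtain ⟨s, hs⟩ := exists_mem_closedCell hδ z
    exact Set.mem_biUnion (hz s hs) hs
  · refine Set.iUnion₂_subset fun s hs => ?_
    rw [← closure_openCell hδ]
    exact closure_mono (openCell_subset_gridDomain hδ hs)

theorem locallyFinite_closedCell {δ : ℝ} (hδ : 0 < δ) : LocallyFinite (closedCell δ) := by
  intro z
  refine ⟨Metric.ball z δ, Metric.ball_mem_nhds z hδ, ?_⟩
  obtain ⟨s, hs⟩ := exists_mem_closedCell hδ z
  -- The bound `3` is not sharp; any fixed bound would do.
  refine ((Set.finite_Icc (s.1 - 3) (s.1 + 3)).prod (Set.finite_Icc (s.2 - 3) (s.2 + 3))).subset ?_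
  rintro t ⟨w, ht, hw⟩
  rw [Metric.mem_ball, dist_eq] at hw
  have hre := abs_le.1 ((abs_re_le_norm (w - z)).trans hw.le)
  have him := abs_le.1 ((abs_im_le_norm (w - z)).trans hw.le)
  rw [sub_re] at hre
  rw [sub_im] at him
  have key : ∀ (i j : ℤ) (x y : ℝ), (δ * i ≤ x ∧ x ≤ δ * (i + 1)) → (δ * j ≤ y ∧ y ≤ δ * (j + 1)) →
      (-δ ≤ y - x ∧ y - x ≤ δ) → j ∈ Set.Icc (i - 3) (i + 3) := by
    intro i j x y hi hj h
    have h1 : δ * (i : ℝ) ≤ δ * (j + 3) := by nlinarith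
    have h2 : δ * (j : ℝ) ≤ δ * (i + 3) := by nlinarith
    have h1 := le_of_mul_le_mul_left h1 hδ
    have h2 := le_of_mul_le_mul_left h2 hδ
    have h1 : i ≤ j + 3 := by exact_mod_cast h1
    have h2 : j ≤ i + 3 := by exact_mod_cast h2
    constructor <;> omega
  exact ⟨key _ _ _ _ hs.1 ht.1 hre, key _ _ _ _ hs.2 ht.2 him⟩

theorem isOpen_gridDomain {δ : ℝ} (hδ : 0 < δ) (S : Finset (ℤ × ℤ)) : IsOpen (gridDomain δ S) := by
  have h : (gridDomain δ S)ᶜ = ⋃ s : {s // s ∉ S}, closedCell δ s := by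
    ext z
    simp [gridDomain]
    tauto
  rw [← isClosed_compl_iff, h]
  exact ((locallyFinite_closedCell hδ).comp_injective Subtype.val_injective).isClosed_iUnion
    fun s => isClosed_closedCell δ s

theorem isBounded_gridDomain {δ : ℝ} (hδ : 0 < δ) (S : Finset (ℤ × ℤ)) :
    Bornology.IsBounded (gridDomain δ S) := by
  refine Bornology.IsBounded.subset ?_ (subset_closure.trans (closure_gridDomain hδ S).subset)
  refine (Bornology.isBounded_biUnion_finset S).2 fun s _ => ?_
  exact (Metric.isBounded_Icc _ _).reProdIm (Metric.isBounded_Icc _ _)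

theorem mem_segment_horizontal {x₁ x₂ y : ℝ} (h : x₁ < x₂) (z : ℂ) :
    z ∈ segment ℝ ((x₁ : ℂ) + y * I) (x₂ + y * I) ↔ (x₁ ≤ z.re ∧ z.re ≤ x₂) ∧ z.im = y := by
  rw [segment_eq_image']
  constructor
  · rintro ⟨t, ht, rfl⟩
    simp only [real_smul]
    simp
    constructor <;> nlinarith [ht.1, ht.2]
  · rintro ⟨⟨h1, h2⟩, h3⟩
    have hne : x₂ - x₁ ≠ 0 := by linarith
    refine ⟨(z.re - x₁) / (x₂ - x₁), ⟨div_nonneg (by linarith) (by linarith), ?_⟩, ?_⟩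
    · rw [div_le_one (by linarith)]; linarith
    · simp only [real_smul]
      apply Complex.ext
      · simp [-ofReal_div]; field_simp; ring
      · simp [-ofReal_div, h3]

theorem mem_segment_vertical {x y₁ y₂ : ℝ} (h : y₁ < y₂) (z : ℂ) :
    z ∈ segment ℝ ((x : ℂ) + y₁ * I) (x + y₂ * I) ↔ z.re = x ∧ (y₁ ≤ z.im ∧ z.im ≤ y₂) := by
  rw [segment_eq_image']
  constructor
  · rintro ⟨t, ht, rfl⟩
    simp only [real_smul]
    simp
    constructor <;> nlinarith [ht.1, ht.2]
  · rintro ⟨h3, ⟨h1, h2⟩⟩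
    have hne : y₂ - y₁ ≠ 0 := by linarith
    refine ⟨(z.im - y₁) / (y₂ - y₁), ⟨div_nonneg (by linarith) (by linarith), ?_⟩, ?_⟩
    · rw [div_le_one (by linarith)]; linarith
    · simp only [real_smul]
      apply Complex.ext
      · simp [-ofReal_div, h3]
      · simp [-ofReal_div]; field_simp; ring

/-- Describing edges by incidence with cells lets later arguments about edges run on integer
indices. -/
theorem mem_edge_iff {δ : ℝ} (hδ : 0 < δ) (e : Fin 4 × (ℤ × ℤ)) (z : ℂ) :
    z ∈ segment ℝ (edgeStart δ e) (edgeEnd δ e) ↔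
      z ∈ closedCell δ e.2 ∧ z ∈ closedCell δ (e.2 + neighbour e.1) := by
  obtain ⟨d, i, j⟩ := e
  have hi : δ * (i : ℝ) < δ * (i + 1) := by nlinarith
  have hj : δ * (j : ℝ) < δ * (j + 1) := by nlinarith
  rw [mem_closedCell, mem_closedCell]
  fin_cases d
  · have := mem_segment_horizontal (y := δ * j) hi z
    simp [edgeStart, edgeEnd, gridPoint, cornerOffset, neighbour] at this ⊢
    rw [this]
    constructor
    · rintro ⟨h, h'⟩; rw [h']; refine ⟨⟨h, le_rfl, hj.le⟩, h, ?_, le_rfl⟩; nlinarith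
    · rintro ⟨⟨h1, h2, h3⟩, h4, h5, h6⟩; exact ⟨h1, le_antisymm h6 h2⟩
  · have := mem_segment_vertical (x := δ * (i + 1)) hj z
    simp [edgeStart, edgeEnd, gridPoint, cornerOffset, neighbour] at this ⊢
    rw [this]
    constructor
    · rintro ⟨h, h'⟩; rw [h]; refine ⟨⟨⟨hi.le, le_rfl⟩, h'⟩, ⟨le_rfl, ?_⟩, h'⟩; nlinarith
    · rintro ⟨⟨h1, h2⟩, h4, h5⟩; exact ⟨le_antisymm h1.2 h4.1, h2⟩
  · have := mem_segment_horizontal (y := δ * (j + 1)) hi z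
    simp [edgeStart, edgeEnd, gridPoint, cornerOffset, neighbour] at this ⊢
    rw [segment_symm, this]
    constructor
    · rintro ⟨h, h'⟩; rw [h']; refine ⟨⟨h, hj.le, le_rfl⟩, h, le_rfl, ?_⟩; nlinarith
    · rintro ⟨⟨h1, h2, h3⟩, h4, h5, h6⟩; exact ⟨h1, le_antisymm h3 h5⟩
  · have := mem_segment_vertical (x := δ * i) hj z
    simp [edgeStart, edgeEnd, gridPoint, cornerOffset, neighbour] at this ⊢
    rw [segment_symm, this]
    constructor
    · rintro ⟨h, h'⟩; rw [h]; refine ⟨⟨⟨le_rfl, hi.le⟩, h'⟩, ⟨?_, le_rfl⟩, h'⟩; nlinarith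
    · rintro ⟨⟨h1, h2⟩, h4, h5⟩; exact ⟨le_antisymm h4.2 h1.1, h2⟩

theorem range_gridChain (δ : ℝ) (S : Finset (ℤ × ℤ)) :
    ⋃ k, gridChain δ S k '' Set.Icc 0 1 =
      ⋃ e ∈ boundaryEdges S, segment ℝ (edgeStart δ e) (edgeEnd δ e) := by
  have h : ∀ e, segment ℝ (edgeStart δ e) (edgeEnd δ e) =
      (fun t : ℝ => edgeStart δ e + t * (edgeEnd δ e - edgeStart δ e)) '' Set.Icc 0 1 := by
    intro e
    rw [segment_eq_image']
    simp
  simp only [h]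
  refine ((boundaryEdges S).equivFin.symm.surjective.iUnion_comp
    (fun e : boundaryEdges S =>
      (fun t : ℝ => edgeStart δ e + t * (edgeEnd δ e - edgeStart δ e)) '' Set.Icc (0 : ℝ) 1)).trans ?_
  rw [Set.iUnion_subtype]

/-- A frontier point lies in a cell of `S` and in a cell outside `S`, which may share only a corner.
The mixed cell, in the column of the second and the row of the first, contains the point as well;
whether or not it belongs to `S`, it completes a pair of edge neighbours with exactly one member in
`S`. -/
theorem frontier_gridDomain {δ : ℝ} (hδ : 0 < δ) (S : Finset (ℤ × ℤ)) :
    frontier (gridDomain δ S) =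
      ⋃ e ∈ boundaryEdges S, segment ℝ (edgeStart δ e) (edgeEnd δ e) := by
  rw [frontier, (isOpen_gridDomain hδ S).interior_eq, closure_gridDomain hδ]
  ext z
  simp only [Set.mem_sdiff, Set.mem_iUnion₂, mem_edge_iff hδ, boundaryEdges, Finset.mem_filter,
    Finset.mem_product, Finset.mem_univ, true_and, exists_prop, Prod.exists]
  constructor
  · rintro ⟨⟨i, j, hs, hz⟩, hnot⟩
    obtain ⟨i', j', hz', hs'⟩ : ∃ i' j', z ∈ closedCell δ (i', j') ∧ (i', j') ∉ S := by
      simpa [gridDomain] using hnot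
    have hmix : z ∈ closedCell δ (i', j) := ⟨hz'.1, hz.2⟩
    by_cases hS : (i', j) ∈ S
    · have h1 := int_le_of_mul_le hδ hz.2.1 hz'.2.2
      have h2 := int_le_of_mul_le hδ hz'.2.1 hz.2.2
      have hne : j ≠ j' := by rintro rfl; exact hs' hS
      obtain h | h : j' = j + -1 ∨ j' = j + 1 := by simp only at h1 h2; omega
      · subst h
        exact ⟨0, i', j, ⟨hS, by simpa [neighbour] using hs'⟩, hmix, by simpa [neighbour] using hz'⟩
      · subst h
        exact ⟨2, i', j, ⟨hS, by simpa [neighbour] using hs'⟩, hmix, by simpa [neighbour] using hz'⟩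
    · have h1 := int_le_of_mul_le hδ hz.1.1 hmix.1.2
      have h2 := int_le_of_mul_le hδ hmix.1.1 hz.1.2
      have hne : i ≠ i' := by rintro rfl; exact hS hs
      obtain h | h : i' = i + -1 ∨ i' = i + 1 := by simp only at h1 h2; omega
      · subst h
        exact ⟨3, i, j, ⟨hs, by simpa [neighbour] using hS⟩, hz, by simpa [neighbour] using hmix⟩
      · subst h
        exact ⟨1, i, j, ⟨hs, by simpa [neighbour] using hS⟩, hz, by simpa [neighbour] using hmix⟩
  · rintro ⟨d, i, j, ⟨hs, hn⟩, hz, hz'⟩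
    exact ⟨⟨i, j, hs, hz⟩, fun h => hn (h _ hz')⟩

end Grid

/-! ### Cauchy integrals and winding numbers of grid boundaries. -/

section GridIntegral

variable {E : Type*} [NormedAddCommGroup E] [NormedSpace ℂ E]

/-- The integral of `f` along a finite chain of arcs. -/
noncomputable def chainInt {n : ℕ} (γ : Fin n → ℝ → ℂ) (f : ℂ → E) : E :=
  ∑ k, ∫ t in (0 : ℝ)..1, deriv (γ k) t • f (γ k t)

/-- The integral of `f` along the boundary of a cell. -/
noncomputable def cellInt (δ : ℝ) (f : ℂ → E) (s : ℤ × ℤ) : E :=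
  ∑ d : Fin 4, segInt f (edgeStart δ (d, s)) (edgeEnd δ (d, s))

theorem winding_eq_chainInt {n : ℕ} (γ : Fin n → ℝ → ℂ) (z : ℂ) :
    winding γ z = (2 * Real.pi * I)⁻¹ * chainInt γ fun w => (w - z)⁻¹ := by
  simp only [winding, chainInt, smul_eq_mul, div_eq_mul_inv, one_mul]

theorem chainInt_gridChain (δ : ℝ) (S : Finset (ℤ × ℤ)) (f : ℂ → E) :
    chainInt (gridChain δ S) f = ∑ e ∈ boundaryEdges S, segInt f (edgeStart δ e) (edgeEnd δ e) := by
  rw [← Finset.sum_coe_sort, chainInt]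
  refine Fintype.sum_equiv (boundaryEdges S).equivFin.symm _ _ fun k => ?_
  rw [segInt]
  congr 1
  ext t
  congr 1
  have h : HasDerivAt (gridChain δ S k) (edgeEnd δ ((boundaryEdges S).equivFin.symm k) -
      edgeStart δ ((boundaryEdges S).equivFin.symm k)) t := by
    have := (((hasDerivAt_id t).ofReal_comp).mul_const (edgeEnd δ ((boundaryEdges S).equivFin.symm k)
      - edgeStart δ ((boundaryEdges S).equivFin.symm k))).const_add
      (edgeStart δ ((boundaryEdges S).equivFin.symm k))
    rw [ofReal_one, one_mul] at this
    exact this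
  exact h.deriv

/-- Opposite directions differ by `2` in `Fin 4`; a shared edge is thus traversed in opposite senses
by its two cells, which yields the cancellation in `sum_cellInt`. -/
theorem edgeStart_neighbour (δ : ℝ) (e : Fin 4 × (ℤ × ℤ)) :
    edgeStart δ (e.1 + 2, e.2 + neighbour e.1) = edgeEnd δ e := by
  simp only [edgeStart, edgeEnd, add_assoc]
  have : ∀ d : Fin 4, neighbour d + cornerOffset (d + 2) = cornerOffset (d + 1) := by decide
  rw [this]

theorem edgeEnd_neighbour (δ : ℝ) (e : Fin 4 × (ℤ × ℤ)) :
    edgeEnd δ (e.1 + 2, e.2 + neighbour e.1) = edgeStart δ e := by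
  simp only [edgeStart, edgeEnd, add_assoc]
  have : ∀ d : Fin 4, neighbour d + cornerOffset (d + (2 + 1)) = cornerOffset d := by decide
  rw [this]

theorem neighbour_add_neighbour (d : Fin 4) : neighbour d + neighbour (d + 2) = 0 := by
  revert d; decide

/-- The integrals along the edges between two cells cancel. -/
theorem sum_cellInt (δ : ℝ) (S : Finset (ℤ × ℤ)) (f : ℂ → E) :
    ∑ s ∈ S, cellInt δ f s = chainInt (gridChain δ S) f := by
  have h1 : ∑ s ∈ S, cellInt δ f s =
      ∑ e ∈ Finset.univ ×ˢ S, segInt f (edgeStart δ e) (edgeEnd δ e) := by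
    rw [Finset.sum_product_right]
    rfl
  rw [h1, chainInt_gridChain, boundaryEdges, ← Finset.sum_filter_add_sum_filter_not
    (Finset.univ ×ˢ S) (fun e => e.2 + neighbour e.1 ∉ S), add_eq_left]
  -- The edges that are not boundary edges are paired off by crossing to the neighbouring cell.
  refine Finset.sum_involution (fun e _ => (e.1 + 2, e.2 + neighbour e.1)) ?_ ?_ ?_ ?_
  · intro e _
    rw [edgeStart_neighbour, edgeEnd_neighbour, segInt_swap, neg_add_cancel]
  · intro e _ _ h
    have h2 : ∀ d : Fin 4, d + 2 ≠ d := by decide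
    exact h2 _ (congrArg Prod.fst h)
  · intro e he
    simp only [Finset.mem_filter, Finset.mem_product, Finset.mem_univ, true_and, not_not] at he ⊢
    rw [add_assoc, neighbour_add_neighbour, add_zero]
    exact ⟨he.2, he.1⟩
  · intro e _
    refine Prod.ext ?_ ?_
    · have h2 : ∀ d : Fin 4, d + 2 + 2 = d := by decide
      exact h2 _
    · simp only [add_assoc, neighbour_add_neighbour, add_zero]

theorem cellInt_eq_zero [CompleteSpace E] {δ : ℝ} (hδ : 0 < δ) {f : ℂ → E} {s : ℤ × ℤ}
    (hf : DifferentiableOn ℂ f (closedCell δ s)) : cellInt δ f s = 0 := by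
  have h := segInt_rect_eq_zero f (δ * s.1) (δ * (s.1 + 1)) (δ * s.2) (δ * (s.2 + 1)) (by
    rwa [Set.uIcc_of_le (by nlinarith), Set.uIcc_of_le (by nlinarith)])
  rw [← h, cellInt, Fin.sum_univ_four]
  simp [edgeStart, edgeEnd, gridPoint, cornerOffset]

theorem neighbour_ne_zero (d : Fin 4) : neighbour d ≠ 0 := by
  revert d; decide

theorem not_mem_edge_of_mem_openCell {δ : ℝ} (hδ : 0 < δ) {s : ℤ × ℤ} {z : ℂ}
    (hz : z ∈ openCell δ s) (e : Fin 4 × (ℤ × ℤ)) :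
    z ∉ segment ℝ (edgeStart δ e) (edgeEnd δ e) := by
  rw [mem_edge_iff hδ]
  rintro ⟨h1, h2⟩
  have h1 := eq_of_mem_openCell hδ hz h1
  have h2 := eq_of_mem_openCell hδ hz h2
  rw [h1, add_eq_left] at h2
  exact neighbour_ne_zero _ h2

theorem cellInt_inv_of_ne {δ : ℝ} (hδ : 0 < δ) {s t : ℤ × ℤ} (hst : t ≠ s) {z : ℂ}
    (hz : z ∈ openCell δ s) : cellInt δ (fun w => (w - z)⁻¹) t = 0 := by
  refine cellInt_eq_zero hδ (DifferentiableOn.inv (by fun_prop) fun w hw h => ?_)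
  rw [sub_eq_zero] at h
  subst h
  exact hst (eq_of_mem_openCell hδ hz hw)

theorem im_div_pos {u v : ℂ} (hu : u ≠ 0) (h : 0 < u.re * v.im - u.im * v.re) : 0 < (v / u).im := by
  rw [div_im]
  have := normSq_pos.2 hu
  rw [← sub_div]
  apply div_pos _ this
  linarith

/-- The integral is a sum of four logarithms of quotients whose product telescopes to `1`, so it is
`2πi n`. Since `z` lies to the left of each edge, every argument is in `(0, π)`; the sum is in `(0,
4π)`, which forces `n = 1`. -/
theorem cellInt_inv_self {δ : ℝ} (hδ : 0 < δ) {s : ℤ × ℤ} {z : ℂ} (hz : z ∈ openCell δ s) :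
    cellInt δ (fun w => (w - z)⁻¹) s = 2 * Real.pi * I := by
  have hns := not_mem_edge_of_mem_openCell hδ hz
  have hne : ∀ e, edgeStart δ e - z ≠ 0 := fun e h => hns e (by
    rw [← sub_eq_zero.1 h]; exact left_mem_segment ℝ _ _)
  have hc : ∀ d : Fin 4, 0 < ((edgeEnd δ (d, s) - z) / (edgeStart δ (d, s) - z)).im := by
    intro d
    refine im_div_pos (hne _) ?_
    obtain ⟨⟨h1, h2⟩, h3, h4⟩ := hz
    fin_cases d <;> simp [edgeStart, edgeEnd, gridPoint, cornerOffset] <;> nlinarith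
  have hsum : cellInt δ (fun w => (w - z)⁻¹) s =
      ∑ d : Fin 4, log ((edgeEnd δ (d, s) - z) / (edgeStart δ (d, s) - z)) :=
    Finset.sum_congr rfl fun d _ => segInt_inv (hns _)
  have hend : ∀ d : Fin 4, edgeEnd δ (d, s) = edgeStart δ (d + 1, s) := fun d => rfl
  have hexp : exp (cellInt δ (fun w => (w - z)⁻¹) s) = 1 := by
    rw [hsum, exp_sum]
    have : ∀ d : Fin 4, exp (log ((edgeEnd δ (d, s) - z) / (edgeStart δ (d, s) - z))) =
        (edgeStart δ (d + 1, s) - z) / (edgeStart δ (d, s) - z) := fun d => by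
      rw [exp_log, hend]
      intro h
      have := hc d
      simp [h] at this
    simp only [this, Fin.prod_univ_four]
    have h0 := hne (0, s)
    have h1 := hne (1, s)
    have h2 := hne (2, s)
    have h3 := hne (3, s)
    have e1 : (0 : Fin 4) + 1 = 1 := rfl
    have e2 : (1 : Fin 4) + 1 = 2 := rfl
    have e3 : (2 : Fin 4) + 1 = 3 := rfl
    have e4 : (3 : Fin 4) + 1 = 0 := rfl
    rw [e1, e2, e3, e4]
    field_simp
  obtain ⟨n, hn⟩ := exp_eq_one_iff.1 hexp
  have him : (cellInt δ (fun w => (w - z)⁻¹) s).im = n * (2 * Real.pi) := by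
    rw [hn]; simp
  have hb : ∀ d : Fin 4, 0 < (log ((edgeEnd δ (d, s) - z) / (edgeStart δ (d, s) - z))).im ∧
      (log ((edgeEnd δ (d, s) - z) / (edgeStart δ (d, s) - z))).im < Real.pi := fun d => by
    rw [log_im]
    constructor
    · refine lt_of_le_of_ne (arg_nonneg_iff.2 (hc d).le) fun h => ?_
      have := (arg_eq_zero_iff.1 h.symm).2
      exact (hc d).ne' this
    · exact arg_lt_pi_iff.2 (Or.inr (hc d).ne')
  rw [hsum, Fin.sum_univ_four] at him
  simp only [add_im] at him
  have hpos := Real.pi_pos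
  have l1 : (0 : ℝ) < n * (2 * Real.pi) := by
    linarith [(hb 0).1, (hb 1).1, (hb 2).1, (hb 3).1]
  have l2 : n * (2 * Real.pi) < 2 * (2 * Real.pi) := by
    linarith [(hb 0).2, (hb 1).2, (hb 2).2, (hb 3).2]
  have l1 : (0 : ℝ) < n := by
    by_contra h
    push Not at h
    nlinarith
  have l2 : (n : ℝ) < 2 := lt_of_mul_lt_mul_right l2 (by positivity)
  have l1 : 0 < n := by exact_mod_cast l1
  have l2 : n < 2 := by exact_mod_cast l2
  obtain rfl : n = 1 := by omega
  rw [hn]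
  simp

theorem winding_gridChain_of_mem_openCell {δ : ℝ} (hδ : 0 < δ) (S : Finset (ℤ × ℤ)) {s : ℤ × ℤ}
    {z : ℂ} (hz : z ∈ openCell δ s) : winding (gridChain δ S) z = if s ∈ S then 1 else 0 := by
  have hpi : (2 * Real.pi * I : ℂ) ≠ 0 := two_pi_I_ne_zero
  rw [winding_eq_chainInt, ← sum_cellInt]
  split_ifs with hs
  · rw [Finset.sum_eq_single_of_mem s hs fun t _ ht => cellInt_inv_of_ne hδ ht hz,
      cellInt_inv_self hδ hz, inv_mul_cancel₀ hpi]
  · rw [Finset.sum_eq_zero fun t ht => cellInt_inv_of_ne hδ (ne_of_mem_of_not_mem ht hs) hz,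
      mul_zero]

/-- Away from the boundary edges the winding number is locally a sum of principal logarithms
evaluated in the slit plane. -/
theorem continuousAt_winding_gridChain (δ : ℝ) (S : Finset (ℤ × ℤ)) {z : ℂ}
    (hz : ∀ e ∈ boundaryEdges S, z ∉ segment ℝ (edgeStart δ e) (edgeEnd δ e)) :
    ContinuousAt (winding (gridChain δ S)) z := by
  have hcl : IsClosed (⋃ e ∈ boundaryEdges S, segment ℝ (edgeStart δ e) (edgeEnd δ e)) :=
    (boundaryEdges S).finite_toSet.isClosed_biUnion fun e _ => by
      rw [segment_eq_image']
      exact (isCompact_Icc.image (by fun_prop)).isClosed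
  have hev : ∀ᶠ w in nhds z, ∀ e ∈ boundaryEdges S,
      w ∉ segment ℝ (edgeStart δ e) (edgeEnd δ e) := by
    have hz' : z ∈ (⋃ e ∈ boundaryEdges S, segment ℝ (edgeStart δ e) (edgeEnd δ e))ᶜ := by
      simpa using hz
    filter_upwards [hcl.isOpen_compl.mem_nhds hz'] with w hw
    simpa using hw
  have heq : winding (gridChain δ S) =ᶠ[nhds z] fun w => (2 * Real.pi * I)⁻¹ *
      ∑ e ∈ boundaryEdges S, log ((edgeEnd δ e - w) / (edgeStart δ e - w)) := by
    filter_upwards [hev] with w hw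
    rw [winding_eq_chainInt, chainInt_gridChain]
    congr 1
    exact Finset.sum_congr rfl fun e he => segInt_inv (hw e he)
  refine ContinuousAt.congr ?_ heq.symm
  refine ContinuousAt.mul continuousAt_const (tendsto_finsetSum _ fun e he => ?_)
  refine ContinuousAt.clog ?_ (div_mem_slitPlane (hz e he))
  refine ContinuousAt.div (by fun_prop) (by fun_prop) fun h => hz e he ?_
  rw [← sub_eq_zero.1 h]
  exact left_mem_segment ℝ _ _

/-- A point off the frontier may still lie on a cell edge. The winding number is continuous there
and constant on the adjacent open cell, so the value extends. -/
theorem winding_gridChain_of_mem_closedCell {δ : ℝ} (hδ : 0 < δ) (S : Finset (ℤ × ℤ)) {s : ℤ × ℤ}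
    {z : ℂ} (hz : z ∈ closedCell δ s) (hf : z ∉ frontier (gridDomain δ S)) :
    winding (gridChain δ S) z = if s ∈ S then 1 else 0 := by
  rw [frontier_gridDomain hδ] at hf
  have hc := continuousAt_winding_gridChain δ S (z := z) (by simpa using hf)
  rw [← closure_openCell hδ] at hz
  have := hc.continuousWithinAt (s := openCell δ s) |>.mem_closure_image hz
  have h2 : winding (gridChain δ S) '' openCell δ s ⊆ {if s ∈ S then 1 else 0} := by
    rintro _ ⟨w, hw, rfl⟩
    exact winding_gridChain_of_mem_openCell hδ S hw
  simpa using closure_mono h2 this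

theorem isOrientedBoundary_gridChain {δ : ℝ} (hδ : 0 < δ) (S : Finset (ℤ × ℤ)) :
    IsOrientedBoundary (gridDomain δ S) (gridChain δ S) where
  contDiffOn k := by
    unfold gridChain
    have : ContDiff ℝ 1 (fun t : ℝ => (t : ℂ)) := ofRealCLM.contDiff
    exact (contDiff_const.add (this.mul contDiff_const)).contDiffOn
  frontier_eq := by rw [frontier_gridDomain hδ, range_gridChain]
  winding_inside z hz := by
    obtain ⟨s, hs⟩ := exists_mem_closedCell hδ z
    rw [winding_gridChain_of_mem_closedCell hδ S hs, if_pos (hz s hs)]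
    exact fun h => h.2 (by rwa [(isOpen_gridDomain hδ S).interior_eq])
  winding_outside z hz := by
    obtain ⟨s, hs⟩ := exists_mem_closedCell hδ z
    rw [winding_gridChain_of_mem_closedCell hδ S hs fun h => hz (frontier_subset_closure h),
      if_neg]
    intro h
    rw [closure_gridDomain hδ] at hz
    exact hz (Set.mem_biUnion h hs)

end GridIntegral

/-! ### Integrals along chains of `C¹` arcs. -/

section Chains

open MeasureTheory

variable {E F : Type*} [NormedAddCommGroup E] [NormedSpace ℂ E] [NormedAddCommGroup F]
  [NormedSpace ℂ F]

/-- The set of points on a chain of arcs. -/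
def trace {n : ℕ} (γ : Fin n → ℝ → ℂ) : Set ℂ := ⋃ k, γ k '' Set.Icc 0 1

/-- Every arc of the chain is continuously differentiable. -/
def IsC1Chain {n : ℕ} (γ : Fin n → ℝ → ℂ) : Prop := ∀ k, ContDiffOn ℝ 1 (γ k) (Set.Icc 0 1)

theorem mem_trace {n : ℕ} (γ : Fin n → ℝ → ℂ) (k : Fin n) {t : ℝ} (ht : t ∈ Set.Icc (0 : ℝ) 1) :
    γ k t ∈ trace γ := Set.mem_iUnion.2 ⟨k, t, ht, rfl⟩

/-- The arcs are `C¹` only on `[0, 1]`, so `deriv` is uncontrolled at the endpoints. Replacing it by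
`derivWithin` gives continuous integrands without changing the integrals. -/
theorem derivWithin_ae_eq_deriv (c : ℝ → ℂ) :
    ∀ᵐ t ∂volume.restrict (Set.Icc (0 : ℝ) 1), derivWithin c (Set.Icc 0 1) t = deriv c t := by
  rw [← restrict_Ioo_eq_restrict_Icc, ae_restrict_iff' measurableSet_Ioo]
  refine Filter.Eventually.of_forall fun t ht => ?_
  exact derivWithin_of_mem_nhds (Icc_mem_nhds ht.1 ht.2)

theorem intervalIntegral_eq_Icc {G : Type*} [NormedAddCommGroup G] [NormedSpace ℝ G] (f : ℝ → G) :
    ∫ t in (0 : ℝ)..1, f t = ∫ t in Set.Icc 0 1, f t := by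
  rw [intervalIntegral.integral_of_le zero_le_one, integral_Icc_eq_integral_Ioc]

theorem chainInt_eq_setIntegral {n : ℕ} (γ : Fin n → ℝ → ℂ) (f : ℂ → E) :
    chainInt γ f = ∑ k, ∫ t in Set.Icc (0 : ℝ) 1, derivWithin (γ k) (Set.Icc 0 1) t • f (γ k t) := by
  refine Finset.sum_congr rfl fun k _ => ?_
  rw [intervalIntegral_eq_Icc]
  refine integral_congr_ae ?_
  filter_upwards [derivWithin_ae_eq_deriv (γ k)] with t ht
  rw [ht]

theorem IsC1Chain.continuousOn_derivWithin {n : ℕ} {γ : Fin n → ℝ → ℂ} (hγ : IsC1Chain γ)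
    (k : Fin n) : ContinuousOn (derivWithin (γ k) (Set.Icc 0 1)) (Set.Icc 0 1) :=
  (hγ k).continuousOn_derivWithin (uniqueDiffOn_Icc zero_lt_one) le_rfl

theorem IsC1Chain.continuousOn {n : ℕ} {γ : Fin n → ℝ → ℂ} (hγ : IsC1Chain γ) (k : Fin n) :
    ContinuousOn (γ k) (Set.Icc 0 1) := (hγ k).continuousOn

theorem IsC1Chain.continuousOn_comp {n : ℕ} {γ : Fin n → ℝ → ℂ} (hγ : IsC1Chain γ) (k : Fin n)
    {G : Type*} [TopologicalSpace G] {f : ℂ → G} (hf : ContinuousOn f (trace γ)) :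
    ContinuousOn (fun t => f (γ k t)) (Set.Icc 0 1) :=
  hf.comp (hγ.continuousOn k) fun _ ht => mem_trace γ k ht

theorem IsC1Chain.integrableOn {n : ℕ} {γ : Fin n → ℝ → ℂ} (hγ : IsC1Chain γ) {f : ℂ → E}
    (hf : ContinuousOn f (trace γ)) (k : Fin n) :
    IntegrableOn (fun t => derivWithin (γ k) (Set.Icc 0 1) t • f (γ k t)) (Set.Icc 0 1) :=
  ((hγ.continuousOn_derivWithin k).smul (hγ.continuousOn_comp k hf)).integrableOn_compact
    isCompact_Icc

theorem chainInt_congr {n : ℕ} {γ : Fin n → ℝ → ℂ} {f g : ℂ → E} (h : Set.EqOn f g (trace γ)) :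
    chainInt γ f = chainInt γ g := by
  refine Finset.sum_congr rfl fun k _ => ?_
  refine intervalIntegral.integral_congr fun t ht => ?_
  rw [Set.uIcc_of_le zero_le_one] at ht
  simp only [h (mem_trace γ k ht)]

theorem chainInt_add {n : ℕ} {γ : Fin n → ℝ → ℂ} (hγ : IsC1Chain γ) {f g : ℂ → E}
    (hf : ContinuousOn f (trace γ)) (hg : ContinuousOn g (trace γ)) :
    chainInt γ (fun z => f z + g z) = chainInt γ f + chainInt γ g := by
  simp only [chainInt_eq_setIntegral, ← Finset.sum_add_distrib, smul_add]
  exact Finset.sum_congr rfl fun k _ => integral_add (hγ.integrableOn hf k) (hγ.integrableOn hg k)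

theorem chainInt_clm [CompleteSpace E] [CompleteSpace F] {n : ℕ} {γ : Fin n → ℝ → ℂ}
    (hγ : IsC1Chain γ) {f : ℂ → E} (hf : ContinuousOn f (trace γ)) (L : E →L[ℂ] F) :
    chainInt γ (fun z => L (f z)) = L (chainInt γ f) := by
  simp only [chainInt_eq_setIntegral, map_sum]
  refine Finset.sum_congr rfl fun k _ => ?_
  rw [← L.integral_comp_comm (hγ.integrableOn hf k)]
  simp

theorem chainInt_smul {n : ℕ} (γ : Fin n → ℝ → ℂ) (f : ℂ → E) (c : ℂ) :
    chainInt γ (fun z => c • f z) = c • chainInt γ f := by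
  simp only [chainInt, Finset.smul_sum, ← intervalIntegral.integral_smul]
  refine Finset.sum_congr rfl fun k _ => ?_
  congr 1
  ext t
  rw [smul_comm]

theorem chainInt_smul_const [CompleteSpace E] {n : ℕ} (γ : Fin n → ℝ → ℂ) (f : ℂ → ℂ) (c : E) :
    chainInt γ (fun z => f z • c) = chainInt γ f • c := by
  simp only [chainInt, Finset.sum_smul, ← intervalIntegral.integral_smul_const]
  simp only [smul_eq_mul, smul_smul]

/-- This is how winding numbers, the only orientation data of a chain, enter operator-valued
integrals. -/
theorem chainInt_inv_smul [CompleteSpace E] {n : ℕ} (γ : Fin n → ℝ → ℂ) (w : ℂ) (c : E) :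
    chainInt γ (fun z => (z - w)⁻¹ • c) = (2 * Real.pi * I * winding γ w) • c := by
  rw [chainInt_smul_const, winding_eq_chainInt, ← mul_assoc, mul_inv_cancel₀ two_pi_I_ne_zero,
    one_mul]

/-- Fubini for each pair of arcs: the integrand is continuous on the compact parameter square. -/
theorem chainInt_comm [CompleteSpace E] {n m : ℕ} {γ : Fin n → ℝ → ℂ} {Γ : Fin m → ℝ → ℂ}
    (hγ : IsC1Chain γ)
    (hΓ : IsC1Chain Γ) {f : ℂ → ℂ → E}
    (hf : ContinuousOn (fun p : ℂ × ℂ => f p.1 p.2) (trace γ ×ˢ trace Γ)) :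
    chainInt γ (fun z => chainInt Γ fun w => f z w) =
      chainInt Γ (fun w => chainInt γ fun z => f z w) := by
  simp only [chainInt_eq_setIntegral]
  set μ := volume.restrict (Set.Icc (0 : ℝ) 1) with hμ
  let g : Fin n → Fin m → ℝ → ℝ → E := fun k l t u =>
    derivWithin (γ k) (Set.Icc 0 1) t • derivWithin (Γ l) (Set.Icc 0 1) u • f (γ k t) (Γ l u)
  have hint : ∀ k l, Integrable (Function.uncurry (g k l)) (μ.prod μ) := by
    intro k l
    rw [hμ, Measure.prod_restrict]
    refine ContinuousOn.integrableOn_compact (isCompact_Icc.prod isCompact_Icc) ?_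
    refine ContinuousOn.smul ((hγ.continuousOn_derivWithin k).comp continuousOn_fst
      fun p hp => hp.1) (ContinuousOn.smul ((hΓ.continuousOn_derivWithin l).comp continuousOn_snd
      fun p hp => hp.2) ?_)
    exact hf.comp (((hγ.continuousOn k).comp continuousOn_fst fun p hp => hp.1).prodMk
      ((hΓ.continuousOn l).comp continuousOn_snd fun p hp => hp.2))
      fun p hp => ⟨mem_trace γ k hp.1, mem_trace Γ l hp.2⟩
  have h1 : ∀ k, ∫ t, derivWithin (γ k) (Set.Icc 0 1) t • ∑ l, ∫ u,
      derivWithin (Γ l) (Set.Icc 0 1) u • f (γ k t) (Γ l u) ∂μ ∂μ =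
      ∑ l, ∫ t, ∫ u, g k l t u ∂μ ∂μ := by
    intro k
    refine Eq.trans ?_ (integral_finsetSum _ fun l _ => (hint k l).integral_prod_left)
    simp only [Finset.smul_sum, g, integral_smul]
  have h2 : ∀ l, ∫ u, derivWithin (Γ l) (Set.Icc 0 1) u • ∑ k, ∫ t,
      derivWithin (γ k) (Set.Icc 0 1) t • f (γ k t) (Γ l u) ∂μ ∂μ =
      ∑ k, ∫ u, ∫ t, g k l t u ∂μ ∂μ := by
    intro l
    refine Eq.trans ?_ (integral_finsetSum _ fun k _ => (hint k l).integral_prod_right)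
    simp only [Finset.smul_sum, g, ← integral_smul]
    congr 1
    ext u
    refine Finset.sum_congr rfl fun k _ => ?_
    congr 1
    ext t
    exact smul_comm _ _ _
  simp only [h1, h2]
  rw [Finset.sum_comm]
  exact Finset.sum_congr rfl fun l _ => Finset.sum_congr rfl fun k _ =>
    integral_integral_swap (hint k l)

end Chains

/-! ### Riesz integrals in a complex Banach algebra. -/

section BanachAlgebra

variable {A : Type*} [NormedRing A] [NormedAlgebra ℂ A]

/-- The Riesz integral `(1 / 2πi) ∮ (z - a)⁻¹ dz`. -/
noncomputable def rieszInt {n : ℕ} (γ : Fin n → ℝ → ℂ) (a : A) : A :=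
  (2 * Real.pi * I : ℂ)⁻¹ • chainInt γ (resolvent a)

theorem notMem_spectrum_iff_isUnit {a : A} {z : ℂ} :
    z ∉ spectrum ℂ a ↔ IsUnit (algebraMap ℂ A z - a) := spectrum.notMem_iff

theorem sub_mul_resolvent {a : A} {z : ℂ} (hz : z ∉ spectrum ℂ a) :
    (algebraMap ℂ A z - a) * resolvent a z = 1 :=
  Ring.mul_inverse_cancel _ (notMem_spectrum_iff_isUnit.1 hz)

theorem resolvent_mul_sub {a : A} {z : ℂ} (hz : z ∉ spectrum ℂ a) :
    resolvent a z * (algebraMap ℂ A z - a) = 1 :=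
  Ring.inverse_mul_cancel _ (notMem_spectrum_iff_isUnit.1 hz)

theorem commute_resolvent {a b : A} (h : Commute b a) (z : ℂ) : Commute b (resolvent a z) := by
  have h1 : Commute b (algebraMap ℂ A z - a) := (Algebra.commute_algebraMap_right z b).sub_right h
  by_cases hu : IsUnit (algebraMap ℂ A z - a)
  · rw [resolvent]
    obtain ⟨u, hu⟩ := hu
    rw [← hu, Ring.inverse_unit]
    rw [← hu] at h1
    exact h1.units_inv_right
  · rw [resolvent, Ring.inverse_non_unit _ hu]
    exact Commute.zero_right b

theorem sub_mul_resolvent_smul {a : A} {z w : ℂ} (hw : w ∉ spectrum ℂ a) (hzw : z ≠ w) :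
    (algebraMap ℂ A z - a) * ((z - w)⁻¹ • resolvent a w) = resolvent a w - (w - z)⁻¹ • 1 := by
  have h1 : (algebraMap ℂ A z - a) = algebraMap ℂ A (z - w) + (algebraMap ℂ A w - a) := by
    rw [map_sub]; abel
  rw [mul_smul_comm, h1, add_mul, sub_mul_resolvent hw, smul_add, ← Algebra.smul_def, smul_smul,
    inv_mul_cancel₀ (sub_ne_zero.2 hzw), one_smul, ← neg_sub w z, inv_neg, neg_smul, ← sub_eq_add_neg]

/-- The resolvent equation, arranged so that integrating over `w` turns the second summand into a
winding number around `z`. -/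
theorem resolvent_mul_resolvent {a : A} {z w : ℂ} (hz : z ∉ spectrum ℂ a)
    (hw : w ∉ spectrum ℂ a) (hzw : z ≠ w) :
    resolvent a z * resolvent a w + (w - z)⁻¹ • (- resolvent a z) =
      (z - w)⁻¹ • resolvent a w := by
  have h := congrArg (resolvent a z * ·) (sub_mul_resolvent_smul hw hzw)
  rw [← mul_assoc, resolvent_mul_sub hz, one_mul, mul_sub, mul_smul_comm, mul_one] at h
  rw [h, smul_neg, ← sub_eq_add_neg]

variable [CompleteSpace A]

theorem continuousOn_resolvent {a : A} {X : Set ℂ} (hX : Disjoint X (spectrum ℂ a)) :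
    ContinuousOn (resolvent a) X := fun _ hz =>
  (spectrum.hasDerivAt_resolvent_const_left
    (Set.notMem_compl_iff.1 (hX.notMem_of_mem_left hz))).continuousAt.continuousWithinAt

theorem differentiableOn_resolvent {a : A} {X : Set ℂ} (hX : Disjoint X (spectrum ℂ a)) :
    DifferentiableOn ℂ (resolvent a) X := fun _ hz =>
  (spectrum.hasDerivAt_resolvent_const_left
    (Set.notMem_compl_iff.1 (hX.notMem_of_mem_left hz))).differentiableAt.differentiableWithinAt

theorem chainInt_mul_left {n : ℕ} {γ : Fin n → ℝ → ℂ} (hγ : IsC1Chain γ) {f : ℂ → A}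
    (hf : ContinuousOn f (trace γ)) (b : A) :
    chainInt γ (fun z => b * f z) = b * chainInt γ f :=
  chainInt_clm hγ hf (ContinuousLinearMap.mul ℂ A b)

theorem chainInt_mul_right {n : ℕ} {γ : Fin n → ℝ → ℂ} (hγ : IsC1Chain γ) {f : ℂ → A}
    (hf : ContinuousOn f (trace γ)) (b : A) :
    chainInt γ (fun z => f z * b) = chainInt γ f * b :=
  chainInt_clm hγ hf ((ContinuousLinearMap.mul ℂ A).flip b)

theorem commute_chainInt {n : ℕ} {γ : Fin n → ℝ → ℂ} (hγ : IsC1Chain γ) {f : ℂ → A}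
    (hf : ContinuousOn f (trace γ)) {b : A} (h : ∀ z, Commute b (f z)) :
    Commute b (chainInt γ f) := by
  rw [Commute, SemiconjBy, ← chainInt_mul_left hγ hf, ← chainInt_mul_right hγ hf]
  exact chainInt_congr fun z _ => h z

theorem commute_rieszInt {n : ℕ} {γ : Fin n → ℝ → ℂ} (hγ : IsC1Chain γ) {a b : A}
    (hf : Disjoint (trace γ) (spectrum ℂ a)) (h : Commute b a) : Commute b (rieszInt γ a) :=
  (commute_chainInt hγ (continuousOn_resolvent hf) fun z => commute_resolvent h z).smul_right _

/-- The product of two Riesz integrals, where the second chain does not wind around the first. -/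
theorem rieszInt_mul_rieszInt {n m : ℕ} {γ : Fin n → ℝ → ℂ} {Γ : Fin m → ℝ → ℂ} (hγ : IsC1Chain γ)
    (hΓ : IsC1Chain Γ) {a : A} (hγa : Disjoint (trace γ) (spectrum ℂ a))
    (hΓa : Disjoint (trace Γ) (spectrum ℂ a)) (hdisj : Disjoint (trace γ) (trace Γ))
    (hwind : ∀ z ∈ trace γ, winding Γ z = 0) {c : ℂ} (hc : ∀ w ∈ trace Γ, winding γ w = c) :
    rieszInt γ a * rieszInt Γ a = c • rieszInt Γ a := by
  have hne : ∀ z ∈ trace γ, ∀ w ∈ trace Γ, z ≠ w := fun z hz w hw h =>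
    hdisj.notMem_of_mem_left hz (h ▸ hw)
  have hRγ := continuousOn_resolvent hγa
  have hRΓ := continuousOn_resolvent hΓa
  have h1 : ∀ z ∈ trace γ, resolvent a z * chainInt Γ (resolvent a) =
      chainInt Γ fun w => (z - w)⁻¹ • resolvent a w := by
    intro z hz
    -- This integral vanishes because `Γ` does not wind around `z`; adding it completes the
    -- resolvent equation under the integral.
    have h2 := chainInt_inv_smul Γ z (- resolvent a z)
    rw [hwind z hz, mul_zero, zero_smul] at h2
    rw [← chainInt_mul_left hΓ hRΓ, ← add_zero (chainInt Γ _), ← h2,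
      ← chainInt_add hΓ (hRΓ.const_mul _)]
    · exact chainInt_congr fun w hw => resolvent_mul_resolvent (hγa.notMem_of_mem_left hz)
        (hΓa.notMem_of_mem_left hw) (hne z hz w hw)
    · refine ContinuousOn.smul (ContinuousOn.inv₀ (by fun_prop) fun w hw => ?_) continuousOn_const
      exact sub_ne_zero.2 (hne z hz w hw).symm
  have h3 : chainInt γ (resolvent a) * chainInt Γ (resolvent a) =
      (2 * Real.pi * I * c) • chainInt Γ (resolvent a) := by
    -- After exchanging the integrals, the inner one is that of `(z - w)⁻¹` along `γ`, which is `2πi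
    -- c`.
    rw [← chainInt_mul_right hγ hRγ, chainInt_congr h1, chainInt_comm hγ hΓ, ← chainInt_smul]
    · refine chainInt_congr fun w hw => ?_
      rw [chainInt_inv_smul, hc w hw]
    · refine ContinuousOn.smul (ContinuousOn.inv₀ (by fun_prop) fun p hp => ?_)
        (hRΓ.comp continuousOn_snd fun p hp => hp.2)
      exact sub_ne_zero.2 (hne _ hp.1 _ hp.2)
  have hpi := two_pi_I_ne_zero
  rw [rieszInt, rieszInt, smul_mul_smul_comm, h3, smul_smul, smul_smul]
  congr 1
  field_simp

/-- If the chain does not wind around `z`, then `z - a` has an inverse relative to the Riesz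
integral. -/
theorem exists_mul_eq_rieszInt {n : ℕ} {γ : Fin n → ℝ → ℂ} (hγ : IsC1Chain γ) {a : A}
    (hγa : Disjoint (trace γ) (spectrum ℂ a)) {z : ℂ} (hz : z ∉ trace γ) (hw : winding γ z = 0) :
    ∃ v : A, (algebraMap ℂ A z - a) * v = rieszInt γ a ∧ ∀ b, Commute b a → Commute b v := by
  have hR := continuousOn_resolvent hγa
  have hne : ∀ w ∈ trace γ, z ≠ w := fun w hw h => hz (h ▸ hw)
  have hc : ContinuousOn (fun w => (z - w)⁻¹ • resolvent a w) (trace γ) :=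
    ContinuousOn.smul (ContinuousOn.inv₀ (by fun_prop) fun w hw => sub_ne_zero.2 (hne w hw)) hR
  -- The witness is the functional calculus applied to `w ↦ (z - w)⁻¹`, holomorphic away from `z`.
  refine ⟨(2 * Real.pi * I : ℂ)⁻¹ • chainInt γ fun w => (z - w)⁻¹ • resolvent a w, ?_, ?_⟩
  · rw [rieszInt, mul_smul_comm, ← chainInt_mul_left hγ hc]
    congr 1
    have h2 := chainInt_inv_smul γ z (-1 : A)
    rw [hw, mul_zero, zero_smul] at h2
    rw [← add_zero (chainInt γ (resolvent a)), ← h2, ← chainInt_add hγ hR]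
    · refine chainInt_congr fun w hw => ?_
      rw [sub_mul_resolvent_smul (hγa.notMem_of_mem_left hw) (hne w hw), smul_neg, sub_eq_add_neg]
    · refine ContinuousOn.smul (ContinuousOn.inv₀ (by fun_prop) fun w hw => ?_) continuousOn_const
      exact sub_ne_zero.2 (hne w hw).symm
  · intro b hb
    exact (commute_chainInt hγ hc fun w => (commute_resolvent hb w).smul_right _).smul_right _

/-- The square block of the cells with both indices in `[-N, N)`. -/
noncomputable def block (N : ℕ) : Finset (ℤ × ℤ) := Finset.Ico (-N : ℤ) N ×ˢ Finset.Ico (-N : ℤ) N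

theorem mem_block {N : ℕ} {s : ℤ × ℤ} :
    s ∈ block N ↔ ((-N : ℤ) ≤ s.1 ∧ s.1 < N) ∧ ((-N : ℤ) ≤ s.2 ∧ s.2 < N) := by
  simp [block]

/-- Only linear growth matters, against an integrand decaying like `N⁻²`. A boundary edge belongs to
a cell with an extreme index; four edges for each of at most `8 N` such cells, corners counted
twice. -/
theorem card_boundaryEdges_block_le (N : ℕ) : (boundaryEdges (block N)).card ≤ 32 * N := by
  let J := Finset.Ico (-N : ℤ) N
  have hJ : J.card = 2 * N := by simp [J]; omega
  let B : Finset ℤ := {-(N : ℤ), (N : ℤ) - 1}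
  have hB : B.card ≤ 2 := Finset.card_le_two
  have hsub : boundaryEdges (block N) ⊆ Finset.univ ×ˢ ((J ×ˢ B) ∪ (B ×ˢ J)) := by
    rintro ⟨d, i, j⟩ he
    simp only [boundaryEdges, Finset.mem_filter, Finset.mem_product, Finset.mem_univ, true_and,
      mem_block] at he
    simp only [Finset.mem_product, Finset.mem_univ, true_and, Finset.mem_union, J, B,
      Finset.mem_insert, Finset.mem_singleton, Finset.mem_Ico]
    obtain ⟨h1, h2⟩ := he
    fin_cases d <;> simp [neighbour] at h2 <;> omega
  refine (Finset.card_le_card hsub).trans ?_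
  rw [Finset.card_product]
  have := Finset.card_union_le (J ×ˢ B) (B ×ˢ J)
  rw [Finset.card_product, Finset.card_product, hJ] at this
  have h4 : (Finset.univ : Finset (Fin 4)).card = 4 := rfl
  rw [h4]
  nlinarith

theorem norm_of_mem_edge_block {δ : ℝ} (hδ : 0 < δ) {N : ℕ} {e : Fin 4 × (ℤ × ℤ)}
    (he : e ∈ boundaryEdges (block N)) {w : ℂ}
    (hw : w ∈ segment ℝ (edgeStart δ e) (edgeEnd δ e)) : δ * N ≤ ‖w‖ := by
  have hw := ((mem_edge_iff hδ e w).1 hw).2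
  simp only [boundaryEdges, Finset.mem_filter] at he
  have he := he.2
  set s := e.2 + neighbour e.1
  rw [mem_block] at he
  rw [mem_closedCell] at hw
  have key : ∀ (i : ℤ) (x : ℝ), ¬ ((-N : ℤ) ≤ i ∧ i < N) → (δ * i ≤ x ∧ x ≤ δ * (i + 1)) →
      δ * N ≤ |x| := by
    intro i x hi hx
    by_cases h : (N : ℤ) ≤ i
    · have h : (N : ℝ) ≤ i := by exact_mod_cast h
      exact (mul_le_mul_of_nonneg_left h hδ.le).trans (hx.1.trans (le_abs_self x))
    · have h : i + 1 ≤ -(N : ℤ) := by omega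
      have h : (i : ℝ) + 1 ≤ -(N : ℝ) := by exact_mod_cast h
      have := hx.2.trans (mul_le_mul_of_nonneg_left h hδ.le)
      exact le_trans (by linarith) (neg_le_abs x)
  by_cases h1 : (-N : ℤ) ≤ s.1 ∧ s.1 < N
  · exact (key s.2 w.im (fun h => he ⟨h1, h⟩) hw.2).trans (abs_im_le_norm w)
  · exact (key s.1 w.re h1 hw.1).trans (abs_re_le_norm w)

theorem norm_edge {δ : ℝ} (hδ : 0 < δ) (e : Fin 4 × (ℤ × ℤ)) :
    ‖edgeEnd δ e - edgeStart δ e‖ = δ := by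
  obtain ⟨d, i, j⟩ := e
  obtain ⟨u, hu, h⟩ : ∃ u : ℂ, ‖u‖ = 1 ∧ edgeEnd δ (d, i, j) - edgeStart δ (d, i, j) = δ * u := by
    fin_cases d
    · exact ⟨1, by simp, by simp [edgeStart, edgeEnd, gridPoint, cornerOffset]; ring⟩
    · exact ⟨I, by simp, by simp [edgeStart, edgeEnd, gridPoint, cornerOffset]; ring⟩
    · exact ⟨-1, by simp, by simp [edgeStart, edgeEnd, gridPoint, cornerOffset]; ring⟩
    · exact ⟨-I, by simp, by simp [edgeStart, edgeEnd, gridPoint, cornerOffset]; ring⟩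
  rw [h, norm_mul, hu, mul_one, norm_real, Real.norm_of_nonneg hδ.le]

theorem norm_segInt_le {E : Type*} [NormedAddCommGroup E] [NormedSpace ℂ E] {f : ℂ → E} {a b : ℂ}
    {C : ℝ} (h : ∀ w ∈ segment ℝ a b, ‖f w‖ ≤ C) : ‖segInt f a b‖ ≤ ‖b - a‖ * C := by
  have := intervalIntegral.norm_integral_le_of_norm_le_const (a := (0 : ℝ)) (b := 1)
    (f := fun t : ℝ => (b - a) • f (a + t * (b - a))) (C := ‖b - a‖ * C) fun t ht => by
      rw [norm_smul]
      refine mul_le_mul_of_nonneg_left (h _ ?_) (norm_nonneg _)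
      rw [Set.uIoc_of_le zero_le_one] at ht
      rw [segment_eq_image']
      exact ⟨t, ⟨ht.1.le, ht.2⟩, by simp⟩
  simpa [segInt] using this

theorem zero_mem_gridDomain_block {δ : ℝ} (hδ : 0 < δ) {N : ℕ} (hN : 1 ≤ N) :
    (0 : ℂ) ∈ gridDomain δ (block N) := by
  intro s hs
  rw [mem_closedCell] at hs
  have key : ∀ i : ℤ, (δ * i ≤ 0 ∧ 0 ≤ δ * ((i : ℝ) + 1)) → (-N : ℤ) ≤ i ∧ i < N := by
    intro i hi
    have h1 : (i : ℝ) ≤ 0 := by by_contra h; push Not at h; nlinarith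
    have h2 : (0 : ℝ) ≤ i + 1 := by by_contra h; push Not at h; nlinarith
    have h1 : i ≤ 0 := by exact_mod_cast h1
    have h2 : 0 ≤ i + 1 := by exact_mod_cast h2
    omega
  exact mem_block.2 ⟨key _ hs.1, key _ hs.2⟩

/-- If no cell outside `S` meets the spectrum, then the Riesz integral along the boundary of `S`
is the identity. -/
theorem rieszInt_gridChain_eq_one {δ : ℝ} (hδ : 0 < δ) (S : Finset (ℤ × ℤ)) (a : A)
    (hS : ∀ s ∉ S, Disjoint (closedCell δ s) (spectrum ℂ a)) : rieszInt (gridChain δ S) a = 1 := by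
  have hpi := two_pi_I_ne_zero
  obtain ⟨C, hC⟩ := (spectrum.resolvent_isBigO_inv (𝕜 := ℂ) a).bound
  obtain ⟨r, hr⟩ : ∃ r : ℝ, ∀ w : ℂ, r ≤ ‖w‖ → ‖resolvent a w‖ ≤ C * ‖w⁻¹‖ ∧ w ∉ spectrum ℂ a := by
    rw [← comap_norm_atTop, Filter.eventually_comap, Filter.eventually_atTop] at hC
    obtain ⟨r, hr⟩ := hC
    refine ⟨max r (‖a‖ * ‖(1 : A)‖ + 1), fun w hw => ⟨hr _ ((le_max_left _ _).trans hw) w rfl, ?_⟩⟩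
    have : ‖a‖ * ‖(1 : A)‖ < ‖w‖ := by linarith [(le_max_right r (‖a‖ * ‖(1 : A)‖ + 1)).trans hw]
    exact Set.notMem_compl_iff.2 (spectrum.mem_resolventSet_of_norm_lt_mul this)
  obtain ⟨M, hM⟩ : ∃ M : ℕ, S ⊆ block M := by
    refine ⟨S.sup (fun s => s.1.natAbs + s.2.natAbs + 1), fun s hs => ?_⟩
    have := Finset.le_sup (f := fun s : ℤ × ℤ => s.1.natAbs + s.2.natAbs + 1) hs
    rw [mem_block]
    omega
  -- The added cells are free of spectrum, so they contribute nothing.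
  have hblock : ∀ N : ℕ, M ≤ N →
      chainInt (gridChain δ S) (resolvent a) = chainInt (gridChain δ (block N)) (resolvent a) := by
    intro N hN
    rw [← sum_cellInt, ← sum_cellInt]
    refine Finset.sum_subset (fun s hs => ?_) fun s _ hs =>
      cellInt_eq_zero hδ (differentiableOn_resolvent (hS s hs))
    have := mem_block.1 (hM hs)
    rw [mem_block]
    omega
  -- Since `R(w) - w⁻¹ = w⁻¹ R(w) a` is `O(|w|⁻²)`, at most `32 N` edges of length `δ`, at distance
  -- at least `δ N` from `0`, contribute `O(1/N)`.
  have hbound : ∀ N : ℕ, M ≤ N → 1 ≤ N → r ≤ δ * N →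
      ‖chainInt (gridChain δ S) (resolvent a) - (2 * Real.pi * I : ℂ) • (1 : A)‖ ≤
        32 * |C| * ‖a‖ / δ * (N : ℝ)⁻¹ := by
    intro N hMN hN hrN
    have hNpos : (0 : ℝ) < N := by exact_mod_cast hN
    have hC1 := (isOrientedBoundary_gridChain hδ (block N)).contDiffOn
    have htr : trace (gridChain δ (block N)) =
        ⋃ e ∈ boundaryEdges (block N), segment ℝ (edgeStart δ e) (edgeEnd δ e) :=
      range_gridChain δ (block N)
    have hlarge : ∀ w ∈ trace (gridChain δ (block N)), δ * N ≤ ‖w‖ := by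
      intro w hw
      rw [htr, Set.mem_iUnion₂] at hw
      obtain ⟨e, he, hw⟩ := hw
      exact norm_of_mem_edge_block hδ he hw
    have hδN : 0 < δ * N := by positivity
    have hw1 := chainInt_inv_smul (gridChain δ (block N)) 0 (-1 : A)
    rw [(isOrientedBoundary_gridChain hδ (block N)).winding_inside 0
      (zero_mem_gridDomain_block hδ hN), mul_one, smul_neg] at hw1
    rw [hblock N hMN, sub_eq_add_neg, ← hw1, ← chainInt_add hC1, chainInt_gridChain]
    · refine (norm_sum_le _ _).trans ?_
      have hseg : ∀ e ∈ boundaryEdges (block N), ‖segInt (fun z => resolvent a z + (z - 0)⁻¹ • (-1 : A))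
          (edgeStart δ e) (edgeEnd δ e)‖ ≤ δ * (|C| * ‖a‖ * (δ * N)⁻¹ ^ 2) := by
        intro e he
        refine (norm_segInt_le (C := |C| * ‖a‖ * (δ * N)⁻¹ ^ 2) fun w hw => ?_).trans
          (by rw [norm_edge hδ])
        have hwl := norm_of_mem_edge_block hδ he hw
        obtain ⟨hb, hsp⟩ := hr w (hrN.trans hwl)
        have hw0 : w ≠ 0 := norm_pos_iff.1 (hδN.trans_le hwl)
        have hid : resolvent a w + (w - 0)⁻¹ • (-1 : A) = w⁻¹ • (resolvent a w * a) := by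
          have h := resolvent_mul_sub hsp
          rw [mul_sub, ← Algebra.commutes, ← Algebra.smul_def] at h
          rw [sub_zero, ← h, neg_sub, smul_sub, smul_smul, inv_mul_cancel₀ hw0, one_smul]
          abel
        have hinv : ‖w⁻¹‖ ≤ (δ * N)⁻¹ := by
          rw [norm_inv]
          exact inv_anti₀ hδN hwl
        rw [hid, norm_smul]
        calc ‖w⁻¹‖ * ‖resolvent a w * a‖ ≤ ‖w⁻¹‖ * ((|C| * ‖w⁻¹‖) * ‖a‖) := by
              gcongr
              refine (norm_mul_le _ _).trans ?_
              gcongr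
              exact hb.trans (by gcongr; exact le_abs_self C)
          _ = |C| * ‖a‖ * ‖w⁻¹‖ ^ 2 := by ring
          _ ≤ _ := by gcongr
      refine (Finset.sum_le_sum hseg).trans ?_
      rw [Finset.sum_const, nsmul_eq_mul]
      have hcard : ((boundaryEdges (block N)).card : ℝ) ≤ 32 * N := by
        exact_mod_cast card_boundaryEdges_block_le N
      calc _ ≤ (32 * N : ℝ) * (δ * (|C| * ‖a‖ * (δ * N)⁻¹ ^ 2)) := by gcongr
        _ = _ := by field_simp
    · refine continuousOn_resolvent (Set.disjoint_left.2 fun w hw => ?_)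
      exact (hr w (hrN.trans (hlarge w hw))).2
    · refine ContinuousOn.smul (ContinuousOn.inv₀ (by fun_prop) fun w hw => ?_) continuousOn_const
      rw [sub_zero]
      exact norm_pos_iff.1 (hδN.trans_le (hlarge w hw))
  have hlim : Filter.Tendsto (fun N : ℕ => 32 * |C| * ‖a‖ / δ * (N : ℝ)⁻¹) Filter.atTop (nhds 0) := by
    simpa using (tendsto_inv_atTop_nhds_zero_nat (𝕜 := ℝ)).const_mul (32 * |C| * ‖a‖ / δ)
  have hzero : ‖chainInt (gridChain δ S) (resolvent a) - (2 * Real.pi * I : ℂ) • (1 : A)‖ ≤ 0 := by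
    refine ge_of_tendsto hlim ?_
    have h3 : Filter.Tendsto (fun N : ℕ => δ * (N : ℝ)) Filter.atTop Filter.atTop :=
      tendsto_natCast_atTop_atTop.const_mul_atTop hδ
    filter_upwards [Filter.eventually_ge_atTop M, Filter.eventually_ge_atTop 1,
      h3.eventually_ge_atTop r] with N h1 h2 h3
    exact hbound N h1 h2 h3
  rw [rieszInt, sub_eq_zero.1 (norm_le_zero_iff.1 hzero), smul_smul, inv_mul_cancel₀ hpi, one_smul]

end BanachAlgebra

/-! ### Independence of the separating chain; reflection in the real axis. -/

section Separation

/-- `γ` is the oriented boundary of an open neighbourhood `D` of `K` whose closure does not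
meet `L`. -/
structure Separates (K L D : Set ℂ) {n : ℕ} (γ : Fin n → ℝ → ℂ) : Prop where
  isOpen : IsOpen D
  subset : K ⊆ D
  disjoint : Disjoint (closure D) L
  boundary : IsOrientedBoundary D γ

/-- The cells that meet `K`. -/
noncomputable def meetingCells (δ : ℝ) (K : Set ℂ) : Finset (ℤ × ℤ) :=
  open Classical in
  if h : {s | (closedCell δ s ∩ K).Nonempty}.Finite then h.toFinset else ∅

theorem mem_meetingCells {δ : ℝ} (hδ : 0 < δ) {K : Set ℂ} (hK : IsCompact K) {s : ℤ × ℤ} :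
    s ∈ meetingCells δ K ↔ (closedCell δ s ∩ K).Nonempty := by
  rw [meetingCells, dif_pos ((locallyFinite_closedCell hδ).finite_nonempty_inter_compact hK)]
  simp

theorem subset_gridDomain_meetingCells {δ : ℝ} (hδ : 0 < δ) {K : Set ℂ} (hK : IsCompact K) :
    K ⊆ gridDomain δ (meetingCells δ K) := fun z hz _ hs =>
  (mem_meetingCells hδ hK).2 ⟨z, hs, hz⟩

theorem dist_le_of_mem_closedCell {δ : ℝ} {s : ℤ × ℤ} {z w : ℂ}
    (hz : z ∈ closedCell δ s) (hw : w ∈ closedCell δ s) : dist z w ≤ 2 * δ := by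
  rw [mem_closedCell] at hz hw
  rw [dist_eq]
  refine (norm_le_abs_re_add_abs_im _).trans ?_
  have h1 : |(z - w).re| ≤ δ := by rw [sub_re, abs_le]; constructor <;> linarith [hz.1, hw.1]
  have h2 : |(z - w).im| ≤ δ := by rw [sub_im, abs_le]; constructor <;> linarith [hz.2, hw.2]
  linarith

/-- Fine grid neighbourhoods of a compact set are contained in a given open neighbourhood. -/
theorem exists_closure_gridDomain_subset {K V : Set ℂ} (hK : IsCompact K) (hV : IsOpen V)
    (hKV : K ⊆ V) : ∃ δ₀ : ℝ, 0 < δ₀ ∧ ∀ δ, 0 < δ → δ ≤ δ₀ →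
      closure (gridDomain δ (meetingCells δ K)) ⊆ V := by
  obtain ⟨ε, hε, h⟩ := hK.exists_cthickening_subset_open hV hKV
  -- Points of one cell are at distance at most `2 δ`.
  refine ⟨ε / 2, by positivity, fun δ hδ hle z hz => h ?_⟩
  rw [closure_gridDomain hδ, Set.mem_iUnion₂] at hz
  obtain ⟨s, hs, hz⟩ := hz
  obtain ⟨w, hw, hwK⟩ := (mem_meetingCells hδ hK).1 hs
  exact Metric.mem_cthickening_of_dist_le z w ε K hwK
    ((dist_le_of_mem_closedCell hz hw).trans (by linarith))

theorem separates_gridChain {δ : ℝ} (hδ : 0 < δ) {K L : Set ℂ} (hK : IsCompact K)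
    (hL : Disjoint (closure (gridDomain δ (meetingCells δ K))) L) :
    Separates K L (gridDomain δ (meetingCells δ K)) (gridChain δ (meetingCells δ K)) where
  isOpen := isOpen_gridDomain hδ _
  subset := subset_gridDomain_meetingCells hδ hK
  disjoint := hL
  boundary := isOrientedBoundary_gridChain hδ _

theorem exists_separates_gridChain {K L : Set ℂ} (hK : IsCompact K) (hL : IsClosed L)
    (hKL : Disjoint K L) : ∃ δ : ℝ, 0 < δ ∧
      Separates K L (gridDomain δ (meetingCells δ K)) (gridChain δ (meetingCells δ K)) := by
  obtain ⟨δ, hδ, h⟩ := exists_closure_gridDomain_subset hK hL.isOpen_compl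
    (Set.disjoint_left.1 hKL)
  exact ⟨δ, hδ, separates_gridChain hδ hK (Set.disjoint_left.2 (h δ hδ le_rfl))⟩

/-- Cells are indexed by the lower left corner, and reflection exchanges top and bottom; hence the
shift by `-1`. -/
theorem conj_mem_closedCell {δ : ℝ} {s : ℤ × ℤ} {z : ℂ} (hz : z ∈ closedCell δ s) :
    (starRingEnd ℂ) z ∈ closedCell δ (s.1, -1 - s.2) := by
  rw [mem_closedCell] at hz ⊢
  push_cast
  rw [conj_re, conj_im]
  refine ⟨hz.1, ?_, ?_⟩ <;> linarith [hz.2.1, hz.2.2]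

theorem conj_mem_gridDomain {δ : ℝ} (hδ : 0 < δ) {K : Set ℂ} (hK : IsCompact K)
    (hconj : ∀ z ∈ K, (starRingEnd ℂ) z ∈ K) {z : ℂ} (hz : z ∈ gridDomain δ (meetingCells δ K)) :
    (starRingEnd ℂ) z ∈ gridDomain δ (meetingCells δ K) := by
  intro s hs
  have h1 := conj_mem_closedCell hs
  rw [conj_conj] at h1
  obtain ⟨w, hw, hwK⟩ := (mem_meetingCells hδ hK).1 (hz _ h1)
  have h2 := conj_mem_closedCell hw
  simp only [sub_sub_cancel] at h2
  exact (mem_meetingCells hδ hK).2 ⟨_, h2, hconj w hwK⟩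

variable {K L D D' : Set ℂ} {n m : ℕ} {γ : Fin n → ℝ → ℂ} {Γ : Fin m → ℝ → ℂ}

theorem Separates.isC1Chain (h : Separates K L D γ) : IsC1Chain γ := h.boundary.contDiffOn

theorem Separates.trace_eq (h : Separates K L D γ) : trace γ = frontier D :=
  h.boundary.frontier_eq.symm

theorem Separates.trace_subset_closure (h : Separates K L D γ) : trace γ ⊆ closure D := by
  rw [h.trace_eq]
  exact frontier_subset_closure

theorem Separates.disjoint_trace_domain (h : Separates K L D γ) : Disjoint (trace γ) D := by
  rw [h.trace_eq]
  exact Set.disjoint_left.2 fun z hz hzD => hz.2 (by rwa [h.isOpen.interior_eq])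

theorem Separates.disjoint_trace (h : Separates K L D γ) : Disjoint (trace γ) (K ∪ L) :=
  (h.disjoint_trace_domain.mono_right h.subset).union_right
    (h.disjoint.mono_left h.trace_subset_closure)

variable {A : Type*} [NormedRing A] [NormedAlgebra ℂ A] [CompleteSpace A] {a : A}

/-- The inner chain does not wind around the outer one, while the outer one winds once around every
point of the inner one. -/
theorem Separates.rieszInt_mul_of_closure_subset (h : Separates K L D γ) (h' : Separates K L D' Γ)
    (ha : spectrum ℂ a ⊆ K ∪ L) (hD : closure D' ⊆ D) :
    rieszInt γ a * rieszInt Γ a = rieszInt Γ a := by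
  have hd : Disjoint (trace γ) (closure D') := h.disjoint_trace_domain.mono_right hD
  rw [rieszInt_mul_rieszInt h.isC1Chain h'.isC1Chain (h.disjoint_trace.mono_right ha)
    (h'.disjoint_trace.mono_right ha) (hd.mono_right h'.trace_subset_closure)
    (fun z hz => h'.boundary.winding_outside z (hd.notMem_of_mem_left hz))
    (c := 1) (fun w hw => h.boundary.winding_inside w (hD (h'.trace_subset_closure hw))), one_smul]

theorem Separates.rieszInt_mul_of_disjoint (h : Separates K L D γ) (h' : Separates L K D' Γ)
    (ha : spectrum ℂ a ⊆ K ∪ L) (hD : Disjoint (closure D) (closure D')) :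
    rieszInt γ a * rieszInt Γ a = 0 := by
  have hd : Disjoint (trace γ) (closure D') := hD.mono_left h.trace_subset_closure
  rw [rieszInt_mul_rieszInt h.isC1Chain h'.isC1Chain (h.disjoint_trace.mono_right ha)
    (h'.disjoint_trace.mono_right (Set.union_comm K L ▸ ha))
    (hd.mono_right h'.trace_subset_closure)
    (fun z hz => h'.boundary.winding_outside z (hd.notMem_of_mem_left hz))
    (c := 0) (fun w hw => h.boundary.winding_outside w fun hw' =>
      hD.notMem_of_mem_left hw' (h'.trace_subset_closure hw)), zero_smul]

theorem rieszInt_gridChain_add {δ : ℝ} (hδ : 0 < δ) (hK : IsCompact K) (hL : IsCompact L)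
    (ha : spectrum ℂ a ⊆ K ∪ L) (hdisj : Disjoint (meetingCells δ K) (meetingCells δ L)) :
    rieszInt (gridChain δ (meetingCells δ K)) a + rieszInt (gridChain δ (meetingCells δ L)) a =
      1 := by
  rw [← rieszInt_gridChain_eq_one hδ (meetingCells δ K ∪ meetingCells δ L) a, rieszInt, rieszInt,
    rieszInt, ← smul_add, ← sum_cellInt, ← sum_cellInt, ← sum_cellInt, Finset.sum_union hdisj]
  intro s hs
  rw [Finset.mem_union, mem_meetingCells hδ hK, mem_meetingCells hδ hL] at hs
  refine Set.disjoint_left.2 fun z hz hza => hs ?_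
  exact (ha hza).imp (fun h => ⟨z, hz, h⟩) fun h => ⟨z, hz, h⟩

/-- The Riesz integral along any separating chain is the one along fine grid chains. -/
theorem Separates.exists_eq_gridChain (h : Separates K L D γ) (hK : IsCompact K) (hL : IsCompact L)
    (ha : spectrum ℂ a ⊆ K ∪ L) : ∃ δ₀ : ℝ, 0 < δ₀ ∧ ∀ δ, 0 < δ → δ ≤ δ₀ →
      rieszInt γ a = rieszInt (gridChain δ (meetingCells δ K)) a ∧
      rieszInt γ a * rieszInt γ a = rieszInt γ a ∧
      rieszInt (gridChain δ (meetingCells δ L)) a = 1 - rieszInt γ a ∧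
      Separates L K (gridDomain δ (meetingCells δ L)) (gridChain δ (meetingCells δ L)) := by
  obtain ⟨δ₁, hδ₁, h₁⟩ := exists_closure_gridDomain_subset hK h.isOpen h.subset
  obtain ⟨δ₂, hδ₂, h₂⟩ := exists_closure_gridDomain_subset hL isClosed_closure.isOpen_compl
    (Set.disjoint_right.1 h.disjoint)
  refine ⟨min δ₁ δ₂, lt_min hδ₁ hδ₂, fun δ hδ hle => ?_⟩
  have hcK := h₁ δ hδ (hle.trans (min_le_left _ _))
  have hcL := h₂ δ hδ (hle.trans (min_le_right _ _))
  have hsK := separates_gridChain hδ hK (L := L)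
    (h.disjoint.mono_left (hcK.trans subset_closure))
  have hsL := separates_gridChain hδ hL (L := K) (Set.disjoint_left.2 fun z hz hzK =>
    hcL hz (subset_closure (h.subset hzK)))
  -- A common cell would lie both inside and outside `closure D`.
  have hcells : Disjoint (meetingCells δ K) (meetingCells δ L) := by
    rw [Finset.disjoint_left]
    intro s hs hs'
    obtain ⟨w, hw, -⟩ := (mem_meetingCells hδ hK).1 hs
    refine hcL (a := w) ?_ (subset_closure (hcK ?_)) <;> rw [closure_gridDomain hδ]
    · exact Set.mem_biUnion hs' hw
    · exact Set.mem_biUnion hs hw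
  have hsum := rieszInt_gridChain_add hδ hK hL ha hcells
  have hm1 := h.rieszInt_mul_of_closure_subset hsK ha hcK
  have hm2 := h.rieszInt_mul_of_disjoint hsL ha (Set.disjoint_right.2 hcL)
  -- Multiply `P_K + P_L = 1` by `P_γ` on the left.
  have heq : rieszInt γ a = rieszInt (gridChain δ (meetingCells δ K)) a := by
    rw [← hm1, ← add_zero (rieszInt γ a * _), ← hm2, ← mul_add, hsum, mul_one]
  refine ⟨heq, ?_, ?_, hsL⟩
  · conv_lhs => rw [heq]
    conv_lhs => enter [1]; rw [← heq]
    rw [hm1, ← heq]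
  · rw [heq, ← hsum, add_sub_cancel_left]

/-- Both integrals equal the one along a common, sufficiently fine grid chain. -/
theorem Separates.rieszInt_eq (h : Separates K L D γ) (h' : Separates K L D' Γ) (hK : IsCompact K)
    (hL : IsCompact L) (ha : spectrum ℂ a ⊆ K ∪ L) : rieszInt γ a = rieszInt Γ a := by
  obtain ⟨δ₁, hδ₁, h₁⟩ := h.exists_eq_gridChain hK hL ha
  obtain ⟨δ₂, hδ₂, h₂⟩ := h'.exists_eq_gridChain hK hL ha
  rw [(h₁ (min δ₁ δ₂) (lt_min hδ₁ hδ₂) (min_le_left _ _)).1,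
    (h₂ (min δ₁ δ₂) (lt_min hδ₁ hδ₂) (min_le_right _ _)).1]

theorem Separates.rieszInt_mul_self (h : Separates K L D γ) (hK : IsCompact K)
    (hL : IsCompact L) (ha : spectrum ℂ a ⊆ K ∪ L) :
    rieszInt γ a * rieszInt γ a = rieszInt γ a := by
  obtain ⟨δ, hδ, h₁⟩ := h.exists_eq_gridChain hK hL ha
  exact (h₁ δ hδ le_rfl).2.1

theorem Separates.rieszInt_add (h : Separates K L D γ) (h' : Separates L K D' Γ) (hK : IsCompact K)
    (hL : IsCompact L) (ha : spectrum ℂ a ⊆ K ∪ L) : rieszInt γ a + rieszInt Γ a = 1 := by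
  obtain ⟨δ, hδ, h₁⟩ := h.exists_eq_gridChain hK hL ha
  obtain ⟨-, -, h2, h3⟩ := h₁ δ hδ le_rfl
  rw [h'.rieszInt_eq h3 hL hK (Set.union_comm K L ▸ ha), h2, add_sub_cancel]

/-- The given chain may enclose or meet `z`; separating `K` from `L ∪ {z}` produces a grid chain
with the same integral that leaves `z` outside. -/
theorem Separates.exists_mul_eq_rieszInt (h : Separates K L D γ) (hK : IsCompact K)
    (hL : IsCompact L) (ha : spectrum ℂ a ⊆ K ∪ L) {z : ℂ} (hz : z ∉ K) :
    ∃ v : A, (algebraMap ℂ A z - a) * v = rieszInt γ a ∧ ∀ b, Commute b a → Commute b v := by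
  have hKL : Disjoint K L := (h.disjoint.mono_left subset_closure).mono_left h.subset
  obtain ⟨δ, hδ, hs⟩ := exists_separates_gridChain hK (hL.insert z).isClosed
    (Set.disjoint_insert_right.2 ⟨hz, hKL⟩)
  have hs' : Separates K L _ _ := ⟨hs.isOpen, hs.subset,
    hs.disjoint.mono_right (Set.subset_insert z L), hs.boundary⟩
  have hzc := hs.disjoint.notMem_of_mem_right (Set.mem_insert z L)
  rw [h.rieszInt_eq hs' hK hL ha]
  exact QuaternionicRiesz.exists_mul_eq_rieszInt hs'.isC1Chain (hs'.disjoint_trace.mono_right ha)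
    (fun hzt => hzc (hs'.trace_subset_closure hzt)) (hs'.boundary.winding_outside z hzc)

/-- The chain reflected in the real axis, run through backwards. -/
noncomputable def conjChain {n : ℕ} (γ : Fin n → ℝ → ℂ) (k : Fin n) (t : ℝ) : ℂ :=
  (starRingEnd ℂ) (γ k (1 - t))

theorem deriv_conjChain (k : Fin n) (t : ℝ) :
    deriv (conjChain γ k) t = -(starRingEnd ℂ) (deriv (γ k) (1 - t)) := by
  have h1 : conjChain γ k = fun t => conjCLE ((fun t => γ k (1 - t)) t) := rfl
  rw [h1]
  have h2 : deriv (fun t => conjCLE ((fun t => γ k (1 - t)) t)) t =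
      conjCLE (deriv (fun t => γ k (1 - t)) t) := by
    -- Where the arc is not differentiable, both derivatives have the default value `0`.
    by_cases hd : DifferentiableAt ℝ (fun t => γ k (1 - t)) t
    · exact (conjCLE.hasFDerivAt.comp_hasDerivAt t hd.hasDerivAt).deriv
    · rw [deriv_zero_of_not_differentiableAt hd, map_zero, deriv_zero_of_not_differentiableAt]
      rwa [show (fun t => conjCLE ((fun t => γ k (1 - t)) t)) = conjCLE ∘ fun t => γ k (1 - t)
        from rfl, conjCLE.comp_differentiableAt_iff]
  rw [h2, deriv_comp_const_sub, map_neg]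
  rfl

theorem chainInt_conjChain {E : Type*} [NormedAddCommGroup E] [NormedSpace ℂ E] (f : ℂ → E) :
    chainInt (conjChain γ) f = -∑ k, ∫ t in (0 : ℝ)..1,
      (starRingEnd ℂ) (deriv (γ k) t) • f ((starRingEnd ℂ) (γ k t)) := by
  rw [chainInt, ← Finset.sum_neg_distrib]
  refine Finset.sum_congr rfl fun k _ => ?_
  have h := intervalIntegral.integral_comp_sub_left (a := (0 : ℝ)) (b := 1)
    (fun t : ℝ => (starRingEnd ℂ) (deriv (γ k) t) • f ((starRingEnd ℂ) (γ k t))) 1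
  rw [sub_self, sub_zero] at h
  rw [← h, ← intervalIntegral.integral_neg]
  congr 1
  ext t
  rw [deriv_conjChain, neg_smul, conjChain]

theorem intervalIntegral_conj (f : ℝ → ℂ) :
    ∫ t in (0 : ℝ)..1, (starRingEnd ℂ) (f t) = (starRingEnd ℂ) (∫ t in (0 : ℝ)..1, f t) := by
  rw [intervalIntegral_eq_Icc, intervalIntegral_eq_Icc]
  exact integral_conj

theorem winding_conjChain (z : ℂ) :
    winding (conjChain γ) z = (starRingEnd ℂ) (winding γ ((starRingEnd ℂ) z)) := by
  rw [winding_eq_chainInt, winding_eq_chainInt, chainInt_conjChain, chainInt]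
  simp only [map_mul, map_inv₀, map_sum, ← intervalIntegral_conj, smul_eq_mul, map_sub, conj_conj,
    conj_I, conj_ofReal, mul_neg, inv_neg, neg_mul, map_ofNat]

/-- Reflection reverses orientation and running backwards restores it. The winding numbers get
conjugated, which leaves `1` and `0` unchanged. -/
theorem isOrientedBoundary_conjChain (hD : ∀ z ∈ D, (starRingEnd ℂ) z ∈ D)
    (h : IsOrientedBoundary D γ) : IsOrientedBoundary D (conjChain γ) := by
  have hpre : conjCLE ⁻¹' D = D := by
    ext z
    refine ⟨fun hz => ?_, fun hz => hD z hz⟩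
    have := hD _ hz
    simpa using this
  have hcl : conjCLE ⁻¹' (closure D) = closure D := by
    exact (conjCLE.toHomeomorph.preimage_closure D).trans (congrArg closure hpre)
  have hfr : conjCLE '' (frontier D) = frontier D := by
    have h2 : conjCLE ⁻¹' (frontier D) = frontier D :=
      (conjCLE.toHomeomorph.preimage_frontier D).trans (congrArg frontier hpre)
    conv_lhs => rw [← h2]
    exact Set.image_preimage_eq _ conjCLE.surjective
  refine ⟨fun k => ?_, ?_, fun z hz => ?_, fun z hz => ?_⟩
  · refine conjCLE.contDiff.comp_contDiffOn ((h.contDiffOn k).comp (f := fun t : ℝ => 1 - t)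
      (by fun_prop) fun t ht => ⟨by linarith [ht.2], by linarith [ht.1]⟩)
  · rw [← hfr, h.frontier_eq, Set.image_iUnion]
    congr 1
    ext k w
    simp only [Set.mem_image, conjChain]
    constructor
    · rintro ⟨_, ⟨t, ht, rfl⟩, rfl⟩
      exact ⟨1 - t, ⟨by linarith [ht.2], by linarith [ht.1]⟩, by simp⟩
    · rintro ⟨t, ht, rfl⟩
      exact ⟨γ k (1 - t), ⟨1 - t, ⟨by linarith [ht.2], by linarith [ht.1]⟩, rfl⟩, by simp⟩
  · rw [winding_conjChain, h.winding_inside _ (hD z hz), map_one]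
  · rw [winding_conjChain, h.winding_outside, map_zero]
    rw [← hcl]
    simpa using hz

end Separation

open QuaternionicInnerProductSpace

/-! ### Algebra of the quaternionic inner product. -/

section InnerProduct

variable {H : Type*} [NormedAddCommGroup H] [Module ℍᵐᵒᵖ H] [QuaternionicInnerProductSpace H]

theorem qinner_zero_right (x : H) : qinner x (0 : H) = 0 := by
  have h := qinner_right x 0 0 1
  simpa using h

theorem qinner_add_right (x y z : H) : qinner x (y + z) = qinner x y + qinner x z := by
  have h := qinner_right x y z 1
  simpa using h

theorem qinner_smul_right (x y : H) (q : ℍ) : qinner x (y <• q) = qinner x y * q := by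
  have h := qinner_right x y 0 q
  rwa [add_zero, qinner_zero_right, add_zero] at h

theorem qinner_add_left (x y z : H) : qinner (x + y) z = qinner x z + qinner y z := by
  rw [qinner_symm, qinner_add_right, star_add, ← qinner_symm, ← qinner_symm]

theorem qinner_smul_left (x y : H) (q : ℍ) : qinner (x <• q) y = star q * qinner x y := by
  rw [qinner_symm, qinner_smul_right, star_mul, ← qinner_symm]

theorem norm_right_smul (x : H) (q : ℍ) : ‖x <• q‖ = ‖q‖ * ‖x‖ := by
  have h := qinner_self (x <• q)
  rw [qinner_smul_right, qinner_smul_left, qinner_self] at h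
  have h2 : ((‖q‖ ^ 2 * ‖x‖ ^ 2 : ℝ) : ℍ) = ((‖x <• q‖ ^ 2 : ℝ) : ℍ) := by
    rw [← h, mul_assoc, Quaternion.coe_commutes, ← mul_assoc, Quaternion.star_mul_self,
      Quaternion.normSq_eq_norm_mul_self, ← sq, Quaternion.coe_mul]
  have h3 := Quaternion.coe_injective h2
  rw [← mul_pow] at h3
  exact ((pow_left_inj₀ (by positivity) (norm_nonneg _) two_ne_zero).1 h3).symm

/-- A set of pairwise orthogonal unit vectors. -/
def IsOrthonormalSet (N : Set H) : Prop :=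
  (∀ z ∈ N, qinner z z = 1) ∧ (∀ z ∈ N, ∀ w ∈ N, z ≠ w → qinner z w = 0)

theorem norm_eq_one_of_qinner {z : H} (h : qinner z z = 1) : ‖z‖ = 1 := by
  rw [qinner_self] at h
  have h2 : ‖z‖ ^ 2 = 1 := Quaternion.coe_injective (by rw [h, Quaternion.coe_one])
  nlinarith [norm_nonneg z]

theorem IsHilbertBasis.isOrthonormalSet {N : Set H} (hN : IsHilbertBasis N) : IsOrthonormalSet N :=
  ⟨hN.1, hN.2.1⟩

theorem IsHilbertBasis.hasSum_norm_sq {N : Set H} (hN : IsHilbertBasis N) (x : H) :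
    HasSum (fun z : N => ‖qinner (z : H) x‖ ^ 2) (‖x‖ ^ 2) := by
  have h := hN.2.2 x x
  have h2 : ∀ z : H, qinner x z * qinner z x = ((‖qinner z x‖ ^ 2 : ℝ) : ℍ) := fun z => by
    rw [qinner_symm x z, Quaternion.star_mul_self, Quaternion.normSq_eq_norm_mul_self, sq]
  simp only [h2, qinner_self] at h
  exact Quaternion.hasSum_coe.1 h

end InnerProduct

/-! ### Hilbert bases and left multiplication. -/

section RealInnerProduct

variable {H : Type*} [NormedAddCommGroup H] [NormedSpace ℝ H] [Module ℍᵐᵒᵖ H]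
  [IsScalarTower ℝ ℍᵐᵒᵖ H]

theorem real_smul_eq (r : ℝ) (x : H) : r • x = x <• (r : ℍ) := by
  have h : (MulOpposite.op (r : ℍ) : ℍᵐᵒᵖ) = r • (1 : ℍᵐᵒᵖ) := by
    apply MulOpposite.unop_injective
    ext <;> simp
  rw [h, smul_assoc, one_smul]

theorem real_smul_right_smul (r : ℝ) (x : H) (q : ℍ) : r • (x <• q) = x <• (r • q) := by
  rw [← smul_assoc, MulOpposite.op_smul]

variable [QuaternionicInnerProductSpace H]

/-- The real part of the quaternionic inner product. -/
@[reducible] noncomputable def realInnerProductSpace (H : Type*) [NormedAddCommGroup H]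
    [i : NormedSpace ℝ H] [Module ℍᵐᵒᵖ H]
    [IsScalarTower ℝ ℍᵐᵒᵖ H] [QuaternionicInnerProductSpace H] : InnerProductSpace ℝ H :=
  { i with
    inner := fun x y => (qinner x y).re
    norm_sq_eq_re_inner := fun x => by
      rw [qinner_self]
      exact (Quaternion.re_coe _).symm
    conj_inner_symm := fun x y => by
      change (qinner y x).re = (qinner x y).re
      rw [qinner_symm x y, Quaternion.re_star]
    add_left := fun x y z => by rw [qinner_add_left, Quaternion.re_add]
    smul_left := fun x y r => by
      change (qinner (r • x) y).re = r * (qinner x y).re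
      rw [real_smul_eq, qinner_smul_left]
      simp }

theorem re_qinner_le (x y : H) : (qinner x y).re ≤ ‖x‖ * ‖y‖ :=
  letI := realInnerProductSpace H
  real_inner_le_norm x y

/-- Replacing `x` by `x <• qinner x y` makes the inner product with `y` real, so the real
Cauchy–Schwarz inequality applies. -/
theorem norm_qinner_le (x y : H) : ‖qinner x y‖ ≤ ‖x‖ * ‖y‖ := by
  have h := re_qinner_le (x <• qinner x y) y
  rw [qinner_smul_left, Quaternion.star_mul_self, Quaternion.re_coe,
    Quaternion.normSq_eq_norm_mul_self, norm_right_smul, mul_assoc] at h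
  by_cases h0 : ‖qinner x y‖ = 0
  · rw [h0]; positivity
  · exact le_of_mul_le_mul_left h (lt_of_le_of_ne (norm_nonneg _) (Ne.symm h0))

/-- The inner product with `x` as a continuous real linear map. -/
noncomputable def qinnerCLM (x : H) : H →L[ℝ] ℍ :=
  LinearMap.mkContinuous
    { toFun := qinner x
      map_add' := qinner_add_right x
      map_smul' := fun r y => by
        rw [real_smul_eq, qinner_smul_right, RingHom.id_apply, ← Quaternion.coe_commutes,
          Quaternion.coe_mul_eq_smul] }
    ‖x‖ (norm_qinner_le x)

theorem qinnerCLM_apply (x y : H) : qinnerCLM x y = qinner x y := rfl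

/-- The isometry `q ↦ z q` for a unit vector `z`. -/
noncomputable def lineIsometry {z : H} (hz : qinner z z = 1) : ℍ →ₗᵢ[ℝ] H where
  toFun q := z <• q
  map_add' p q := by rw [MulOpposite.op_add, add_smul]
  map_smul' r q := by rw [RingHom.id_apply, real_smul_right_smul]
  norm_map' q := by
    change ‖z <• q‖ = ‖q‖
    rw [norm_right_smul, norm_eq_one_of_qinner hz, mul_one]

/-- The lines `z ℍ` form an orthogonal family of isometric copies of `ℍ` for the real inner product.
-/
theorem IsOrthonormalSet.summable [CompleteSpace H] {N : Set H} (hN : IsOrthonormalSet N)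
    {f : N → ℍ} (hf : Summable fun z => ‖f z‖ ^ 2) : Summable fun z : N => (z : H) <• f z := by
  let _ := realInnerProductSpace H
  have hV : OrthogonalFamily ℝ (fun _ : N => ℍ) (fun z : N => lineIsometry (hN.1 z z.2)) := by
    intro z w hzw p q
    change (qinner ((z : H) <• p) ((w : H) <• q)).re = 0
    rw [qinner_smul_right, qinner_smul_left, hN.2 z z.2 w w.2 (fun h => hzw (Subtype.ext h))]
    simp
  exact (hV.summable_iff_norm_sq_summable f).2 hf

theorem IsOrthonormalSet.sum_norm_sq_le {N : Set H} (hN : IsOrthonormalSet N) (x : H)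
    (F : Finset N) : ∑ z ∈ F, ‖qinner (z : H) x‖ ^ 2 ≤ ‖x‖ ^ 2 := by
  let _ := realInnerProductSpace H
  have hV : OrthogonalFamily ℝ (fun _ : N => ℍ) (fun z : N => lineIsometry (hN.1 z z.2)) := by
    intro z w hzw p q
    change (qinner ((z : H) <• p) ((w : H) <• q)).re = 0
    rw [qinner_smul_right, qinner_smul_left, hN.2 z z.2 w w.2 (fun h => hzw (Subtype.ext h))]
    simp
  have h1 := hV.norm_sum (fun z => qinner (z : H) x) F
  set y := ∑ z ∈ F, (lineIsometry (hN.1 z z.2)) (qinner (z : H) x) with hy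
  have h2 : inner ℝ y x = ∑ z ∈ F, ‖qinner (z : H) x‖ ^ 2 := by
    rw [hy, sum_inner]
    refine Finset.sum_congr rfl fun z _ => ?_
    change (qinner ((z : H) <• qinner (z : H) x) x).re = _
    rw [qinner_smul_left, Quaternion.star_mul_self, Quaternion.re_coe,
      Quaternion.normSq_eq_norm_mul_self, sq]
  have h3 := real_inner_le_norm y x
  rw [h2, ← h1] at h3
  rw [← h1]
  nlinarith [norm_nonneg y, norm_nonneg x, sq_nonneg (‖y‖ - ‖x‖)]

theorem IsOrthonormalSet.summable_norm_sq {N : Set H} (hN : IsOrthonormalSet N) (x : H) :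
    Summable fun z : N => ‖qinner (z : H) x‖ ^ 2 :=
  summable_of_sum_le (fun _ => by positivity) (hN.sum_norm_sq_le x)

theorem IsOrthonormalSet.qinner_of_hasSum {N : Set H} (hN : IsOrthonormalSet N) {f : N → ℍ} {y : H}
    (hy : HasSum (fun z : N => (z : H) <• f z) y) (w : N) : qinner (w : H) y = f w := by
  have h1 := (qinnerCLM (w : H)).hasSum hy
  simp only [qinnerCLM_apply, qinner_smul_right] at h1
  refine h1.unique ?_
  convert hasSum_single w fun z hz => ?_ using 1
  · rw [hN.1 w w.2, one_mul]
  · rw [hN.2 w w.2 z z.2 fun h => hz (Subtype.ext h.symm), zero_mul]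

/-- A maximal orthonormal set, from Zorn's lemma, has trivial orthogonal complement. The difference
between `y` and its Fourier series lies there, so the series sums to `y`; pairing with `x` gives
Parseval. -/
theorem exists_isHilbertBasis [CompleteSpace H] : ∃ N : Set H, IsHilbertBasis N := by
  obtain ⟨N, hN⟩ := zorn_subset {N : Set H | IsOrthonormalSet N} (by
    intro c hc hchain
    refine ⟨⋃₀ c, ⟨?_, ?_⟩, fun s hs => Set.subset_sUnion_of_mem hs⟩
    · rintro z ⟨s, hs, hz⟩
      exact (hc hs).1 z hz
    · rintro z ⟨s, hs, hz⟩ w ⟨t, ht, hw⟩ hzw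
      rcases hchain.total hs ht with h | h
      · exact (hc ht).2 z (h hz) w hw hzw
      · exact (hc hs).2 z hz w (h hw) hzw)
  have hO : IsOrthonormalSet N := hN.prop
  have hmax : ∀ x : H, (∀ z ∈ N, qinner z x = 0) → x = 0 := by
    intro x hx
    by_contra hx0
    have hn : ‖x‖ ≠ 0 := norm_ne_zero_iff.2 hx0
    set u := x <• ((‖x‖⁻¹ : ℝ) : ℍ) with hu
    have huu : qinner u u = 1 := by
      rw [qinner_self, hu, norm_right_smul, Quaternion.norm_coe, norm_inv, norm_norm,
        inv_mul_cancel₀ hn, one_pow, Quaternion.coe_one]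
    have hzu : ∀ z ∈ N, qinner z u = 0 := fun z hz => by rw [hu, qinner_smul_right, hx z hz, zero_mul]
    have hins : IsOrthonormalSet (insert u N) := by
      refine ⟨?_, ?_⟩
      · rintro z (rfl | hz)
        · exact huu
        · exact hO.1 z hz
      · rintro z (rfl | hz) w (rfl | hw) hzw
        · exact absurd rfl hzw
        · rw [qinner_symm, hzu w hw, star_zero]
        · exact hzu z hz
        · exact hO.2 z hz w hw hzw
    have huN : u ∈ N := hN.le_of_ge hins (Set.subset_insert u N) (Set.mem_insert u N)
    have := hzu u huN
    rw [huu] at this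
    exact one_ne_zero this
  refine ⟨N, hO.1, hO.2, fun x y => ?_⟩
  have hs := (hO.summable (hO.summable_norm_sq y)).hasSum
  have hy : y = ∑' z : N, (z : H) <• qinner (z : H) y := by
    rw [← sub_eq_zero]
    refine hmax _ fun z hz => ?_
    rw [← qinnerCLM_apply, map_sub, qinnerCLM_apply, qinnerCLM_apply,
      hO.qinner_of_hasSum hs ⟨z, hz⟩, sub_self]
  rw [← hy] at hs
  have := (qinnerCLM x).hasSum hs
  simpa only [qinnerCLM_apply, qinner_smul_right] using this

theorem IsHilbertBasis.ext {N : Set H} (hN : IsHilbertBasis N) {x y : H}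
    (h : ∀ z ∈ N, qinner z x = qinner z y) : x = y := by
  rw [← sub_eq_zero]
  have h1 := hN.hasSum_norm_sq (x - y)
  have h2 : ∀ z : N, ‖qinner (z : H) (x - y)‖ ^ 2 = 0 := fun z => by
    rw [← qinnerCLM_apply, map_sub, qinnerCLM_apply, qinnerCLM_apply, h z z.2, sub_self]
    simp
  simp only [h2] at h1
  have := h1.unique hasSum_zero
  simpa using this

variable [CompleteSpace H]

/-- The defining series converges by square summability. Together with `IsHilbertBasis.ext`, this
lets the rules of left multiplication be checked coordinatewise. -/
theorem IsHilbertBasis.qinner_leftMul {N : Set H} (hN : IsHilbertBasis N) (q : ℍ) (x : H) {z : H}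
    (hz : z ∈ N) : qinner z (leftMul N q x) = q * qinner z x := by
  have hs : Summable fun z : N => (z : H) <• (q * qinner (z : H) x) := by
    refine hN.isOrthonormalSet.summable ?_
    simp only [norm_mul, mul_pow]
    exact (hN.isOrthonormalSet.summable_norm_sq x).mul_left _
  exact hN.isOrthonormalSet.qinner_of_hasSum hs.hasSum ⟨z, hz⟩

theorem IsHilbertBasis.norm_leftMul {N : Set H} (hN : IsHilbertBasis N) (q : ℍ) (x : H) :
    ‖leftMul N q x‖ = ‖q‖ * ‖x‖ := by
  have h1 := hN.hasSum_norm_sq (leftMul N q x)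
  have h2 := (hN.hasSum_norm_sq x).mul_left (‖q‖ ^ 2)
  have h3 : ∀ z : N, ‖qinner (z : H) (leftMul N q x)‖ ^ 2 = ‖q‖ ^ 2 * ‖qinner (z : H) x‖ ^ 2 :=
    fun z => by rw [hN.qinner_leftMul q x z.2, norm_mul, mul_pow]
  simp only [h3] at h1
  have h4 := h1.unique h2
  rw [← mul_pow] at h4
  exact (pow_left_inj₀ (norm_nonneg _) (by positivity) two_ne_zero).1 h4

/-- Left multiplication relative to a Hilbert basis, as a bounded right linear operator. -/
noncomputable def leftMulCLM {N : Set H} (hN : IsHilbertBasis N) (q : ℍ) : H →L[ℍᵐᵒᵖ] H where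
  toFun := leftMul N q
  map_add' x y := hN.ext fun z hz => by
    simp only [hN.qinner_leftMul _ _ hz, qinner_add_right, mul_add]
  map_smul' p x := hN.ext fun z hz => by
    have h : ∀ y : H, p • y = y <• p.unop := fun y => rfl
    simp only [hN.qinner_leftMul _ _ hz, h, RingHom.id_apply, qinner_smul_right, mul_assoc]
  cont := by
    let f : H →+ H :=
      { toFun := leftMul N q
        map_zero' := hN.ext fun z hz => by simp [hN.qinner_leftMul _ _ hz, qinner_zero_right]
        map_add' := fun x y => hN.ext fun z hz => by
          simp only [hN.qinner_leftMul _ _ hz, qinner_add_right, mul_add] }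
    exact AddMonoidHomClass.continuous_of_bound f ‖q‖ fun x => (hN.norm_leftMul q x).le

theorem leftMulCLM_apply {N : Set H} (hN : IsHilbertBasis N) (q : ℍ) (x : H) :
    leftMulCLM hN q x = leftMul N q x := rfl

theorem leftMulCLM_mul {N : Set H} (hN : IsHilbertBasis N) (p q : ℍ) :
    leftMulCLM hN (p * q) = leftMulCLM hN p * leftMulCLM hN q := by
  ext x
  refine hN.ext fun z hz => ?_
  rw [mul_apply_eq_comp, leftMulCLM_apply, leftMulCLM_apply, leftMulCLM_apply]
  simp only [hN.qinner_leftMul _ _ hz, mul_assoc]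

theorem leftMulCLM_add {N : Set H} (hN : IsHilbertBasis N) (p q : ℍ) :
    leftMulCLM hN (p + q) = leftMulCLM hN p + leftMulCLM hN q := by
  ext x
  refine hN.ext fun z hz => ?_
  rw [add_apply, leftMulCLM_apply, leftMulCLM_apply, leftMulCLM_apply]
  simp only [hN.qinner_leftMul _ _ hz, qinner_add_right, add_mul]

theorem leftMul_coe {N : Set H} (hN : IsHilbertBasis N) (r : ℝ) (x : H) :
    leftMul N (r : ℍ) x = r • x := by
  refine hN.ext fun z hz => ?_
  rw [hN.qinner_leftMul _ _ hz, real_smul_eq, qinner_smul_right, Quaternion.coe_commutes]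

end RealInnerProduct

/-! ### Real and imaginary parts of the resolvent integral. -/

section Parts

open MeasureTheory

theorem IsC1Chain.intervalIntegrable {E : Type*} [NormedAddCommGroup E] {n : ℕ}
    {γ : Fin n → ℝ → ℂ} (hγ : IsC1Chain γ) {Φ : ℂ → ℂ → E}
    (hΦ : ContinuousOn (fun p : ℂ × ℂ => Φ p.1 p.2) (Set.univ ×ˢ trace γ)) (k : Fin n) :
    IntervalIntegrable (fun t => Φ (deriv (γ k) t) (γ k t)) volume 0 1 := by
  rw [intervalIntegrable_iff_integrableOn_Icc_of_le zero_le_one]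
  have h : IntegrableOn (fun t => Φ (derivWithin (γ k) (Set.Icc 0 1) t) (γ k t)) (Set.Icc 0 1) :=
    (hΦ.comp ((hγ.continuousOn_derivWithin k).prodMk (hγ.continuousOn k))
      fun t ht => ⟨trivial, mem_trace γ k ht⟩).integrableOn_compact isCompact_Icc
  refine Integrable.congr h ?_
  filter_upwards [derivWithin_ae_eq_deriv (γ k)] with t ht
  rw [ht]

variable {A : Type*} [NormedRing A] [NormedAlgebra ℂ A]

/-- The product of the resolvents at `z` and at its conjugate, the inverse of
`a² - 2 re(z) a + |z|²`. -/
noncomputable def pairResolvent (a : A) (z : ℂ) : A :=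
  resolvent a z * resolvent a ((starRingEnd ℂ) z)

/-- The real part of the density of `∫ (z - a)⁻¹ dz`. -/
noncomputable def reDensity (a : A) (v z : ℂ) : A :=
  (((v * (starRingEnd ℂ) z).re : ℝ) : ℂ) • pairResolvent a z -
    ((v.re : ℝ) : ℂ) • (a * pairResolvent a z)

/-- The imaginary part of the density of `∫ (z - a)⁻¹ dz`. -/
noncomputable def imDensity (a : A) (v z : ℂ) : A :=
  (((v * (starRingEnd ℂ) z).im : ℝ) : ℂ) • pairResolvent a z -
    ((v.im : ℝ) : ℂ) • (a * pairResolvent a z)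

theorem commute_self_resolvent (a : A) (z : ℂ) : Commute a (resolvent a z) :=
  commute_resolvent (Commute.refl a) z

/-- Write `R(z) = (z̄ - a) R(z) R(z̄)` and split the scalars `v z̄` and `v` into real and imaginary
parts. -/
theorem smul_resolvent_eq {a : A} {v z : ℂ} (hz : (starRingEnd ℂ) z ∉ spectrum ℂ a) :
    v • resolvent a z = reDensity a v z + I • imDensity a v z := by
  have h1 : resolvent a z = (starRingEnd ℂ) z • pairResolvent a z - a * pairResolvent a z := by
    rw [Algebra.smul_def, ← sub_mul, pairResolvent, ← (commute_resolvent
      (commute_self_resolvent a _).symm z).eq, ← mul_assoc, sub_mul_resolvent hz, one_mul]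
  have h2 : v • resolvent a z =
      (v * (starRingEnd ℂ) z) • pairResolvent a z - v • (a * pairResolvent a z) := by
    conv_lhs => rw [h1]
    rw [smul_sub, smul_smul]
  rw [h2, reDensity, imDensity]
  generalize v * (starRingEnd ℂ) z = w
  calc w • pairResolvent a z - v • (a * pairResolvent a z) =
      ((w.re : ℂ) + w.im * I) • pairResolvent a z -
        ((v.re : ℂ) + v.im * I) • (a * pairResolvent a z) := by rw [re_add_im, re_add_im]
    _ = _ := by module

/-- `pairResolvent` is unchanged when `z` is conjugated, so only the signs of the imaginary
coefficients flip. -/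
theorem conj_smul_resolvent_eq {a : A} {v z : ℂ} (hz : z ∉ spectrum ℂ a) :
    (starRingEnd ℂ) v • resolvent a ((starRingEnd ℂ) z) =
      reDensity a v z - I • imDensity a v z := by
  have h := smul_resolvent_eq (v := (starRingEnd ℂ) v) (z := (starRingEnd ℂ) z) (a := a)
    (by rwa [conj_conj])
  have hp : pairResolvent a ((starRingEnd ℂ) z) = pairResolvent a z := by
    rw [pairResolvent, pairResolvent, conj_conj]
    exact (commute_resolvent (commute_self_resolvent a _).symm _).eq
  rw [h, reDensity, imDensity, reDensity, imDensity, hp, ← map_mul, conj_re, conj_im, conj_re,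
    conj_im]
  push_cast
  module

variable [CompleteSpace A] {K L D : Set ℂ} {n : ℕ} {γ : Fin n → ℝ → ℂ} {a : A}

theorem Separates.conj_mem_trace (h : Separates K L D γ)
    (hconj : ∀ z ∈ D, (starRingEnd ℂ) z ∈ D) {z : ℂ} (hz : z ∈ trace γ) :
    (starRingEnd ℂ) z ∈ trace γ := by
  rw [h.trace_eq, (isOrientedBoundary_conjChain hconj h.boundary).frontier_eq]
  rw [trace, Set.mem_iUnion] at hz
  obtain ⟨k, t, ht, rfl⟩ := hz
  exact Set.mem_iUnion.2 ⟨k, 1 - t, ⟨by linarith [ht.2], by linarith [ht.1]⟩, by simp [conjChain]⟩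

theorem Separates.continuousOn_pairResolvent (h : Separates K L D γ)
    (hconj : ∀ z ∈ D, (starRingEnd ℂ) z ∈ D) (ha : spectrum ℂ a ⊆ K ∪ L) :
    ContinuousOn (pairResolvent a) (trace γ) := by
  have hR := continuousOn_resolvent (h.disjoint_trace.mono_right ha)
  exact hR.mul (hR.comp continuous_conj.continuousOn fun z hz => h.conj_mem_trace hconj hz)

theorem Separates.intervalIntegrable_reDensity (h : Separates K L D γ)
    (hconj : ∀ z ∈ D, (starRingEnd ℂ) z ∈ D) (ha : spectrum ℂ a ⊆ K ∪ L) (k : Fin n) :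
    IntervalIntegrable (fun t => reDensity a (deriv (γ k) t) (γ k t)) volume 0 1 := by
  have hG : ContinuousOn (fun p : ℂ × ℂ => pairResolvent a p.2) (Set.univ ×ˢ trace γ) :=
    (h.continuousOn_pairResolvent hconj ha).comp continuousOn_snd fun p hp => hp.2
  refine h.isC1Chain.intervalIntegrable (Φ := reDensity a) ?_ k
  unfold reDensity
  refine ContinuousOn.sub (ContinuousOn.smul ?_ hG) (ContinuousOn.smul ?_ (hG.const_mul a))
  · exact (continuous_ofReal.comp (continuous_re.comp
      (continuous_fst.mul (continuous_conj.comp continuous_snd)))).continuousOn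
  · exact (continuous_ofReal.comp (continuous_re.comp continuous_fst)).continuousOn

theorem Separates.intervalIntegrable_imDensity (h : Separates K L D γ)
    (hconj : ∀ z ∈ D, (starRingEnd ℂ) z ∈ D) (ha : spectrum ℂ a ⊆ K ∪ L) (k : Fin n) :
    IntervalIntegrable (fun t => imDensity a (deriv (γ k) t) (γ k t)) volume 0 1 := by
  have hG : ContinuousOn (fun p : ℂ × ℂ => pairResolvent a p.2) (Set.univ ×ˢ trace γ) :=
    (h.continuousOn_pairResolvent hconj ha).comp continuousOn_snd fun p hp => hp.2
  refine h.isC1Chain.intervalIntegrable (Φ := imDensity a) ?_ k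
  unfold imDensity
  refine ContinuousOn.sub (ContinuousOn.smul ?_ hG) (ContinuousOn.smul ?_ (hG.const_mul a))
  · exact (continuous_ofReal.comp (continuous_im.comp
      (continuous_fst.mul (continuous_conj.comp continuous_snd)))).continuousOn
  · exact (continuous_ofReal.comp (continuous_im.comp continuous_fst)).continuousOn

/-- For a domain that is symmetric in the real axis, the real part of the resolvent integral
vanishes. -/
theorem Separates.integral_densities (h : Separates K L D γ)
    (hconj : ∀ z ∈ D, (starRingEnd ℂ) z ∈ D) (hK : IsCompact K) (hL : IsCompact L)
    (ha : spectrum ℂ a ⊆ K ∪ L) :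
    ∑ k, ∫ t in (0 : ℝ)..1, reDensity a (deriv (γ k) t) (γ k t) = 0 ∧
      ∑ k, ∫ t in (0 : ℝ)..1, imDensity a (deriv (γ k) t) (γ k t) =
        (2 * Real.pi : ℂ) • rieszInt γ a := by
  set X := ∑ k, ∫ t in (0 : ℝ)..1, reDensity a (deriv (γ k) t) (γ k t) with hX
  set Y := ∑ k, ∫ t in (0 : ℝ)..1, imDensity a (deriv (γ k) t) (γ k t) with hY
  have hsp : ∀ z ∈ trace γ, z ∉ spectrum ℂ a := fun z hz =>
    (h.disjoint_trace.mono_right ha).notMem_of_mem_left hz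
  have hXi := h.intervalIntegrable_reDensity hconj ha
  have hYi := h.intervalIntegrable_imDensity hconj ha
  have hYi' : ∀ k, IntervalIntegrable (fun t => I • imDensity a (deriv (γ k) t) (γ k t))
    volume 0 1 := fun k => (hYi k).smul I
  have h1 : chainInt γ (resolvent a) = X + I • Y := by
    rw [hX, hY, Finset.smul_sum, ← Finset.sum_add_distrib, chainInt]
    refine Finset.sum_congr rfl fun k _ => ?_
    rw [← intervalIntegral.integral_smul, ← intervalIntegral.integral_add (hXi k) (hYi' k)]
    refine intervalIntegral.integral_congr fun t ht => ?_
    rw [Set.uIcc_of_le zero_le_one] at ht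
    exact smul_resolvent_eq (hsp _ (h.conj_mem_trace hconj (mem_trace γ k ht)))
  have h2 : chainInt (conjChain γ) (resolvent a) = -(X - I • Y) := by
    rw [chainInt_conjChain, hX, hY, Finset.smul_sum, ← Finset.sum_sub_distrib]
    congr 1
    refine Finset.sum_congr rfl fun k _ => ?_
    rw [← intervalIntegral.integral_smul, ← intervalIntegral.integral_sub (hXi k) (hYi' k)]
    refine intervalIntegral.integral_congr fun t ht => ?_
    rw [Set.uIcc_of_le zero_le_one] at ht
    exact conj_smul_resolvent_eq (hsp _ (mem_trace γ k ht))
  -- Both chains bound `D`, so `X + i Y = -(X - i Y)` and therefore `2 X = 0`.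
  have h' : Separates K L D (conjChain γ) :=
    ⟨h.isOpen, h.subset, h.disjoint, isOrientedBoundary_conjChain hconj h.boundary⟩
  have h3 := h.rieszInt_eq h' hK hL ha
  have hpi := two_pi_I_ne_zero
  rw [rieszInt, rieszInt] at h3
  have h4 := smul_right_injective A (inv_ne_zero hpi) h3
  rw [h1, h2] at h4
  have hX0 : X = 0 := by
    have h5 : (2 : ℂ) • X = 0 := by
      rw [two_smul]
      have : X + I • Y - -(X - I • Y) = 0 := by rw [h4, sub_self]
      rw [← this]
      abel
    exact (smul_eq_zero.1 h5).resolve_left two_ne_zero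
  refine ⟨hX0, ?_⟩
  rw [rieszInt, h1, hX0, zero_add, smul_smul, smul_smul]
  have hpi' : (Real.pi : ℂ) ≠ 0 := by exact_mod_cast Real.pi_ne_zero
  have : (2 * Real.pi : ℂ) * (2 * Real.pi * I)⁻¹ * I = 1 := by field_simp [I_ne_zero]
  rw [this, one_smul]

end Parts

/-! ### Imaginary units and slices of the quaternions. -/

section SlicePoint

theorem slicePoint_eq_lift {m : ℍ} (hm : m * m = -1) (z : ℂ) :
    slicePoint m z = Complex.liftAux m hm z := by
  rw [Complex.liftAux_apply, slicePoint, ← Quaternion.coe_mul_eq_smul]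
  rfl

theorem slicePoint_mul {m : ℍ} (hm : m * m = -1) (z w : ℂ) :
    slicePoint m (z * w) = slicePoint m z * slicePoint m w := by
  simp only [slicePoint_eq_lift hm, map_mul]

/-- A nonzero real part would make the imaginary components vanish, and a real square is not `-1`.
-/
theorem re_eq_zero_of_mul_self {m : ℍ} (hm : m * m = -1) : m.re = 0 := by
  have h1 := congrArg (fun q : ℍ => q.re) hm
  have h2 := congrArg (fun q : ℍ => q.imI) hm
  have h3 := congrArg (fun q : ℍ => q.imJ) hm
  have h4 := congrArg (fun q : ℍ => q.imK) hm
  simp at h1 h2 h3 h4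
  by_contra h
  have e2 : m.imI = 0 := by
    have : m.re * m.imI = 0 := by linarith
    exact (mul_eq_zero.1 this).resolve_left h
  have e3 : m.imJ = 0 := by
    have : m.re * m.imJ = 0 := by nlinarith
    exact (mul_eq_zero.1 this).resolve_left h
  have e4 : m.imK = 0 := by
    have : m.re * m.imK = 0 := by nlinarith
    exact (mul_eq_zero.1 this).resolve_left h
  rw [e2, e3, e4] at h1
  nlinarith [mul_self_nonneg m.re]

theorem norm_eq_one_of_mul_self {m : ℍ} (hm : m * m = -1) : ‖m‖ = 1 := by
  have h : ‖m‖ * ‖m‖ = 1 := by rw [← norm_mul, hm, norm_neg, norm_one]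
  nlinarith [norm_nonneg m]

theorem star_eq_neg_of_mul_self {m : ℍ} (hm : m * m = -1) : star m = -m := by
  rw [Quaternion.star_eq_neg]
  exact re_eq_zero_of_mul_self hm

theorem slicePoint_re {m : ℍ} (hm : m * m = -1) (z : ℂ) : (slicePoint m z).re = z.re := by
  simp [slicePoint, re_eq_zero_of_mul_self hm]

theorem slicePoint_im {m : ℍ} (hm : m * m = -1) (z : ℂ) :
    (slicePoint m z).im = (z.im : ℍ) * m := by
  have h := re_eq_zero_of_mul_self hm
  ext <;> simp [slicePoint, h]

theorem norm_slicePoint_im {m : ℍ} (hm : m * m = -1) (z : ℂ) :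
    ‖(slicePoint m z).im‖ = |z.im| := by
  rw [slicePoint_im hm, norm_mul, norm_eq_one_of_mul_self hm, mul_one, Quaternion.norm_coe,
    Real.norm_eq_abs]

theorem star_slicePoint {m : ℍ} (hm : m * m = -1) (z : ℂ) :
    star (slicePoint m z) = slicePoint m ((starRingEnd ℂ) z) := by
  simp only [slicePoint, star_add, star_mul, Quaternion.star_coe, star_eq_neg_of_mul_self hm,
    conj_re, conj_im, Quaternion.coe_neg, neg_mul, ← Quaternion.coe_commutes]

theorem norm_slicePoint {m : ℍ} (hm : m * m = -1) (z : ℂ) : ‖slicePoint m z‖ = ‖z‖ := by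
  have h : ‖slicePoint m z‖ * ‖slicePoint m z‖ = ‖z‖ * ‖z‖ := by
    rw [← Quaternion.normSq_eq_norm_mul_self, Complex.norm_mul_self_eq_normSq]
    apply Quaternion.coe_injective
    rw [← Quaternion.self_mul_star, star_slicePoint hm, ← slicePoint_mul hm, Complex.mul_conj]
    simp [slicePoint]
  exact (mul_self_inj (norm_nonneg _) (norm_nonneg _)).1 h

theorem continuous_slicePoint (m : ℍ) : Continuous (slicePoint m) := by
  unfold slicePoint
  exact (Quaternion.continuous_coe.comp continuous_re).add
    ((Quaternion.continuous_coe.comp continuous_im).mul continuous_const)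

/-- The first imaginary unit. -/
noncomputable def imagUnit : ℍ := ⟨0, 1, 0, 0⟩

theorem imagUnit_mul_self : imagUnit * imagUnit = -1 := by
  ext <;> simp <;> simp [imagUnit]

theorem exists_slicePoint (q : ℍ) : ∃ (m : ℍ) (z : ℂ), m * m = -1 ∧ slicePoint m z = q := by
  by_cases h : ‖q.im‖ = 0
  · refine ⟨imagUnit, (q.re : ℂ), imagUnit_mul_self, ?_⟩
    · rw [norm_eq_zero] at h
      conv_rhs => rw [← Quaternion.re_add_im q, h]
      rw [slicePoint, ofReal_re, ofReal_im, Quaternion.coe_zero, zero_mul]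
  · have hq : q.im * q.im = -((‖q.im‖ ^ 2 : ℝ) : ℍ) := by
      have h1 := Quaternion.self_mul_star q.im
      rw [Quaternion.star_im, mul_neg, Quaternion.normSq_eq_norm_mul_self, ← sq ‖q.im‖] at h1
      rw [← h1, neg_neg]
    refine ⟨((‖q.im‖⁻¹ : ℝ) : ℍ) * q.im, ⟨q.re, ‖q.im‖⟩, ?_, ?_⟩
    · rw [mul_assoc, ← mul_assoc q.im, ← Quaternion.coe_commutes, mul_assoc, hq, ← mul_assoc,
        mul_neg, ← Quaternion.coe_mul, ← Quaternion.coe_mul]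
      have : ‖q.im‖⁻¹ * ‖q.im‖⁻¹ * ‖q.im‖ ^ 2 = 1 := by field_simp
      rw [this, Quaternion.coe_one]
    · simp only [slicePoint]
      rw [← mul_assoc, ← Quaternion.coe_mul, mul_inv_cancel₀ h, Quaternion.coe_one, one_mul,
        Quaternion.re_add_im]

end SlicePoint

/-! ### Right linear operators as complex linear operators. -/

section Conversion

/-- Serves to identify the given real structure with the one underlying the complex structure of a
slice. -/
theorem normedSpace_real_ext {H : Type*} [NormedAddCommGroup H] {i j : NormedSpace ℝ H}
    (h : ∀ (r : ℝ) (x : H), i.smul r x = j.smul r x) :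
    i = j := by
  have hm : i.toModule = j.toModule := Module.ext' _ _ h
  cases i
  cases j
  congr

/-- The inverse of a linear bijection is automatically linear, so only continuity of `g` is asked.
Hence invertibility over `ℂ` and over `ℍ` coincide. -/
theorem isUnit_of_continuous_inverse {R M : Type*} [Ring R] [AddCommGroup M] [TopologicalSpace M]
    [IsTopologicalAddGroup M] [Module R M] (B : M →L[R] M) {g : M → M} (hg : Continuous g)
    (h₁ : ∀ x, B (g x) = x) (h₂ : ∀ x, g (B x) = x) : IsUnit B := by
  have hinj : Function.Injective B := Function.LeftInverse.injective h₂
  let C : M →L[R] M :=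
    { toFun := g
      map_add' := fun x y => hinj (by rw [map_add, h₁, h₁, h₁])
      map_smul' := fun r x => hinj (by rw [RingHom.id_apply, map_smul, h₁, h₁])
      cont := hg }
  exact ⟨⟨B, C, ContinuousLinearMap.ext h₁, ContinuousLinearMap.ext h₂⟩, rfl⟩

theorem commute_algebraMap_sub {A : Type*} [Ring A] [Algebra ℂ A] (a : A) (z w : ℂ) :
    Commute (algebraMap ℂ A z - a) (algebraMap ℂ A w - a) :=
  ((Algebra.commute_algebraMap_left z _)).sub_left
    (((Algebra.commute_algebraMap_right w a)).sub_right (Commute.refl a))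

variable {H : Type*} [NormedAddCommGroup H] [Module ℍᵐᵒᵖ H] [NormedSpace ℂ H] {m : ℍ}
  (hcs : ∀ (z : ℂ) (x : H), z • x = x <• slicePoint m z)

/-- A right linear operator as a complex linear operator. -/
noncomputable def toComplex (B : H →L[ℍᵐᵒᵖ] H) : H →L[ℂ] H where
  toFun := B
  map_add' := map_add B
  map_smul' z x := by rw [hcs, map_smul, RingHom.id_apply, hcs]
  cont := B.continuous

theorem toComplex_apply (B : H →L[ℍᵐᵒᵖ] H) (x : H) : toComplex hcs B x = B x := rfl

theorem toComplex_mul (B C : H →L[ℍᵐᵒᵖ] H) :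
    toComplex hcs (B * C) = toComplex hcs B * toComplex hcs C := rfl

theorem toComplex_one : toComplex hcs (1 : H →L[ℍᵐᵒᵖ] H) = 1 := rfl

theorem isUnit_toComplex_iff {B : H →L[ℍᵐᵒᵖ] H} : IsUnit (toComplex hcs B) ↔ IsUnit B := by
  constructor
  · rintro ⟨u, hu⟩
    refine isUnit_of_continuous_inverse B (g := (↑u⁻¹ : H →L[ℂ] H))
      (ContinuousLinearMap.continuous _) (fun x => ?_) fun x => ?_
    · have := congrArg (fun f : H →L[ℂ] H => f x) u.mul_inv
      rwa [hu] at this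
    · have := congrArg (fun f : H →L[ℂ] H => f x) u.inv_mul
      rwa [hu] at this
  · rintro ⟨u, rfl⟩
    refine ⟨⟨toComplex hcs u, toComplex hcs ↑u⁻¹, ?_, ?_⟩, rfl⟩
    · rw [← toComplex_mul, u.mul_inv, toComplex_one]
    · rw [← toComplex_mul, u.inv_mul, toComplex_one]

end Conversion

/-! ### The complex structure of a slice and the factorization of `Δ`. -/

section Slice

variable {H : Type*} [NormedAddCommGroup H] [NormedSpace ℝ H] [Module ℍᵐᵒᵖ H]
  [IsScalarTower ℝ ℍᵐᵒᵖ H]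

/-- The complex structure in which `α + i β` acts as the right multiplication by `α + m β`. -/
@[reducible] noncomputable def complexStructure [QuaternionicInnerProductSpace H] {m : ℍ}
    (hm : m * m = -1) : NormedSpace ℂ H where
  smul z x := x <• slicePoint m z
  one_smul x := by
    change x <• slicePoint m 1 = x
    rw [slicePoint_eq_lift hm, map_one, MulOpposite.op_one, one_smul]
  mul_smul z w x := by
    change x <• slicePoint m (z * w) = (x <• slicePoint m w) <• slicePoint m z
    -- A right action reverses products, which is harmless inside a commutative slice.
    rw [smul_smul, ← MulOpposite.op_mul, mul_comm z w, slicePoint_mul hm]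
  smul_zero z := smul_zero _
  smul_add z x y := smul_add _ x y
  add_smul z w x := by
    change x <• slicePoint m (z + w) = x <• slicePoint m z + x <• slicePoint m w
    rw [← add_smul, ← MulOpposite.op_add, slicePoint_eq_lift hm, map_add, slicePoint_eq_lift hm,
      slicePoint_eq_lift hm]
  zero_smul x := by
    change x <• slicePoint m 0 = 0
    rw [slicePoint_eq_lift hm, map_zero, MulOpposite.op_zero, zero_smul]
  norm_smul_le z x := by
    change ‖x <• slicePoint m z‖ ≤ ‖z‖ * ‖x‖
    rw [norm_right_smul, norm_slicePoint hm]

/-- The inverse of `Δ_q(T)` for `re q = re z` and `|q| = |z|`. -/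
noncomputable def sphericalInverse (T : H →L[ℍᵐᵒᵖ] H) (z : ℂ) : H →L[ℍᵐᵒᵖ] H :=
  Ring.inverse (T ^ 2 - (2 * z.re) • T + (‖z‖ ^ 2) • (1 : H →L[ℍᵐᵒᵖ] H))

theorem Delta_slicePoint (T : H →L[ℍᵐᵒᵖ] H) {m : ℍ} (hm : m * m = -1) (z : ℂ) :
    Delta T (slicePoint m z) = T ^ 2 - (2 * z.re) • T + (‖z‖ ^ 2) • (1 : H →L[ℍᵐᵒᵖ] H) := by
  rw [Delta, slicePoint_re hm, norm_slicePoint hm]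

theorem inverse_Delta_slicePoint (T : H →L[ℍᵐᵒᵖ] H) {m : ℍ} (hm : m * m = -1) (z : ℂ) :
    Ring.inverse (Delta T (slicePoint m z)) = sphericalInverse T z := by
  rw [Delta_slicePoint T hm, sphericalInverse]

/-- The Riesz projection, written with real scalars only. -/
noncomputable def rieszFun (T : H →L[ℍᵐᵒᵖ] H) {n : ℕ} (γ : Fin n → ℝ → ℂ) (x : H) : H :=
  (1 / (2 * Real.pi)) • ∑ k, ∫ t in (0 : ℝ)..1,
    ((deriv (γ k) t * (starRingEnd ℂ) (γ k t)).im • sphericalInverse T (γ k t) x -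
      (deriv (γ k) t).im • T (sphericalInverse T (γ k t) x))

theorem coe_smul_of_slice [NormedSpace ℂ H] {m : ℍ}
    (hcs : ∀ (z : ℂ) (x : H), z • x = x <• slicePoint m z) (r : ℝ) (x : H) : (r : ℂ) • x = r • x := by
  rw [hcs, real_smul_eq]
  simp [slicePoint]

theorem eq_complexToReal {H : Type*} [NormedAddCommGroup H] [i : NormedSpace ℝ H] [Module ℍᵐᵒᵖ H]
    [IsScalarTower ℝ ℍᵐᵒᵖ H] [NormedSpace ℂ H] {m : ℍ}
    (hcs : ∀ (z : ℂ) (x : H), z • x = x <• slicePoint m z) : i = NormedSpace.complexToReal :=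
  normedSpace_real_ext fun r x => (coe_smul_of_slice hcs r x).symm

variable [NormedSpace ℂ H] {m : ℍ} (hcs : ∀ (z : ℂ) (x : H), z • x = x <• slicePoint m z)

/-- The coefficients of `Δ` are the symmetric functions `z + z̄ = 2 re z` and `z z̄ = |z|²`. -/
theorem toComplex_Delta (hm : m * m = -1) (T : H →L[ℍᵐᵒᵖ] H) (z : ℂ) :
    toComplex hcs (Delta T (slicePoint m z)) =
      (algebraMap ℂ (H →L[ℂ] H) z - toComplex hcs T) *
        (algebraMap ℂ (H →L[ℂ] H) ((starRingEnd ℂ) z) - toComplex hcs T) := by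
  ext x
  rw [toComplex_apply, Delta_slicePoint T hm]
  have e1 : (T ^ 2 - (2 * z.re) • T + (‖z‖ ^ 2) • (1 : H →L[ℍᵐᵒᵖ] H)) x =
      T (T x) - (2 * z.re) • T x + (‖z‖ ^ 2) • x := by
    rw [pow_two]; rfl
  have e2 : ((algebraMap ℂ (H →L[ℂ] H) z - toComplex hcs T) *
      (algebraMap ℂ (H →L[ℂ] H) ((starRingEnd ℂ) z) - toComplex hcs T)) x =
      z • ((starRingEnd ℂ) z • x - T x) - toComplex hcs T ((starRingEnd ℂ) z • x - T x) := by
    simp only [Algebra.algebraMap_eq_smul_one]; rfl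
  rw [e1, e2, map_sub, map_smul, toComplex_apply, toComplex_apply, ← coe_smul_of_slice hcs,
    ← coe_smul_of_slice hcs]
  have h1 : ((2 * z.re : ℝ) : ℂ) = z + (starRingEnd ℂ) z := by rw [add_conj]
  have h2 : ((‖z‖ ^ 2 : ℝ) : ℂ) = z * (starRingEnd ℂ) z := by rw [mul_conj, normSq_eq_norm_sq]
  rw [h1, h2]
  module

theorem slicePoint_notMem_sphericalSpectrum_iff (hm : m * m = -1) (T : H →L[ℍᵐᵒᵖ] H) (z : ℂ) :
    slicePoint m z ∉ sphericalSpectrum T ↔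
      z ∉ spectrum ℂ (toComplex hcs T) ∧ (starRingEnd ℂ) z ∉ spectrum ℂ (toComplex hcs T) := by
  rw [sphericalSpectrum, Set.notMem_ofPred_iff, not_not, ← isUnit_toComplex_iff hcs,
    toComplex_Delta hcs hm, (commute_algebraMap_sub _ _ _).isUnit_mul_iff,
    notMem_spectrum_iff_isUnit, notMem_spectrum_iff_isUnit]

theorem toComplex_sphericalInverse (hm : m * m = -1) {T : H →L[ℍᵐᵒᵖ] H} {z : ℂ}
    (hz : slicePoint m z ∉ sphericalSpectrum T) :
    toComplex hcs (sphericalInverse T z) = pairResolvent (toComplex hcs T) z := by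
  obtain ⟨h1, h2⟩ := (slicePoint_notMem_sphericalSpectrum_iff hcs hm T z).1 hz
  have hu : IsUnit (Delta T (slicePoint m z)) := not_not.1 hz
  have h3 := congrArg (toComplex hcs) (Ring.mul_inverse_cancel _ hu)
  rw [toComplex_mul, toComplex_one, toComplex_Delta hcs hm, inverse_Delta_slicePoint T hm] at h3
  have h4 := congrArg (fun B => pairResolvent (toComplex hcs T) z * B) h3
  simp only [mul_one] at h4
  rw [← h4, pairResolvent, (commute_algebraMap_sub (toComplex hcs T) z ((starRingEnd ℂ) z)).eq,
    mul_assoc, mul_assoc, ← mul_assoc (resolvent _ ((starRingEnd ℂ) z)), resolvent_mul_sub h2,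
    one_mul, ← mul_assoc, resolvent_mul_sub h1, one_mul]

end Slice

/-! ### Quaternionic Cauchy integrals as complex Riesz integrals. -/

section Integrals

/-- `J` is the left multiplication by `m`; the factors are `ds_m` and the negative of `(a - s̄)
Δ⁻¹`. `J` and `a` need not commute, but `J` only ever stands to the left, so the terms can be
collected by powers of `J`. -/
theorem leftFactor_mul {A : Type*} [NormedRing A] [NormedAlgebra ℂ A] (a J : A) (hJ : J * J = -1)
    (v z : ℂ) :
    (((v.im : ℝ) : ℂ) • (1 : A) - ((v.re : ℝ) : ℂ) • J) *
      -((a - (((z.re : ℝ) : ℂ) • (1 : A) - ((z.im : ℝ) : ℂ) • J)) * pairResolvent a z) =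
      imDensity a v z - J * reDensity a v z := by
  have h : J * (J * pairResolvent a z) = -pairResolvent a z := by
    rw [← mul_assoc, hJ, neg_one_mul]
  simp only [imDensity, reDensity, mul_sub, sub_mul, smul_mul_assoc, one_mul, mul_neg,
    mul_smul_comm, h, mul_re, mul_im, conj_re, conj_im, smul_sub, smul_neg]
  push_cast
  module

theorem rightFactor_mul {A : Type*} [NormedRing A] [NormedAlgebra ℂ A] (a J : A) (hJ : J * J = -1)
    (v z : ℂ) :
    -(pairResolvent a z * ((a - (((z.re : ℝ) : ℂ) • (1 : A) - ((z.im : ℝ) : ℂ) • J)) *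
      (((v.im : ℝ) : ℂ) • (1 : A) - ((v.re : ℝ) : ℂ) • J))) =
      imDensity a v z - reDensity a v z * J := by
  have h : a * pairResolvent a z = pairResolvent a z * a :=
    ((commute_self_resolvent a z).mul_right (commute_self_resolvent a _)).eq
  simp only [imDensity, reDensity, h, mul_sub, sub_mul, smul_mul_assoc, one_mul, mul_neg, mul_one,
    mul_smul_comm, hJ, mul_re, mul_im, conj_re, conj_im, smul_sub, smul_neg, mul_assoc]
  push_cast
  module

theorem one_div_two_pi_smul {E : Type*} [NormedAddCommGroup E] [NormedSpace ℂ E] (y : E) :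
    (1 / (2 * Real.pi) : ℝ) • ((2 * Real.pi : ℂ) • y) = y := by
  rw [← Complex.coe_smul, smul_smul]
  have hpi : (Real.pi : ℂ) ≠ 0 := by exact_mod_cast Real.pi_ne_zero
  have : ((1 / (2 * Real.pi) : ℝ) : ℂ) * (2 * Real.pi) = 1 := by
    push_cast
    field_simp
  rw [this, one_smul]

/-- `B` will be `0` or multiplication by `J` on one side. The real densities integrate to zero, so
the term with `B` disappears. -/
theorem Separates.sum_integral_apply {E : Type*} [NormedAddCommGroup E] [NormedSpace ℂ E]
    [CompleteSpace E] {a : E →L[ℂ] E} {K L D : Set ℂ} {n : ℕ} {γ : Fin n → ℝ → ℂ}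
    (h : Separates K L D γ) (hconj : ∀ z ∈ D, (starRingEnd ℂ) z ∈ D) (hK : IsCompact K)
    (hL : IsCompact L) (ha : spectrum ℂ a ⊆ K ∪ L) (B : (E →L[ℂ] E) →L[ℂ] (E →L[ℂ] E)) (x : E) :
    ∑ k, ∫ t in (0 : ℝ)..1, (imDensity a (deriv (γ k) t) (γ k t) -
      B (reDensity a (deriv (γ k) t) (γ k t))) x = (2 * Real.pi : ℂ) • rieszInt γ a x := by
  obtain ⟨h1, h2⟩ := h.integral_densities hconj hK hL ha
  have hB : ∀ k, IntervalIntegrable (fun t => B (reDensity a (deriv (γ k) t) (γ k t)))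
      MeasureTheory.volume 0 1 := fun k => by
    have := h.intervalIntegrable_reDensity hconj ha k
    rw [intervalIntegrable_iff] at this ⊢
    exact B.integrable_comp this
  have h3 : ∑ k, ∫ t in (0 : ℝ)..1, (imDensity a (deriv (γ k) t) (γ k t) -
      B (reDensity a (deriv (γ k) t) (γ k t))) = (2 * Real.pi : ℂ) • rieszInt γ a := by
    refine Eq.trans ?_ ((sub_zero _).trans h2)
    rw [← map_zero B, ← h1, map_sum, ← Finset.sum_sub_distrib]
    refine Finset.sum_congr rfl fun k _ => ?_
    rw [intervalIntegral.integral_sub (h.intervalIntegrable_imDensity hconj ha k) (hB k),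
      B.intervalIntegral_comp_comm (h.intervalIntegrable_reDensity hconj ha k)]
  rw [← smul_apply, ← h3, sum_apply]
  refine Finset.sum_congr rfl fun k _ => ?_
  exact (ContinuousLinearMap.intervalIntegral_apply
    ((h.intervalIntegrable_imDensity hconj ha k).sub (hB k)) x).symm

variable {H : Type*} [NormedAddCommGroup H] [i : NormedSpace ℝ H] [Module ℍᵐᵒᵖ H]
  [IsScalarTower ℝ ℍᵐᵒᵖ H]

theorem leftMul_slicePoint [QuaternionicInnerProductSpace H] [CompleteSpace H] {N : Set H}
    (hN : IsHilbertBasis N) {m : ℍ} (w : ℂ) (x : H) :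
    leftMul N (slicePoint m w) x = w.re • x + w.im • leftMulCLM hN m x := by
  rw [slicePoint, ← leftMulCLM_apply hN, leftMulCLM_add, add_apply, leftMulCLM_mul,
    mul_apply_eq_comp, leftMulCLM_apply, leftMulCLM_apply, leftMulCLM_apply, leftMul_coe hN,
    leftMul_coe hN]

variable [NormedSpace ℂ H] {m : ℍ}
  (hcs : ∀ (z : ℂ) (x : H), z • x = x <• slicePoint m z) {T : H →L[ℍᵐᵒᵖ] H} {K L D : Set ℂ}
  {n : ℕ} {γ : Fin n → ℝ → ℂ}

theorem spectrum_toComplex_subset (hm : m * m = -1)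
    (hT : {z | slicePoint m z ∈ sphericalSpectrum T} ⊆ K ∪ L) :
    spectrum ℂ (toComplex hcs T) ⊆ K ∪ L := by
  refine subset_trans (fun z hz => ?_) hT
  by_contra h
  exact ((slicePoint_notMem_sphericalSpectrum_iff hcs hm T z).1 h).1 hz

theorem Separates.toComplex_sphericalInverse_apply (h : Separates K L D γ) (hm : m * m = -1)
    (hT : {z | slicePoint m z ∈ sphericalSpectrum T} ⊆ K ∪ L) {z : ℂ} (hz : z ∈ trace γ) (x : H) :
    sphericalInverse T z x = pairResolvent (toComplex hcs T) z x := by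
  rw [← toComplex_sphericalInverse hcs hm fun hz' => h.disjoint_trace.notMem_of_mem_left hz (hT hz'),
    toComplex_apply]

variable [CompleteSpace H]

theorem Separates.rieszFun_eq_rieszInt (h : Separates K L D γ)
    (hconj : ∀ z ∈ D, (starRingEnd ℂ) z ∈ D) (hK : IsCompact K) (hL : IsCompact L)
    (hm : m * m = -1) (hT : {z | slicePoint m z ∈ sphericalSpectrum T} ⊆ K ∪ L) (x : H) :
    rieszFun T γ x = rieszInt γ (toComplex hcs T) x := by
  obtain rfl : i = NormedSpace.complexToReal := eq_complexToReal hcs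
  have ha := spectrum_toComplex_subset hcs hm hT
  rw [rieszFun, ← one_div_two_pi_smul (rieszInt γ (toComplex hcs T) x), ← h.sum_integral_apply hconj hK hL ha 0 x]
  congr 1
  refine Finset.sum_congr rfl fun k _ => intervalIntegral.integral_congr fun t ht => ?_
  rw [Set.uIcc_of_le zero_le_one] at ht
  simp only [h.toComplex_sphericalInverse_apply hcs hm hT (mem_trace γ k ht), zero_apply, sub_zero]
  rfl

variable [QuaternionicInnerProductSpace H]

theorem dsm_eq_slicePoint (hm : m * m = -1) (c : ℝ → ℂ) (t : ℝ) :
    dsm m c t = slicePoint m (-(deriv c t * I)) := by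
  have h : slicePoint m I = m := by simp [slicePoint]
  rw [dsm, slicePoint_eq_lift hm (-_), map_neg, map_mul, ← slicePoint_eq_lift hm,
    ← slicePoint_eq_lift hm, h]

theorem toComplex_leftMulCLM_mul_self (hm : m * m = -1) {N : Set H} (hN : IsHilbertBasis N) :
    toComplex hcs (leftMulCLM hN m) * toComplex hcs (leftMulCLM hN m) = -1 := by
  rw [← toComplex_mul, ← leftMulCLM_mul, hm]
  ext x
  have h : ((-1 : ℝ) : ℍ) = -1 := by simp
  rw [toComplex_apply, leftMulCLM_apply, ← h, leftMul_coe hN]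
  simp

/-- The basis enters only through `J`, and the terms containing `J` integrate to zero. -/
theorem Separates.rightIntegral_eq (h : Separates K L D γ)
    (hconj : ∀ z ∈ D, (starRingEnd ℂ) z ∈ D) (hK : IsCompact K) (hL : IsCompact L)
    (hm : m * m = -1) (hT : {z | slicePoint m z ∈ sphericalSpectrum T} ⊆ K ∪ L)
    {N : Set H} (hN : IsHilbertBasis N) (x : H) :
    rightIntegral N T m γ x = rieszInt γ (toComplex hcs T) x := by
  obtain rfl : i = NormedSpace.complexToReal := eq_complexToReal hcs
  have ha := spectrum_toComplex_subset hcs hm hT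
  set J := toComplex hcs (leftMulCLM hN m) with hJ
  have hJJ : J * J = -1 := toComplex_leftMulCLM_mul_self hcs hm hN
  rw [rightIntegral, ← one_div_two_pi_smul (rieszInt γ (toComplex hcs T) x),
    ← h.sum_integral_apply hconj hK hL ha (ContinuousLinearMap.mul ℂ _ J) x]
  congr 1
  refine Finset.sum_congr rfl fun k _ => intervalIntegral.integral_congr fun t ht => ?_
  rw [Set.uIcc_of_le zero_le_one] at ht
  simp only [ContinuousLinearMap.mul_apply']
  rw [← leftFactor_mul _ J hJJ, dsm_eq_slicePoint hm, rightResolvent,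
    inverse_Delta_slicePoint T hm, star_slicePoint hm, leftMul_slicePoint hN,
    leftMul_slicePoint hN, h.toComplex_sphericalInverse_apply hcs hm hT (mem_trace γ k ht)]
  simp only [neg_re, neg_im, mul_I_re, mul_I_im, conj_re, conj_im, neg_neg, neg_smul,
    ← sub_eq_add_neg]
  rfl

theorem Separates.leftIntegral_eq (h : Separates K L D γ)
    (hconj : ∀ z ∈ D, (starRingEnd ℂ) z ∈ D) (hK : IsCompact K) (hL : IsCompact L)
    (hm : m * m = -1) (hT : {z | slicePoint m z ∈ sphericalSpectrum T} ⊆ K ∪ L)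
    {N : Set H} (hN : IsHilbertBasis N) (x : H) :
    leftIntegral N T m γ x = rieszInt γ (toComplex hcs T) x := by
  obtain rfl : i = NormedSpace.complexToReal := eq_complexToReal hcs
  have ha := spectrum_toComplex_subset hcs hm hT
  set J := toComplex hcs (leftMulCLM hN m) with hJ
  have hJJ : J * J = -1 := toComplex_leftMulCLM_mul_self hcs hm hN
  rw [leftIntegral, ← one_div_two_pi_smul (rieszInt γ (toComplex hcs T) x),
    ← h.sum_integral_apply hconj hK hL ha ((ContinuousLinearMap.mul ℂ _).flip J) x]
  congr 1
  refine Finset.sum_congr rfl fun k _ => intervalIntegral.integral_congr fun t ht => ?_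
  rw [Set.uIcc_of_le zero_le_one] at ht
  simp only [ContinuousLinearMap.flip_apply, ContinuousLinearMap.mul_apply']
  rw [← rightFactor_mul _ J hJJ, dsm_eq_slicePoint hm, leftResolvent,
    inverse_Delta_slicePoint T hm, star_slicePoint hm, leftMul_slicePoint hN,
    leftMul_slicePoint hN, h.toComplex_sphericalInverse_apply hcs hm hT (mem_trace γ k ht)]
  simp only [neg_re, neg_im, mul_I_re, mul_I_im, conj_re, conj_im, neg_neg, neg_smul,
    ← sub_eq_add_neg]
  rfl

end Integrals

/-! ### Axially symmetric sets and their planar traces. -/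

section SliceSets

/-- The trace of a set of quaternions in a slice. -/
def sliceSet (σ : Set ℍ) : Set ℂ := {z | slicePoint imagUnit z ∈ σ}

/-- The sphere of a quaternion meets every slice in the same conjugate pair, so one planar set
serves all `m`. -/
theorem IsAxiallySymmetric.slicePoint_mem_iff {σ : Set ℍ} (h : IsAxiallySymmetric σ) {m : ℍ}
    (hm : m * m = -1) (z : ℂ) : slicePoint m z ∈ σ ↔ z ∈ sliceSet σ := by
  have hi := imagUnit_mul_self
  constructor <;> intro hz <;> refine h _ hz _ ?_ ?_ <;>
    simp only [slicePoint_re hm, slicePoint_re hi, norm_slicePoint_im hm, norm_slicePoint_im hi]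

theorem IsAxiallySymmetric.conj_mem_sliceSet {σ : Set ℍ} (h : IsAxiallySymmetric σ) {z : ℂ}
    (hz : z ∈ sliceSet σ) : (starRingEnd ℂ) z ∈ sliceSet σ := by
  have hi := imagUnit_mul_self
  refine h _ hz _ ?_ ?_ <;>
    simp only [slicePoint_re hi, norm_slicePoint_im hi, conj_re, conj_im, abs_neg]

theorem isClosed_sliceSet {σ : Set ℍ} (h : IsClosed σ) : IsClosed (sliceSet σ) :=
  h.preimage (continuous_slicePoint imagUnit)

theorem disjoint_sliceSet {σ τ : Set ℍ} (h : Disjoint σ τ) : Disjoint (sliceSet σ) (sliceSet τ) :=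
  h.preimage _

theorem IsSeparatingDomain.separates {σ τ U : Set ℍ} {m : ℍ} (hm : m * m = -1) {n : ℕ}
    {γ : Fin n → ℝ → ℂ} (hσ : IsAxiallySymmetric σ) (hτ : IsAxiallySymmetric τ)
    (h : IsSeparatingDomain σ τ m U γ) :
    Separates (sliceSet σ) (sliceSet τ) {z | slicePoint m z ∈ U} γ where
  isOpen := h.isOpen.preimage (continuous_slicePoint m)
  subset z hz := h.subset ((hσ.slicePoint_mem_iff hm z).2 hz)
  disjoint := by
    refine (h.disjoint.preimage (slicePoint m)).mono
      ((continuous_slicePoint m).closure_preimage_subset U) fun z hz => ?_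
    exact (hτ.slicePoint_mem_iff hm z).2 hz
  boundary := h.boundary

theorem IsSeparatingDomain.conj_mem {σ τ U : Set ℍ} {m : ℍ} (hm : m * m = -1) {n : ℕ}
    {γ : Fin n → ℝ → ℂ} (h : IsSeparatingDomain σ τ m U γ) (z : ℂ)
    (hz : z ∈ {z | slicePoint m z ∈ U}) : (starRingEnd ℂ) z ∈ {z | slicePoint m z ∈ U} :=
  (h.axiallySymmetric.slicePoint_mem_iff hm _).2 (h.axiallySymmetric.conj_mem_sliceSet
    ((h.axiallySymmetric.slicePoint_mem_iff hm z).1 hz))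

/-- The point of the closed upper half plane that represents the sphere of `q`. -/
noncomputable def halfPlanePoint (q : ℍ) : ℂ := ⟨q.re, ‖q.im‖⟩

theorem continuous_halfPlanePoint : Continuous halfPlanePoint := by
  have h : halfPlanePoint = fun q => equivRealProdCLM.symm (q.re, ‖q.im‖) := rfl
  rw [h]
  exact equivRealProdCLM.symm.continuous.comp
    (Quaternion.continuous_re.prodMk Quaternion.continuous_im.norm)

theorem norm_le_of_halfPlanePoint (q : ℍ) : ‖q‖ ≤ 2 * ‖halfPlanePoint q‖ := by
  have h1 : ‖q‖ ≤ |q.re| + ‖q.im‖ := by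
    conv_lhs => rw [← Quaternion.re_add_im q]
    refine (norm_add_le _ _).trans ?_
    rw [Quaternion.norm_coe, Real.norm_eq_abs]
  have h2 := abs_re_le_norm (halfPlanePoint q)
  have h3 := abs_im_le_norm (halfPlanePoint q)
  simp only [halfPlanePoint, abs_norm] at h2 h3 ⊢
  linarith

theorem IsAxiallySymmetric.halfPlanePoint_mem_iff {σ : Set ℍ} (h : IsAxiallySymmetric σ) (q : ℍ) :
    halfPlanePoint q ∈ sliceSet σ ↔ q ∈ σ := by
  have hi := imagUnit_mul_self
  constructor <;> intro hq <;> refine h _ hq _ ?_ ?_ <;>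
    simp only [halfPlanePoint, slicePoint_re hi, norm_slicePoint_im hi, abs_norm]

/-- Rotate a planar grid neighbourhood of `sliceSet σ` about the real axis. It is symmetric under
conjugation, as `sliceSet σ` and the grid are, so slicing the rotated set gives back the whole grid
domain. -/
theorem exists_isSeparatingDomain {σ τ : Set ℍ} (hσ : IsAxiallySymmetric σ)
    (hτ : IsAxiallySymmetric τ) (hK : IsCompact (sliceSet σ)) (hτc : IsClosed τ)
    (hdisj : Disjoint σ τ) {m : ℍ} (hm : m * m = -1) :
    ∃ (U : Set ℍ) (n : ℕ) (γ : Fin n → ℝ → ℂ), IsSeparatingDomain σ τ m U γ := by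
  obtain ⟨δ, hδ, h⟩ := exists_separates_gridChain hK (isClosed_sliceSet hτc)
    (disjoint_sliceSet hdisj)
  set S := meetingCells δ (sliceSet σ)
  have hconj : ∀ z ∈ gridDomain δ S, (starRingEnd ℂ) z ∈ gridDomain δ S := fun z hz =>
    conj_mem_gridDomain hδ hK (fun z hz => hσ.conj_mem_sliceSet hz) hz
  have hslice : {z | slicePoint m z ∈ halfPlanePoint ⁻¹' gridDomain δ S} = gridDomain δ S := by
    ext z
    change halfPlanePoint (slicePoint m z) ∈ gridDomain δ S ↔ _
    rw [halfPlanePoint, slicePoint_re hm, norm_slicePoint_im hm]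
    rcases le_total 0 z.im with h0 | h0
    · rw [abs_of_nonneg h0]
    · rw [abs_of_nonpos h0]
      change (starRingEnd ℂ) z ∈ _ ↔ _
      exact ⟨fun hz => by simpa using hconj _ hz, hconj z⟩
  refine ⟨halfPlanePoint ⁻¹' gridDomain δ S, _, gridChain δ S,
    h.isOpen.preimage continuous_halfPlanePoint, ?_, ?_, ?_, ?_, ?_⟩
  · obtain ⟨C, hC⟩ := (isBounded_gridDomain hδ S).exists_norm_le
    refine isBounded_iff_forall_norm_le.2 ⟨2 * C, fun q hq => ?_⟩
    have := hC _ hq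
    linarith [norm_le_of_halfPlanePoint q]
  · intro q hq p hre him
    change halfPlanePoint p ∈ gridDomain δ S
    rw [halfPlanePoint, hre, him]
    exact hq
  · intro q hq
    exact h.subset ((hσ.halfPlanePoint_mem_iff q).2 hq)
  · refine Set.disjoint_left.2 fun q hq hqτ => ?_
    exact h.disjoint.notMem_of_mem_left
      (continuous_halfPlanePoint.closure_preimage_subset _ hq) ((hτ.halfPlanePoint_mem_iff q).2 hqτ)
  · rw [hslice]
    exact h.boundary

end SliceSets

/-! ### Invertibility of `Δ` on invariant ranges. -/

section Restriction

variable {H : Type*} [NormedAddCommGroup H] [NormedSpace ℝ H] [Module ℍᵐᵒᵖ H]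
  [IsScalarTower ℝ ℍᵐᵒᵖ H]

theorem Delta_apply (T : H →L[ℍᵐᵒᵖ] H) (q : ℍ) (x : H) :
    Delta T q x = T (T x) - (2 * q.re) • T x + (‖q‖ ^ 2) • x := by
  rw [Delta, pow_two]
  rfl

theorem Delta_restrict_apply (T : H →L[ℍᵐᵒᵖ] H) {M : Submodule ℍᵐᵒᵖ H}
    (hinv : ∀ x ∈ M, T x ∈ M) (q : ℍ) (x : M) :
    ((Delta (T.restrict hinv) q x : M) : H) = Delta T q x := by
  rw [Delta_apply, Delta_apply]
  rfl

theorem commute_Delta {T P : H →L[ℍᵐᵒᵖ] H} (h : T * P = P * T) (q : ℍ) (x : H) :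
    Delta T q (P x) = P (Delta T q x) := by
  have h' : ∀ y, T (P y) = P (T y) := fun y => congrArg (fun B : H →L[ℍᵐᵒᵖ] H => B y) h
  have hr : ∀ (r : ℝ) (y : H), P (r • y) = r • P y := fun r y => by
    rw [real_smul_eq, map_smul, ← real_smul_eq]
  rw [Delta_apply, Delta_apply, map_add, map_sub, hr, hr, h', h']

/-- `V` need not preserve the range of `P`, but `P V` does, and it inverts `Δ` there because `P`
commutes with `Δ`. -/
theorem isUnit_Delta_restrict {T P : H →L[ℍᵐᵒᵖ] H} (hPP : P * P = P) (hTP : T * P = P * T)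
    {M : Submodule ℍᵐᵒᵖ H} (hM : M = LinearMap.range (P : H →ₗ[ℍᵐᵒᵖ] H))
    (hinv : ∀ x ∈ M, T x ∈ M) {q : ℍ} {V : H → H} (hV : Continuous V)
    (h₁ : ∀ x, Delta T q (V x) = P x) (h₂ : ∀ x, V (Delta T q x) = P x) :
    IsUnit (Delta (T.restrict hinv) q) := by
  subst hM
  have hP : ∀ x, P (P x) = P x := fun x => congrArg (fun B : H →L[ℍᵐᵒᵖ] H => B x) hPP
  have hfix : ∀ x ∈ LinearMap.range (P : H →ₗ[ℍᵐᵒᵖ] H), P x = x := by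
    rintro _ ⟨y, rfl⟩
    exact hP y
  refine isUnit_of_continuous_inverse _ (g := fun x => ⟨P (V x), ⟨V x, rfl⟩⟩)
    (by fun_prop) (fun x => ?_) fun x => ?_
  · apply Subtype.ext
    rw [Delta_restrict_apply]
    change Delta T q (P (V x)) = x
    rw [commute_Delta hTP, h₁, hP, hfix x x.2]
  · apply Subtype.ext
    change P (V (Delta (T.restrict hinv) q x : _)) = x
    rw [Delta_restrict_apply, h₂, hP, hfix x x.2]

theorem exists_inverse_of_isUnit {R M : Type*} [Ring R] [AddCommGroup M] [TopologicalSpace M]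
    [IsTopologicalAddGroup M] [Module R M] {B : M →L[R] M} (h : IsUnit B) :
    ∃ C : M →L[R] M, (∀ x, B (C x) = x) ∧ ∀ x, C (B x) = x := by
  obtain ⟨u, rfl⟩ := h
  exact ⟨↑u⁻¹, fun x => congrArg (fun B : M →L[R] M => B x) u.mul_inv,
    fun x => congrArg (fun B : M →L[R] M => B x) u.inv_mul⟩

/-- The inverses `u`, `w` on the two ranges glue to `u P + w Q`. -/
theorem isUnit_Delta_of_restrict {T P Q : H →L[ℍᵐᵒᵖ] H} (hPQ : P + Q = 1)
    (hTP : T * P = P * T) (hTQ : T * Q = Q * T) {M N : Submodule ℍᵐᵒᵖ H}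
    (hM : M = LinearMap.range (P : H →ₗ[ℍᵐᵒᵖ] H)) (hN : N = LinearMap.range (Q : H →ₗ[ℍᵐᵒᵖ] H))
    (hinvM : ∀ x ∈ M, T x ∈ M) (hinvN : ∀ x ∈ N, T x ∈ N) {q : ℍ}
    (h₁ : IsUnit (Delta (T.restrict hinvM) q)) (h₂ : IsUnit (Delta (T.restrict hinvN) q)) :
    IsUnit (Delta T q) := by
  subst hM hN
  obtain ⟨u, hu1, hu2⟩ := exists_inverse_of_isUnit h₁
  obtain ⟨w, hw1, hw2⟩ := exists_inverse_of_isUnit h₂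
  have hsum : ∀ x, P x + Q x = x := fun x => congrArg (fun B : H →L[ℍᵐᵒᵖ] H => B x) hPQ
  refine isUnit_of_continuous_inverse _ (g := fun x => (u ⟨P x, ⟨x, rfl⟩⟩ : H) + w ⟨Q x, ⟨x, rfl⟩⟩)
    ?_ ?_ ?_
  · refine Continuous.add (continuous_subtype_val.comp
      (u.continuous.comp (P.continuous.subtype_mk _)))
      (continuous_subtype_val.comp
      (w.continuous.comp (Q.continuous.subtype_mk _)))
  · intro x
    rw [map_add, ← Delta_restrict_apply T hinvM, ← Delta_restrict_apply T hinvN, hu1, hw1]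
    exact hsum x
  · intro x
    have e1 : (⟨P (Delta T q x), ⟨_, rfl⟩⟩ : LinearMap.range (P : H →ₗ[ℍᵐᵒᵖ] H)) =
        Delta (T.restrict hinvM) q ⟨P x, ⟨x, rfl⟩⟩ := by
      apply Subtype.ext
      rw [Delta_restrict_apply]
      exact (commute_Delta hTP q x).symm
    have e2 : (⟨Q (Delta T q x), ⟨_, rfl⟩⟩ : LinearMap.range (Q : H →ₗ[ℍᵐᵒᵖ] H)) =
        Delta (T.restrict hinvN) q ⟨Q x, ⟨x, rfl⟩⟩ := by
      apply Subtype.ext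
      rw [Delta_restrict_apply]
      exact (commute_Delta hTQ q x).symm
    simp only [e1, e2, hu2, hw2]
    exact hsum x

end Restriction

/-! ### Construction of the quaternionic Riesz projection. -/

section RieszProjection

variable {H : Type*} [NormedAddCommGroup H] [NormedSpace ℝ H] [Module ℍᵐᵒᵖ H]
  [IsScalarTower ℝ ℍᵐᵒᵖ H] {T : H →L[ℍᵐᵒᵖ] H} {σ τ : Set ℍ}

theorem setOf_slicePoint_mem_subset (hT : sphericalSpectrum T = σ ∪ τ)
    (hσs : IsAxiallySymmetric σ) (hτs : IsAxiallySymmetric τ) {m : ℍ} (hm : m * m = -1) :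
    {z | slicePoint m z ∈ sphericalSpectrum T} ⊆ sliceSet σ ∪ sliceSet τ := by
  intro z hz
  rw [Set.mem_ofPred_eq, hT] at hz
  exact hz.imp (hσs.slicePoint_mem_iff hm z).1 (hτs.slicePoint_mem_iff hm z).1

variable [QuaternionicInnerProductSpace H] [CompleteSpace H]

theorem isBounded_sliceSet_sphericalSpectrum (T : H →L[ℍᵐᵒᵖ] H) :
    Bornology.IsBounded (sliceSet (sphericalSpectrum T)) := by
  let _ : NormedSpace ℂ H := complexStructure imagUnit_mul_self
  have hcs : ∀ (z : ℂ) (x : H), z • x = x <• slicePoint imagUnit z := fun _ _ => rfl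
  refine isBounded_iff_forall_norm_le.2
    ⟨‖toComplex hcs T‖ * ‖(1 : H →L[ℂ] H)‖, fun z hz => ?_⟩
  by_contra hlt
  push Not at hlt
  have hmem : ∀ w : ℂ, ‖w‖ = ‖z‖ → w ∉ spectrum ℂ (toComplex hcs T) := fun w hw =>
    Set.notMem_compl_iff.2 (spectrum.mem_resolventSet_of_norm_lt_mul (by rwa [hw]))
  exact (slicePoint_notMem_sphericalSpectrum_iff hcs imagUnit_mul_self T z).2
    ⟨hmem z rfl, hmem _ (norm_conj z)⟩ hz

theorem isCompact_sliceSet (hT : σ ⊆ sphericalSpectrum T) (hσc : IsClosed σ) :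
    IsCompact (sliceSet σ) :=
  Metric.isCompact_of_isClosed_isBounded (isClosed_sliceSet hσc)
    ((isBounded_sliceSet_sphericalSpectrum T).subset (Set.preimage_mono hT))

/-- `rieszFun` does not mention `m`. Given `q`, choose a slice containing it; there `rieszFun` is a
complex linear Riesz integral, so it commutes with right multiplication by `q`. -/
theorem Separates.exists_clm_eq_rieszFun (hT : sphericalSpectrum T = σ ∪ τ)
    (hσc : IsClosed σ) (hτc : IsClosed τ) (hσs : IsAxiallySymmetric σ) (hτs : IsAxiallySymmetric τ)
    {D : Set ℂ} {n : ℕ} {γ : Fin n → ℝ → ℂ} (h : Separates (sliceSet σ) (sliceSet τ) D γ)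
    (hconj : ∀ z ∈ D, (starRingEnd ℂ) z ∈ D) : ∃ P : H →L[ℍᵐᵒᵖ] H, ∀ x, P x = rieszFun T γ x := by
  have hK : IsCompact (sliceSet σ) := isCompact_sliceSet (T := T) (hT ▸ Set.subset_union_left) hσc
  have hL : IsCompact (sliceSet τ) := isCompact_sliceSet (T := T) (hT ▸ Set.subset_union_right) hτc
  have hsmul : ∀ (q : ℍ) (x : H), rieszFun T γ (x <• q) = rieszFun T γ x <• q := by
    intro q x
    obtain ⟨m, z, hm, rfl⟩ := exists_slicePoint q
    let _ : NormedSpace ℂ H := complexStructure hm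
    have hcs : ∀ (z : ℂ) (x : H), z • x = x <• slicePoint m z := fun _ _ => rfl
    have hmem := setOf_slicePoint_mem_subset hT hσs hτs hm
    rw [h.rieszFun_eq_rieszInt hcs hconj hK hL hm hmem,
      h.rieszFun_eq_rieszInt hcs hconj hK hL hm hmem, ← hcs, ← hcs, map_smul]
  let _ : NormedSpace ℂ H := complexStructure imagUnit_mul_self
  have hcs : ∀ (z : ℂ) (x : H), z • x = x <• slicePoint imagUnit z := fun _ _ => rfl
  have heq : rieszFun T γ = rieszInt γ (toComplex hcs T) := funext fun x =>
    h.rieszFun_eq_rieszInt hcs hconj hK hL imagUnit_mul_self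
      (setOf_slicePoint_mem_subset hT hσs hτs imagUnit_mul_self) x
  exact ⟨{ toFun := rieszFun T γ
           map_add' := fun x y => by simp only [heq, map_add]
           map_smul' := fun q x => hsmul q.unop x
           cont := by rw [heq]; exact ContinuousLinearMap.continuous _ }, fun x => rfl⟩

/-- The Riesz projection of an isolated part of the spherical spectrum, with the properties that
determine the spectra of the restrictions. -/
theorem exists_rieszProjection (hT : sphericalSpectrum T = σ ∪ τ) (hdisj : Disjoint σ τ)
    (hσc : IsClosed σ) (hτc : IsClosed τ) (hσs : IsAxiallySymmetric σ)
    (hτs : IsAxiallySymmetric τ) :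
    ∃ P : H →L[ℍᵐᵒᵖ] H, IsRieszProjection T σ P ∧ P * P = P ∧ T * P = P * T ∧
      (∀ q ∉ σ, ∃ V : H → H, Continuous V ∧ (∀ x, Delta T q (V x) = P x) ∧
        ∀ x, V (Delta T q x) = P x) ∧
      ∃ (D : Set ℂ) (n : ℕ) (γ : Fin n → ℝ → ℂ), Separates (sliceSet σ) (sliceSet τ) D γ ∧
        (∀ z ∈ D, (starRingEnd ℂ) z ∈ D) ∧ ∀ x, P x = rieszFun T γ x := by
  have hdiff : sphericalSpectrum T \ σ = τ := by
    rw [hT, Set.union_sdiff_left, hdisj.symm.sdiff_eq_left]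
  have hK : IsCompact (sliceSet σ) := isCompact_sliceSet (T := T) (hT ▸ Set.subset_union_left) hσc
  have hL : IsCompact (sliceSet τ) := isCompact_sliceSet (T := T) (hT ▸ Set.subset_union_right) hτc
  have hdom := fun (m : ℍ) (hm : m * m = -1) =>
    exists_isSeparatingDomain hσs hτs hK hτc hdisj hm
  obtain ⟨U, n, γ, hU⟩ := hdom imagUnit imagUnit_mul_self
  have h := hU.separates imagUnit_mul_self hσs hτs
  have hconj := hU.conj_mem imagUnit_mul_self
  obtain ⟨P, hP⟩ := h.exists_clm_eq_rieszFun hT hσc hτc hσs hτs hconj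
  have hmem := fun (m : ℍ) (hm : m * m = -1) => setOf_slicePoint_mem_subset hT hσs hτs hm
  refine ⟨P, ⟨exists_isHilbertBasis, ?_, ?_⟩, ?_, ?_, ?_, _, n, γ, h, hconj, hP⟩
  · rwa [hdiff]
  · intro N hN m hm U' n' γ' hU' x
    rw [hdiff] at hU'
    have h' := hU'.separates hm hσs hτs
    have hconj' := hU'.conj_mem hm
    let _ : NormedSpace ℂ H := complexStructure hm
    have hcs : ∀ (z : ℂ) (x : H), z • x = x <• slicePoint m z := fun _ _ => rfl
    have ha := spectrum_toComplex_subset hcs hm (hmem m hm)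
    rw [h'.rightIntegral_eq hcs hconj' hK hL hm (hmem m hm) hN,
      h'.leftIntegral_eq hcs hconj' hK hL hm (hmem m hm) hN, hP,
      h.rieszFun_eq_rieszInt hcs hconj hK hL hm (hmem m hm), h.rieszInt_eq h' hK hL ha]
    exact ⟨rfl, rfl⟩
  · let _ : NormedSpace ℂ H := complexStructure imagUnit_mul_self
    have hcs : ∀ (z : ℂ) (x : H), z • x = x <• slicePoint imagUnit z := fun _ _ => rfl
    have ha := spectrum_toComplex_subset hcs imagUnit_mul_self (hmem _ imagUnit_mul_self)
    have hPc : ∀ x, P x = rieszInt γ (toComplex hcs T) x := fun x => by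
      rw [hP, h.rieszFun_eq_rieszInt hcs hconj hK hL imagUnit_mul_self (hmem _ imagUnit_mul_self)]
    ext x
    rw [mul_apply_eq_comp, hPc, hPc, ← mul_apply_eq_comp, h.rieszInt_mul_self hK hL ha]
  · let _ : NormedSpace ℂ H := complexStructure imagUnit_mul_self
    have hcs : ∀ (z : ℂ) (x : H), z • x = x <• slicePoint imagUnit z := fun _ _ => rfl
    have ha := spectrum_toComplex_subset hcs imagUnit_mul_self (hmem _ imagUnit_mul_self)
    have hPc : ∀ x, P x = rieszInt γ (toComplex hcs T) x := fun x => by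
      rw [hP, h.rieszFun_eq_rieszInt hcs hconj hK hL imagUnit_mul_self (hmem _ imagUnit_mul_self)]
    have hcomm := commute_rieszInt h.isC1Chain (h.disjoint_trace.mono_right ha)
      (Commute.refl (toComplex hcs T))
    ext x
    rw [mul_apply_eq_comp, mul_apply_eq_comp, hPc, hPc]
    exact congrArg (fun B : H →L[ℂ] H => B x) hcomm.eq
  · intro q hq
    obtain ⟨m, z, hm, rfl⟩ := exists_slicePoint q
    have hz : z ∉ sliceSet σ := fun hz => hq ((hσs.slicePoint_mem_iff hm z).2 hz)
    have hz' : (starRingEnd ℂ) z ∉ sliceSet σ := fun hz' => hz (by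
      simpa using hσs.conj_mem_sliceSet hz')
    let _ : NormedSpace ℂ H := complexStructure hm
    have hcs : ∀ (z : ℂ) (x : H), z • x = x <• slicePoint m z := fun _ _ => rfl
    have ha := spectrum_toComplex_subset hcs hm (hmem m hm)
    have hPc : ∀ x, P x = rieszInt γ (toComplex hcs T) x := fun x => by
      rw [hP, h.rieszFun_eq_rieszInt hcs hconj hK hL hm (hmem m hm)]
    obtain ⟨v, hv, hvc⟩ := h.exists_mul_eq_rieszInt hK hL ha hz
    obtain ⟨w, hw, hwc⟩ := h.exists_mul_eq_rieszInt hK hL ha hz'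
    set a := toComplex hcs T with hadef
    have hca : ∀ z, Commute (algebraMap ℂ (H →L[ℂ] H) z - a) a := fun z =>
      (Algebra.commute_algebraMap_left z a).sub_left (Commute.refl a)
    -- The relative inverses of the two factors `z - a` and `z̄ - a` multiply to one of `Δ`, since
    -- `P P = P`.
    have hprod : toComplex hcs (Delta T (slicePoint m z)) * (v * w) = rieszInt γ a := by
      rw [toComplex_Delta hcs hm, mul_assoc, ← mul_assoc _ v w, (hvc _ (hca _)).eq, mul_assoc v,
        hw, ← mul_assoc, hv, h.rieszInt_mul_self hK hL ha]
    have hΔ : Commute (toComplex hcs (Delta T (slicePoint m z))) a := by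
      rw [toComplex_Delta hcs hm]
      exact (hca _).mul_left (hca _)
    refine ⟨(v * w : H →L[ℂ] H), ContinuousLinearMap.continuous _, fun x => ?_, fun x => ?_⟩
    · rw [hPc, ← hprod]
      rfl
    · rw [hPc, ← hprod, ((hvc _ hΔ).mul_right (hwc _ hΔ)).eq]
      rfl

end RieszProjection

/-! ### Ranges of complementary idempotents. -/

section Projections

theorem isCompl_range_of_add_eq_one {R M : Type*} [Ring R] [AddCommGroup M] [TopologicalSpace M]
    [IsTopologicalAddGroup M] [Module R M] {P Q : M →L[R] M} (hP : P * P = P) (hPQ : P + Q = 1) :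
    IsCompl (LinearMap.range (P : M →ₗ[R] M)) (LinearMap.range (Q : M →ₗ[R] M)) := by
  have hsum : ∀ x, P x + Q x = x := fun x => congrArg (fun B : M →L[R] M => B x) hPQ
  have hPP : ∀ x, P (P x) = P x := fun x => congrArg (fun B : M →L[R] M => B x) hP
  have hPQ0 : ∀ x, P (Q x) = 0 := fun x => by
    have h := congrArg P (hsum x)
    rw [map_add, hPP] at h
    exact add_eq_left.1 h
  constructor
  · rw [Submodule.disjoint_def]
    rintro _ ⟨x, rfl⟩ ⟨y, hy⟩
    change Q y = P x at hy
    change P x = 0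
    rw [← hPP, ← hy, hPQ0]
  · rw [codisjoint_iff, Submodule.eq_top_iff']
    intro x
    exact Submodule.mem_sup.2 ⟨P x, ⟨x, rfl⟩, Q x, ⟨x, rfl⟩, hsum x⟩

theorem isClosed_range_of_idempotent {R M : Type*} [Ring R] [AddCommGroup M] [TopologicalSpace M]
    [IsTopologicalAddGroup M] [T2Space M] [Module R M] {P : M →L[R] M} (hP : P * P = P) :
    IsClosed (LinearMap.range (P : M →ₗ[R] M) : Set M) := by
  have hPP : ∀ x, P (P x) = P x := fun x => congrArg (fun B : M →L[R] M => B x) hP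
  have h : (LinearMap.range (P : M →ₗ[R] M) : Set M) = {x | P x = x} := by
    ext x
    constructor
    · rintro ⟨y, rfl⟩
      exact hPP y
    · intro hx
      exact ⟨x, hx⟩
  rw [h]
  exact isClosed_eq P.continuous continuous_id

theorem mem_range_of_commute {R M : Type*} [Ring R] [AddCommGroup M] [TopologicalSpace M]
    [IsTopologicalAddGroup M] [Module R M] {T P : M →L[R] M} (h : T * P = P * T) :
    ∀ x ∈ LinearMap.range (P : M →ₗ[R] M), T x ∈ LinearMap.range (P : M →ₗ[R] M) := by
  rintro _ ⟨x, rfl⟩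
  exact ⟨T x, (congrArg (fun B : M →L[R] M => B x) h).symm⟩

theorem sphericalSpectrum_of_subsingleton {H : Type*} [NormedAddCommGroup H] [NormedSpace ℝ H]
    [Module ℍᵐᵒᵖ H] [IsScalarTower ℝ ℍᵐᵒᵖ H] [Subsingleton H] (T : H →L[ℍᵐᵒᵖ] H) :
    sphericalSpectrum T = ∅ := by
  refine Set.eq_empty_iff_forall_notMem.2 fun q hq => hq ?_
  exact isUnit_of_subsingleton _

end Projections

end QuaternionicRiesz

/-! ### The spectral decomposition. -/

open QuaternionicRiesz in
theorem mainTheorem3 {H : Type*} [NormedAddCommGroup H] [NormedSpace ℝ H] [Module ℍᵐᵒᵖ H]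
    [IsScalarTower ℝ ℍᵐᵒᵖ H] [QuaternionicInnerProductSpace H] [CompleteSpace H]
    (T : H →L[ℍᵐᵒᵖ] H) (σ τ : Set ℍ)
    (hunion : sphericalSpectrum T = σ ∪ τ) (hdisj : Disjoint σ τ)
    (hσ : σ.Nonempty) (hτ : τ.Nonempty) (hσc : IsClosed σ) (hτc : IsClosed τ)
    (hσs : IsAxiallySymmetric σ) (hτs : IsAxiallySymmetric τ) :
    ∃ (Pσ Pτ : H →L[ℍᵐᵒᵖ] H) (Mσ Mτ : Submodule ℍᵐᵒᵖ H),
      IsRieszProjection T σ Pσ ∧ IsRieszProjection T τ Pτ ∧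
      Pσ * Pσ = Pσ ∧ Pτ * Pτ = Pτ ∧ Pσ + Pτ = 1 ∧
      T * Pσ = Pσ * T ∧ T * Pτ = Pτ * T ∧
      Mσ = LinearMap.range (Pσ : H →ₗ[ℍᵐᵒᵖ] H) ∧ Mτ = LinearMap.range (Pτ : H →ₗ[ℍᵐᵒᵖ] H) ∧
      IsClosed (Mσ : Set H) ∧ IsClosed (Mτ : Set H) ∧
      Mσ ≠ ⊥ ∧ Mσ ≠ ⊤ ∧ Mτ ≠ ⊥ ∧ Mτ ≠ ⊤ ∧
      IsCompl Mσ Mτ ∧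
      (∃ hinv : ∀ x ∈ Mσ, T x ∈ Mσ, sphericalSpectrum (T.restrict hinv) = σ) ∧
      (∃ hinv : ∀ x ∈ Mτ, T x ∈ Mτ, sphericalSpectrum (T.restrict hinv) = τ) := by
  have hunion' : sphericalSpectrum T = τ ∪ σ := by rw [hunion, Set.union_comm]
  obtain ⟨P, hP, hPP, hTP, hPV, D, n, γ, hsep, hconj, hPr⟩ :=
    exists_rieszProjection hunion hdisj hσc hτc hσs hτs
  obtain ⟨Q, hQ, hQQ, hTQ, hQV, D', n', γ', hsep', hconj', hQr⟩ :=
    exists_rieszProjection hunion' hdisj.symm hτc hσc hτs hσs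
  have hK : IsCompact (sliceSet σ) :=
    isCompact_sliceSet (T := T) (hunion ▸ Set.subset_union_left) hσc
  have hL : IsCompact (sliceSet τ) :=
    isCompact_sliceSet (T := T) (hunion ▸ Set.subset_union_right) hτc
  have hPQ : P + Q = 1 := by
    let _ : NormedSpace ℂ H := complexStructure imagUnit_mul_self
    have hcs : ∀ (z : ℂ) (x : H), z • x = x <• slicePoint imagUnit z := fun _ _ => rfl
    have hm := imagUnit_mul_self
    have h1 := setOf_slicePoint_mem_subset hunion hσs hτs hm
    have h2 := setOf_slicePoint_mem_subset hunion' hτs hσs hm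
    ext x
    rw [add_apply, hPr, hQr, hsep.rieszFun_eq_rieszInt hcs hconj hK hL hm h1,
      hsep'.rieszFun_eq_rieszInt hcs hconj' hL hK hm h2, ← add_apply,
      hsep.rieszInt_add hsep' hK hL (spectrum_toComplex_subset hcs hm h1)]
    rfl
  have hcompl := isCompl_range_of_add_eq_one hPP hPQ
  have hinvP := mem_range_of_commute hTP
  have hinvQ := mem_range_of_commute hTQ
  have hunitP : ∀ q ∉ σ, IsUnit (Delta (T.restrict hinvP) q) := fun q hq => by
    obtain ⟨V, hV, h1, h2⟩ := hPV q hq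
    exact isUnit_Delta_restrict hPP hTP rfl hinvP hV h1 h2
  have hunitQ : ∀ q ∉ τ, IsUnit (Delta (T.restrict hinvQ) q) := fun q hq => by
    obtain ⟨V, hV, h1, h2⟩ := hQV q hq
    exact isUnit_Delta_restrict hQQ hTQ rfl hinvQ hV h1 h2
  -- A spectral point of `T` must survive in at least one restriction; disjointness of `σ` and `τ`
  -- then decides in which.
  have hboth : ∀ q ∈ sphericalSpectrum T, IsUnit (Delta (T.restrict hinvP) q) →
      ¬ IsUnit (Delta (T.restrict hinvQ) q) := fun q hq h1 h2 =>
    hq (isUnit_Delta_of_restrict hPQ hTP hTQ rfl rfl hinvP hinvQ h1 h2)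
  have hspP : sphericalSpectrum (T.restrict hinvP) = σ := by
    ext q
    refine ⟨fun hq => by_contra fun h => hq (hunitP q h), fun hq h => ?_⟩
    exact hboth q (hunion ▸ Or.inl hq) h (hunitQ q (hdisj.notMem_of_mem_left hq))
  have hspQ : sphericalSpectrum (T.restrict hinvQ) = τ := by
    ext q
    refine ⟨fun hq => by_contra fun h => hq (hunitQ q h), fun hq h => ?_⟩
    exact hboth q (hunion ▸ Or.inr hq) (hunitP q (hdisj.notMem_of_mem_right hq)) h
  -- On the zero space every `Δ_q` is invertible, so the spectrum would be empty, whereas `σ` is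
  -- not.
  have hPbot : LinearMap.range (P : H →ₗ[ℍᵐᵒᵖ] H) ≠ ⊥ := fun h => by
    have : Subsingleton (LinearMap.range (P : H →ₗ[ℍᵐᵒᵖ] H)) :=
      Submodule.subsingleton_iff_eq_bot.2 h
    rw [sphericalSpectrum_of_subsingleton] at hspP
    exact hσ.ne_empty hspP.symm
  have hQbot : LinearMap.range (Q : H →ₗ[ℍᵐᵒᵖ] H) ≠ ⊥ := fun h => by
    have : Subsingleton (LinearMap.range (Q : H →ₗ[ℍᵐᵒᵖ] H)) :=
      Submodule.subsingleton_iff_eq_bot.2 h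
    rw [sphericalSpectrum_of_subsingleton] at hspQ
    exact hτ.ne_empty hspQ.symm
  refine ⟨P, Q, _, _, hP, hQ, hPP, hQQ, hPQ, hTP, hTQ, rfl, rfl, isClosed_range_of_idempotent hPP,
    isClosed_range_of_idempotent hQQ, hPbot, fun h => ?_, hQbot, fun h => ?_, hcompl,
    ⟨hinvP, hspP⟩, ⟨hinvQ, hspQ⟩⟩
  · exact hQbot (eq_bot_of_top_isCompl (h ▸ hcompl))
  · exact hPbot (eq_bot_of_isCompl_top (h ▸ hcompl))
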